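/- Let $n\ge 3$ and let $(M^{2n},\omega)$ be a compact symplectic manifold (smooth, Hausdorff, without boundary, of dimension $2n$; not necessarily connected). Suppose that $\omega$ evaluates nontrivially on $\pi_2(M)$: for some base point $x\in M$ and some $\alpha\in\pi_2(M,x)$ one has $\langle\omega,\alpha\rangle\neq 0$, where $\langle\omega,\alpha\rangle=\int_{[0,1]^2}u^*\omega$ for any smooth map $u$ from the square $[0,1]^2$ to $M$, sending the boundary of the square to $x$, that represents $\alpha$. Then there are a smooth embedding $f:S^2\to M$ and a real number $k>0$ such that $$f^*[\omega]=k\,[\omega_0]\quad\text{in } H^2_{\mathrm{dR}}(S^2;\mathbb R),$$ that is, $f^*\omega-k\,\omega_0=d\beta$ for some smooth 1-form $\beta$ on $S^2$. Here $\omega_0$ is the standard symplectic form of the unit sphere $S^2\subset\mathbb R^3$, $(\omega_0)_p(v,w)=\det(p,v,w)$ for $v,w\in T_pS^2$. -/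

import Mathlib

open scoped Manifold ContDiff Topology Matrix

noncomputable section

/- Use the identity chart as the manifold structure of `ℝᵐ`. -/
attribute [local instance high] chartedSpaceSelf

/-- A (not necessarily smooth) differential `k`-form on an `m`-dimensional manifold `M` without
boundary: an alternating `k`-linear form on each tangent space. -/
abbrev DForm (m : ℕ) (M : Type*) [TopologicalSpace M] [ChartedSpace (EuclideanSpace ℝ (Fin m)) M]
    (k : ℕ) : Type _ :=
  (x : M) → TangentSpace (𝓡 m) x [⋀^Fin k]→L[ℝ] ℝ

namespace DForm

section General

variable {m l k : ℕ}
  {M : Type*} [TopologicalSpace M] [ChartedSpace (EuclideanSpace ℝ (Fin m)) M]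
  {N : Type*} [TopologicalSpace N] [ChartedSpace (EuclideanSpace ℝ (Fin l)) N]

/-- The pullback of a differential form along a map `f` (meaningful where `f` is differentiable):
`(f^*η)_x (v₁, …, v_k) = η_{f x} (df_x v₁, …, df_x v_k)`. -/
def pullback (f : N → M) (η : DForm m M k) : DForm l N k :=
  fun x => (η (f x)).compContinuousLinearMap (mfderiv (𝓡 l) (𝓡 m) f x)

/-- The expression of a form in the chart of `M` around `x₀`, that is, its pullback along the
inverse of that chart. It is meaningful on the target of the chart, an open subset of `ℝᵐ`. -/
def inChart (η : DForm m M k) (x₀ : M) :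
    EuclideanSpace ℝ (Fin m) → EuclideanSpace ℝ (Fin m) [⋀^Fin k]→L[ℝ] ℝ :=
  fun y => (η ((extChartAt (𝓡 m) x₀).symm y)).compContinuousLinearMap
    (mfderiv (𝓡 m) (𝓡 m) (extChartAt (𝓡 m) x₀).symm y)

/-- A form is smooth if its coefficients are smooth in charts. -/
def IsSmooth (η : DForm m M k) : Prop :=
  ∀ x₀ : M, ContDiffOn ℝ ∞ (η.inChart x₀) (extChartAt (𝓡 m) x₀).target

/-- The exterior derivative of a (smooth) form: at `x`, it is the exterior derivative of the
expression of the form in the chart around `x`, carried back to the tangent space at `x`. -/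
def d (η : DForm m M k) : DForm m M (k + 1) :=
  fun x => (extDeriv (η.inChart x) (extChartAt (𝓡 m) x x)).compContinuousLinearMap
    (mfderiv (𝓡 m) (𝓡 m) (extChartAt (𝓡 m) x) x)

/-- Two (closed smooth) `(k + 1)`-forms have the same de Rham cohomology class: they differ by the
exterior derivative of a smooth `k`-form. -/
def Cohomologous (η θ : DForm m M (k + 1)) : Prop :=
  ∃ β : DForm m M k, β.IsSmooth ∧ η - θ = β.d

/-- A symplectic form: a smooth, closed, nondegenerate 2-form. -/
structure IsSymplectic (η : DForm m M 2) : Prop where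
  smooth : η.IsSmooth
  closed : η.d = 0
  nondegenerate : ∀ (x : M) (v : TangentSpace (𝓡 m) x),
    (∀ w : TangentSpace (𝓡 m) x, η x ![v, w] = 0) → v = 0

/-- The integral over the unit square `[0,1]²` of a 2-form on the plane. -/
def integralSquare (η : DForm 2 (EuclideanSpace ℝ (Fin 2)) 2) : ℝ :=
  ∫ s in (0 : ℝ)..1, ∫ t in (0 : ℝ)..1,
    η !₂[s, t] ![EuclideanSpace.single 0 1, EuclideanSpace.single 1 1]

/-- The relation `⟨η, α⟩ = c` between a closed 2-form `η`, a class `α ∈ π₂(M, x)` and a real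
number `c`: the class `α` is represented by a smooth map `u` of the unit square (sending the
boundary of the square to `x`) over which the integral of `η`, i.e. `∫_{[0,1]²} u^*η`, is `c`. -/
def EvaluatesTo (η : DForm m M 2) {x : M} (α : HomotopyGroup.Pi 2 M x) (c : ℝ) : Prop :=
  ∃ (u : EuclideanSpace ℝ (Fin 2) → M) (γ : GenLoop (Fin 2) M x),
    ContMDiff (𝓡 2) (𝓡 m) ∞ u ∧
    (∀ t : Fin 2 → unitInterval, γ t = u (WithLp.toLp 2 fun i => (t i : ℝ))) ∧
    α = (⟦γ⟧ : HomotopyGroup (Fin 2) M x) ∧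
    integralSquare (pullback u η) = c

/-- A closed 2-form evaluates nontrivially on `π₂(M)`: its value on some element of `π₂(M, x)`,
for some base point `x`, is nonzero. -/
def EvaluatesNontriviallyOnPi2 (η : DForm m M 2) : Prop :=
  ∃ (x : M) (α : HomotopyGroup.Pi 2 M x) (c : ℝ), η.EvaluatesTo α c ∧ c ≠ 0

end General

end DForm

/-- The unit sphere `S²` in `ℝ³`, with Mathlib's manifold structure. -/
abbrev S2 : Type := Metric.sphere (0 : EuclideanSpace ℝ (Fin 3)) 1

/-- The alternating form `(v, w) ↦ det (p, v, w) = p ⬝ (v × w)` on `ℝ³`. -/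
def tripleProduct (p : EuclideanSpace ℝ (Fin 3)) :
    EuclideanSpace ℝ (Fin 3) [⋀^Fin 2]→L[ℝ] ℝ where
  toFun v := p.ofLp ⬝ᵥ ((v 0).ofLp ⨯₃ (v 1).ofLp)
  map_update_add' := by
    intro inst v i a b
    rw [Subsingleton.elim inst (instDecidableEqFin 2)]
    fin_cases i <;> simp
  map_update_smul' := by
    intro inst v i c a
    rw [Subsingleton.elim inst (instDecidableEqFin 2)]
    fin_cases i <;> simp
  map_eq_zero_of_eq' v i j h hij := by
    fin_cases i <;> fin_cases j <;> simp_all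
  cont := by
    simp only [cross_apply, Matrix.vec3_dotProduct]
    simp only [Matrix.cons_val]
    fun_prop

/-- The standard symplectic form on `S²`, i.e. the area form of the unit sphere oriented by the
outward normal: `(ω₀)_p (v, w) = det (p, v, w)` for tangent vectors `v, w ∈ T_p S² ⊆ ℝ³`. -/
def standardFormS2 : DForm 2 S2 2 :=
  fun p => (tripleProduct (p : EuclideanSpace ℝ (Fin 3))).compContinuousLinearMap
    (mfderiv (𝓡 2) (𝓡 3) (fun q : S2 => (q : EuclideanSpace ℝ (Fin 3))) p)

end

/-! Integration identifies the second cohomology of the sphere with `ℝ`, so `f^*[ω]` is a positive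
multiple of `[ω₀]` as soon as the integrals of `f^*ω` and `ω₀` have the same sign. It remains to
find an embedding for which this sign is right.

A smooth square with boundary sent to `x` and nonzero `ω`-area closes up to a smooth sphere `g` once
its two coordinates are reparametrized to be constant near their ends; reversing one coordinate if
necessary gives the desired sign (`S2.exists_integral_neg`). The sign is an open condition, so it
survives small perturbations of `g`. As the dimension of `M` exceeds `4 = 2 + 2`, general position
supplies arbitrarily small perturbations that are injective immersions
(`S2.exists_injective_immersion`), and these are embeddings because the sphere is compact and `M` is
Hausdorff (`isSmoothEmbedding_of_injective`).

General position rests on finitely many functions `μ` on the sphere, each supported over one chart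
of `M`, that jointly separate points and tangent vectors. A map is moved by `μ p • a` in the chart.
The vectors `a` that identify two points with different values of `μ`, or kill a tangent vector on
which `dμ` is nonzero, are smooth images of open sets of dimension four; they have Hausdorff
dimension at most four, hence dense complement (`S2.dense_compl_badSet`). After one such move for
each function, a surviving double point or critical vector would be invisible to all the functions,
which is impossible (`S2.exists_separated_by`).

For the cohomology (`S2.exists_cohomologous_standardFormS2`), an exact correction makes a 2-form
vanish near a pole, hence compactly supported in the opposite stereographic plane; there the
Poincaré lemma with compact supports (`Plane.exists_compact_primitive`) reduces it to a multiple of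
a fixed bump form, and the multiple is detected by the integral. Integrals are computed through
`S2.cap`, a modification of the inverse stereographic projection from the north pole. That
projection reverses the outward-normal orientation, so `ω₀` has negative integral and the right sign
is negative throughout. -/

noncomputable section

attribute [local instance high] chartedSpaceSelf

/-! ### Smoothness of the pullback of alternating forms by linear maps -/

section Alternating
variable {E F : Type*} [NormedAddCommGroup E] [NormedSpace ℝ E] [FiniteDimensional ℝ E]
  [NormedAddCommGroup F] [NormedSpace ℝ F]

instance ContinuousMultilinearMap.finiteDimensional_real {k : ℕ} :
    FiniteDimensional ℝ (ContinuousMultilinearMap ℝ (fun _ : Fin k => E) ℝ) :=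
  FiniteDimensional.of_injective
    (ContinuousMultilinearMap.toMultilinearMapLinear :
      ContinuousMultilinearMap ℝ (fun _ : Fin k => E) ℝ →ₗ[ℝ] _)
    ContinuousMultilinearMap.toMultilinearMap_injective

/-- Forgetting alternation embeds the forms on `E` in a finite-dimensional space of multilinear
forms, where composition is linear in the form and multilinear in the maps. A linear left inverse of
the embedding, continuous by finite dimension, carries smoothness back. -/
theorem contDiff_compContinuousLinearMap {k : ℕ} :
    ContDiff ℝ ∞ fun p : (F [⋀^Fin k]→L[ℝ] ℝ) × (E →L[ℝ] F) =>
      p.1.compContinuousLinearMap p.2 := by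
  let L : (E [⋀^Fin k]→L[ℝ] ℝ) →L[ℝ] ContinuousMultilinearMap ℝ (fun _ : Fin k => E) ℝ :=
    ContinuousAlternatingMap.toContinuousMultilinearMapCLM ℝ
  have hL : Function.Injective L := ContinuousAlternatingMap.toContinuousMultilinearMap_injective
  obtain ⟨G, hG⟩ := LinearMap.exists_leftInverse_of_injective L.toLinearMap
    (LinearMap.ker_eq_bot.2 hL)
  have hG' : ∀ x, LinearMap.toContinuousLinearMap G (L x) = x := fun x => LinearMap.congr_fun hG x
  have h1 : ContDiff ℝ ∞ fun p : (F [⋀^Fin k]→L[ℝ] ℝ) × (E →L[ℝ] F) =>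
      p.1.toContinuousMultilinearMap.compContinuousLinearMap (fun _ => p.2) := by
    let B := ContinuousMultilinearMap.compContinuousLinearMapContinuousMultilinear ℝ
      (fun _ : Fin k => E) (fun _ : Fin k => F) ℝ
    have hB : ContDiff ℝ ∞ fun p : (F [⋀^Fin k]→L[ℝ] ℝ) × (E →L[ℝ] F) => B fun _ => p.2 :=
      (ContinuousMultilinearMap.contDiff (𝕜 := ℝ) (ι := Fin k) (E := fun _ => E →L[ℝ] F)
        (F := ContinuousMultilinearMap ℝ (fun _ : Fin k => F) ℝ →L[ℝ]
          ContinuousMultilinearMap ℝ (fun _ : Fin k => E) ℝ) B).comp (contDiff_pi.2 fun _ => contDiff_snd)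
    exact hB.clm_apply
      (((ContinuousAlternatingMap.toContinuousMultilinearMapLI (𝕜 := ℝ) (E := F) (ι := Fin k)
        (F := ℝ)).contDiff).comp contDiff_fst)
  have h2 := (LinearMap.toContinuousLinearMap G).contDiff.comp h1
  convert! h2 using 2 with p
  exact (hG' (p.1.compContinuousLinearMap p.2)).symm

end Alternating

/-! ### Pullbacks and exterior derivatives of forms on manifolds -/

namespace DForm
variable {m l k r : ℕ}
  {M : Type*} [TopologicalSpace M] [ChartedSpace (EuclideanSpace ℝ (Fin m)) M]
  {N : Type*} [TopologicalSpace N] [ChartedSpace (EuclideanSpace ℝ (Fin l)) N]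
  {P : Type*} [TopologicalSpace P] [ChartedSpace (EuclideanSpace ℝ (Fin r)) P]

theorem pullback_comp_apply {f : N → M} {g : P → N} (η : DForm m M k) {x : P}
    (hf : MDifferentiableAt (𝓡 l) (𝓡 m) f (g x)) (hg : MDifferentiableAt (𝓡 r) (𝓡 l) g x) :
    pullback (l := r) (f ∘ g) η x = pullback (l := r) g (pullback (l := l) f η) x := by
  simp only [pullback]
  rw [mfderiv_comp x hf hg]
  rfl

theorem pullback_congr {f g : N → M} (η : DForm m M k) {x : N} (h : f =ᶠ[𝓝 x] g) :
    pullback (l := l) f η x = pullback (l := l) g η x := by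
  have h1 := h.mfderiv_eq (I := 𝓡 l) (I' := 𝓡 m)
  have h2 := h.eq_of_nhds
  simp only [pullback]
  ext v
  simp only [ContinuousAlternatingMap.compContinuousLinearMap_apply]
  rw [h1]
  congr 1
  rw [h2]

/-- The pullback along a map from a Euclidean space, as a form with Euclidean source. -/
abbrev epullback (h : EuclideanSpace ℝ (Fin l) → M) (η : DForm m M k) :
    EuclideanSpace ℝ (Fin l) → EuclideanSpace ℝ (Fin l) [⋀^Fin k]→L[ℝ] ℝ :=
  pullback (l := l) h η

/-- Inserting the chart and its inverse after `h` turns a pullback from `M` into a pullback of a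
form on `ℝᵐ` along `φ ∘ h`, a map between vector spaces. Smoothness of pullbacks and naturality of
`d` both reduce to this. -/
theorem epullback_eq_inChart [IsManifold (𝓡 m) ∞ M] (η : DForm m M k)
    {h : EuclideanSpace ℝ (Fin l) → M} {y : EuclideanSpace ℝ (Fin l)} {x₀ : M}
    (hh : MDifferentiableAt (𝓡 l) (𝓡 m) h y) (hy : h y ∈ (chartAt (EuclideanSpace ℝ (Fin m)) x₀).source) :
    epullback h η y = (η.inChart x₀ (extChartAt (𝓡 m) x₀ (h y))).compContinuousLinearMap
      (fderiv ℝ (extChartAt (𝓡 m) x₀ ∘ h) y) := by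
  have hev : h =ᶠ[𝓝 y] (extChartAt (𝓡 m) x₀).symm ∘ (extChartAt (𝓡 m) x₀ ∘ h) := by
    have : ∀ᶠ z in 𝓝 y, h z ∈ (chartAt (EuclideanSpace ℝ (Fin m)) x₀).source :=
      hh.continuousAt.eventually ((chartAt (EuclideanSpace ℝ (Fin m)) x₀).open_source.mem_nhds hy)
    filter_upwards [this] with z hz
    simp only [Function.comp]
    rw [(extChartAt (𝓡 m) x₀).left_inv (by rwa [extChartAt_source])]
  have h1 : MDifferentiableAt (𝓡 l) (𝓡 m) (extChartAt (𝓡 m) x₀ ∘ h) y :=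
    (mdifferentiableAt_extChartAt hy).comp y hh
  have h2 : MDifferentiableAt (𝓡 m) (𝓡 m) (extChartAt (𝓡 m) x₀).symm
      ((extChartAt (𝓡 m) x₀ ∘ h) y) := by
    have hz : (extChartAt (𝓡 m) x₀ (h y)) ∈ (extChartAt (𝓡 m) x₀).target :=
      (extChartAt (𝓡 m) x₀).map_source (by rwa [extChartAt_source])
    have := mdifferentiableWithinAt_extChartAt_symm (I := 𝓡 m) hz
    rw [modelWithCornersSelf_coe, Set.range_id] at this
    exact this.mdifferentiableAt Filter.univ_mem
  rw [epullback, pullback_congr η hev, pullback_comp_apply η h2 h1]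
  simp only [pullback, inChart, ← mfderiv_eq_fderiv]
  rfl

theorem contDiffOn_epullback [IsManifold (𝓡 m) ∞ M] {η : DForm m M k} (hη : η.IsSmooth)
    {h : EuclideanSpace ℝ (Fin l) → M} {O : Set (EuclideanSpace ℝ (Fin l))} (hO : IsOpen O)
    (hh : ContMDiffOn (𝓡 l) (𝓡 m) ∞ h O) : ContDiffOn ℝ ∞ (epullback h η) O := by
  intro y hy
  apply ContDiffAt.contDiffWithinAt
  set φ := extChartAt (𝓡 m) (h y)
  have hcont : ContinuousAt h y := (hh y hy).continuousWithinAt.continuousAt (hO.mem_nhds hy)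
  set O' := O ∩ h ⁻¹' (chartAt (EuclideanSpace ℝ (Fin m)) (h y)).source
  have hO' : IsOpen O' := hh.continuousOn.isOpen_inter_preimage hO
    (chartAt (EuclideanSpace ℝ (Fin m)) (h y)).open_source
  have hy' : y ∈ O' := ⟨hy, mem_chart_source _ _⟩
  have h1 : ContDiffOn ℝ ∞ (φ ∘ h) O' := by
    rw [← contMDiffOn_iff_contDiffOn]
    refine (contMDiffOn_extChartAt (x := h y)).comp (hh.mono Set.inter_subset_left) ?_
    exact fun z hz => hz.2
  have h2 : ContDiffOn ℝ ∞ (fun z => ((η.inChart (h y) (φ (h z))).compContinuousLinearMap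
      (fderiv ℝ (φ ∘ h) z) : EuclideanSpace ℝ (Fin l) [⋀^Fin k]→L[ℝ] ℝ)) O' := by
    refine contDiff_compContinuousLinearMap.comp_contDiffOn (ContDiffOn.prodMk ?_ ?_)
    · refine (hη (h y)).comp h1 ?_
      intro z hz
      exact φ.map_source (by simpa [φ, extChartAt_source] using hz.2)
    · exact h1.fderiv_of_isOpen hO' (by simp)
  refine ((h2 y hy').contDiffAt (hO'.mem_nhds hy')).congr_of_eventuallyEq ?_
  filter_upwards [hO'.mem_nhds hy'] with z hz
  refine epullback_eq_inChart η ?_ hz.2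
  exact ((hh z hz.1).contMDiffAt (hO.mem_nhds hz.1)).mdifferentiableAt (by simp)

/-- Since `d` at `h y` is defined in the chart at `h y`, working in that very chart leaves only the
naturality of `extDeriv` under a map of Euclidean spaces; no independence of the chart has to be
known beforehand. -/
theorem epullback_d [IsManifold (𝓡 m) ∞ M] {η : DForm m M k} (hη : η.IsSmooth)
    {h : EuclideanSpace ℝ (Fin l) → M} {O : Set (EuclideanSpace ℝ (Fin l))} (hO : IsOpen O)
    (hh : ContMDiffOn (𝓡 l) (𝓡 m) ∞ h O) {y : EuclideanSpace ℝ (Fin l)} (hy : y ∈ O) :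
    epullback h η.d y = extDeriv (epullback h η) y := by
  set φ := extChartAt (𝓡 m) (h y)
  have hmd : ∀ z ∈ O, MDifferentiableAt (𝓡 l) (𝓡 m) h z := fun z hz =>
    ((hh z hz).contMDiffAt (hO.mem_nhds hz)).mdifferentiableAt (by simp)
  have hsrc : h y ∈ (chartAt (EuclideanSpace ℝ (Fin m)) (h y)).source := mem_chart_source _ _
  have hev : epullback h η =ᶠ[𝓝 y] fun z => (η.inChart (h y) ((φ ∘ h) z)).compContinuousLinearMap
      (fderiv ℝ (φ ∘ h) z) := by
    have : ∀ᶠ z in 𝓝 y, h z ∈ (chartAt (EuclideanSpace ℝ (Fin m)) (h y)).source :=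
      (hmd y hy).continuousAt.eventually
        ((chartAt (EuclideanSpace ℝ (Fin m)) (h y)).open_source.mem_nhds hsrc)
    filter_upwards [this, hO.mem_nhds hy] with z hz hzO
    exact epullback_eq_inChart η (hmd z hzO) hz
  have h1 : ContDiffAt ℝ ∞ (φ ∘ h) y := by
    rw [← contMDiffAt_iff_contDiffAt]
    exact (contMDiffAt_extChartAt (x := h y)).comp y ((hh y hy).contMDiffAt (hO.mem_nhds hy))
  have h2 : DifferentiableAt ℝ (η.inChart (h y)) ((φ ∘ h) y) := by
    have ht : (φ ∘ h) y ∈ φ.target := mem_extChartAt_target (h y)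
    have hopen : IsOpen φ.target := isOpen_extChartAt_target (h y)
    exact ((hη (h y) _ ht).contDiffAt (hopen.mem_nhds ht)).differentiableAt (by simp)
  rw [hev.extDeriv_eq, extDeriv_pullback h2 h1 (by simpa using (WithTop.coe_le_coe.2 le_top : ((2 : ℕ∞) : WithTop ℕ∞) ≤ ∞))]
  have : fderiv ℝ (φ ∘ h) y = (mfderiv (𝓡 m) (𝓡 m) φ (h y)).comp (mfderiv (𝓡 l) (𝓡 m) h y) := by
    rw [← mfderiv_eq_fderiv, mfderiv_comp y (mdifferentiableAt_extChartAt hsrc) (hmd y hy)]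
  rw [this]
  rfl

theorem inChart_eq_epullback (η : DForm m M k) (x₀ : M) :
    η.inChart x₀ = epullback (extChartAt (𝓡 m) x₀).symm η := rfl

theorem IsSmooth.pullback [IsManifold (𝓡 m) ∞ M] [IsManifold (𝓡 l) ∞ N] {η : DForm m M k}
    (hη : η.IsSmooth) {f : N → M} (hf : ContMDiff (𝓡 l) (𝓡 m) ∞ f) :
    (DForm.pullback (l := l) f η).IsSmooth := by
  intro x₀
  have hopen : IsOpen (extChartAt (𝓡 l) x₀).target := isOpen_extChartAt_target x₀
  have hs : ContMDiffOn (𝓡 l) (𝓡 l) ∞ (extChartAt (𝓡 l) x₀).symm (extChartAt (𝓡 l) x₀).target :=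
    contMDiffOn_extChartAt_symm x₀
  refine (contDiffOn_epullback hη hopen (hf.comp_contMDiffOn hs)).congr ?_
  intro y hy
  rw [inChart_eq_epullback]
  refine (pullback_comp_apply η (hf.mdifferentiableAt (by simp)) ?_).symm
  exact ((hs y hy).contMDiffAt (hopen.mem_nhds hy)).mdifferentiableAt (by simp)

end DForm

/-! ### Smooth dependence of integrals on parameters -/

section ParametricIntegral
universe u
variable {V : Type u} [NormedAddCommGroup V] [NormedSpace ℝ V] [FiniteDimensional ℝ V]

theorem hasFDerivAt_integral_zero_one {F : Type u} [NormedAddCommGroup F] [NormedSpace ℝ F]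
    {φ : V × ℝ → F} (hφ : ContDiff ℝ 1 φ) (z : V) :
    HasFDerivAt (fun z => ∫ t in (0 : ℝ)..1, φ (z, t))
      (∫ t in (0 : ℝ)..1, (fderiv ℝ φ (z, t)).comp (ContinuousLinearMap.inl ℝ V ℝ)) z := by
  have hd : Continuous fun p : V × ℝ => (fderiv ℝ φ p).comp (ContinuousLinearMap.inl ℝ V ℝ) :=
    (hφ.continuous_fderiv one_ne_zero).clm_comp continuous_const
  obtain ⟨C, hC⟩ := ((isCompact_closedBall z 1).prod (isCompact_Icc (a := (0 : ℝ))
    (b := 1))).exists_bound_of_continuousOn hd.continuousOn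
  refine intervalIntegral.hasFDerivAt_integral_of_dominated_of_fderiv_le
    (F' := fun z t => (fderiv ℝ φ (z, t)).comp (ContinuousLinearMap.inl ℝ V ℝ))
    (bound := fun _ => C) (Metric.ball_mem_nhds z one_pos) ?_ ?_ ?_ ?_ ?_ ?_
  · exact Filter.Eventually.of_forall fun w =>
      (hφ.continuous.comp (by fun_prop : Continuous fun t : ℝ => (w, t))).aestronglyMeasurable
  · exact (hφ.continuous.comp
      (by fun_prop : Continuous fun t : ℝ => (z, t))).intervalIntegrable _ _
  · exact (hd.comp (by fun_prop : Continuous fun t : ℝ => (z, t))).aestronglyMeasurable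
  · refine Filter.Eventually.of_forall fun t ht w hw => hC (w, t) ⟨Metric.ball_subset_closedBall hw, ?_⟩
    rw [Set.uIoc_of_le zero_le_one] at ht
    exact ⟨ht.1.le, ht.2⟩
  · exact intervalIntegrable_const
  · refine Filter.Eventually.of_forall fun t _ w _ => ?_
    have h1 : HasFDerivAt φ (fderiv ℝ φ (w, t)) (w, t) :=
      (hφ.differentiable one_ne_zero _).hasFDerivAt
    exact h1.comp w (hasFDerivAt_prodMk_left w t)

/-- The derivative is again an integral of the same kind, with values in `V →L[ℝ] F`; hence the
target is quantified inside the induction, and `V` and `F` share a universe. -/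
theorem contDiff_integral_zero_one_nat (n : ℕ) : ∀ {F : Type u} [NormedAddCommGroup F]
    [NormedSpace ℝ F] {φ : V × ℝ → F}, ContDiff ℝ ∞ φ →
    ContDiff ℝ n (fun z => ∫ t in (0 : ℝ)..1, φ (z, t)) := by
  induction n with
  | zero =>
    intro F _ _ φ hφ
    refine contDiff_zero.2 ?_
    exact intervalIntegral.continuous_parametric_intervalIntegral_of_continuous'
      (f := fun z t => φ (z, t)) hφ.continuous 0 1
  | succ n ih =>
    intro F _ _ φ hφ
    have h1 := fun z => hasFDerivAt_integral_zero_one (hφ.of_le (by exact_mod_cast le_top)) z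
    rw [Nat.cast_succ]
    refine contDiff_succ_iff_fderiv.2 ⟨fun z => (h1 z).differentiableAt,
      fun h => absurd h (by exact_mod_cast WithTop.coe_ne_top), ?_⟩
    rw [funext fun z => (h1 z).fderiv]
    exact ih (φ := fun p => (fderiv ℝ φ p).comp (ContinuousLinearMap.inl ℝ V ℝ))
      ((hφ.fderiv_right (m := ∞) le_rfl).clm_comp contDiff_const)

theorem contDiff_integral_zero_one {F : Type u} [NormedAddCommGroup F] [NormedSpace ℝ F]
    {φ : V × ℝ → F} (hφ : ContDiff ℝ ∞ φ) :
    ContDiff ℝ ∞ (fun z => ∫ t in (0 : ℝ)..1, φ (z, t)) :=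
  contDiff_infty.2 fun n => contDiff_integral_zero_one_nat n hφ

theorem contDiff_integral_upper {V : Type} [NormedAddCommGroup V] [NormedSpace ℝ V]
    [FiniteDimensional ℝ V] {φ : V → ℝ → ℝ} (hφ : ContDiff ℝ ∞ fun p : V × ℝ => φ p.1 p.2)
    {u : V → ℝ} (hu : ContDiff ℝ ∞ u) (a : ℝ) :
    ContDiff ℝ ∞ (fun z => ∫ s in a..u z, φ z s) := by
  -- The substitution `s = a + (u z - a) * t` moves the variable endpoint into the integrand.
  have h : (fun z => ∫ s in a..u z, φ z s) =
      fun z => ∫ t in (0 : ℝ)..1, (u z - a) * φ z (a + (u z - a) * t) := by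
    ext z
    rw [intervalIntegral.integral_const_mul]
    have := intervalIntegral.mul_integral_comp_add_mul (a := 0) (b := 1) (f := φ z) (c := u z - a) (d := a)
    simp only [mul_zero, add_zero, mul_one, add_sub_cancel] at this
    exact this.symm
  rw [h]
  refine contDiff_integral_zero_one (φ := fun p => (u p.1 - a) * φ p.1 (a + (u p.1 - a) * p.2)) ?_
  have hu' : ContDiff ℝ ∞ fun p : V × ℝ => u p.1 := hu.comp contDiff_fst
  have h2 : ContDiff ℝ ∞ fun p : V × ℝ => (p.1, a + (u p.1 - a) * p.2) :=
    contDiff_fst.prodMk (contDiff_const.add ((hu'.sub contDiff_const).mul contDiff_snd))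
  exact (hu'.sub contDiff_const).mul (hφ.comp h2)

end ParametricIntegral

/-- The Euclidean plane. -/
abbrev Plane : Type := EuclideanSpace ℝ (Fin 2)

/-! ### Calculus of forms on the plane and Stokes' theorem on a square -/

namespace Plane

abbrev e₀ : Plane := EuclideanSpace.single 0 1
abbrev e₁ : Plane := EuclideanSpace.single 1 1

theorem contDiff_coord (i : Fin 2) : ContDiff ℝ ∞ fun y : Plane => y i :=
  (EuclideanSpace.proj i : Plane →L[ℝ] ℝ).contDiff

theorem contDiff_mk {V : Type*} [NormedAddCommGroup V] [NormedSpace ℝ V] {a b : V → ℝ}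
    (ha : ContDiff ℝ ∞ a) (hb : ContDiff ℝ ∞ b) : ContDiff ℝ ∞ fun z => (!₂[a z, b z] : Plane) := by
  rw [contDiff_euclidean]
  intro i
  fin_cases i <;> simpa

theorem mk_coord (y : Plane) : !₂[y 0, y 1] = y := by
  ext i; fin_cases i <;> simp

theorem eq_smul_add_smul (v : Plane) : v = v 0 • e₀ + v 1 • e₁ := by
  ext i; fin_cases i <;> simp

/-- Alternating 2-forms on the plane are determined by their value on the standard basis. -/
theorem ext_two {η η' : Plane [⋀^Fin 2]→L[ℝ] ℝ} (h : η ![e₀, e₁] = η' ![e₀, e₁]) : η = η' := by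
  apply ContinuousAlternatingMap.toAlternatingMap_injective
  refine Module.Basis.ext_alternating (EuclideanSpace.basisFun (Fin 2) ℝ).toBasis ?_
  intro v hv
  have key : ∀ θ : Plane [⋀^Fin 2]→L[ℝ] ℝ, θ ![e₁, e₀] = - θ ![e₀, e₁] := by
    intro θ
    have := θ.map_swap ![e₀, e₁] (i := 0) (j := 1) (by simp)
    have h2 : ![e₀, e₁] ∘ Equiv.swap (0 : Fin 2) 1 = ![e₁, e₀] := by
      ext i j; fin_cases i <;> simp
    rw [h2] at this
    exact this
  have h0 : v 0 = 0 ∧ v 1 = 1 ∨ v 0 = 1 ∧ v 1 = 0 := by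
    have : v 0 ≠ v 1 := fun h => by simpa using hv h
    revert this
    generalize v 0 = p
    generalize v 1 = q
    revert p q; decide
  have hv' : (fun i => (EuclideanSpace.basisFun (Fin 2) ℝ).toBasis (v i)) =
      ![EuclideanSpace.single (v 0) 1, EuclideanSpace.single (v 1) 1] := by
    ext i j; fin_cases i <;> simp
  rw [hv']
  rcases h0 with ⟨h0, h1⟩ | ⟨h0, h1⟩
  · rw [h0, h1]; exact h
  · rw [h0, h1]
    change η ![e₁, e₀] = η' ![e₁, e₀]
    rw [key, key, h]

/-- The 1-form `a dx + b dy`. -/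
def oneForm (a b : ℝ) : Plane [⋀^Fin 1]→L[ℝ] ℝ :=
  ContinuousAlternatingMap.ofSubsingleton ℝ Plane ℝ (0 : Fin 1)
    (a • (EuclideanSpace.proj 0 : Plane →L[ℝ] ℝ) + b • (EuclideanSpace.proj 1 : Plane →L[ℝ] ℝ))

theorem oneForm_apply (a b : ℝ) (v : Fin 1 → Plane) : oneForm a b v = a * v 0 0 + b * v 0 1 := by
  simp [oneForm]

theorem contDiff_oneForm {a b : Plane → ℝ} (ha : ContDiff ℝ ∞ a) (hb : ContDiff ℝ ∞ b) :
    ContDiff ℝ ∞ fun y => oneForm (a y) (b y) := by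
  have h : ∀ y, oneForm (a y) (b y) = a y • oneForm 1 0 + b y • oneForm 0 1 := by
    intro y; ext v; simp [oneForm_apply]
  simp only [h]
  exact (ha.smul contDiff_const).add (hb.smul contDiff_const)

theorem extDeriv_apply_basis {η : Plane → Plane [⋀^Fin 1]→L[ℝ] ℝ} {y : Plane}
    (h : DifferentiableAt ℝ η y) : extDeriv η y ![e₀, e₁] =
      fderiv ℝ (fun z => η z ![e₁]) y e₀ - fderiv ℝ (fun z => η z ![e₀]) y e₁ := by
  rw [extDeriv_apply h]
  have h0 : Fin.removeNth 0 ![e₀, e₁] = ![e₁] := by ext i j; fin_cases i; simp [Fin.removeNth]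
  have h1 : Fin.removeNth 1 ![e₀, e₁] = ![e₀] := by ext i j; fin_cases i; simp [Fin.removeNth]
  rw [Fin.sum_univ_two, h0, h1]
  simp [sub_eq_add_neg]

theorem extDeriv_oneForm {a b : Plane → ℝ} (ha : ContDiff ℝ ∞ a) (hb : ContDiff ℝ ∞ b)
    (y : Plane) : extDeriv (fun y => oneForm (a y) (b y)) y ![e₀, e₁] =
      fderiv ℝ b y e₀ - fderiv ℝ a y e₁ := by
  rw [extDeriv_apply_basis ((contDiff_oneForm ha hb).differentiable (by simp) y)]
  simp [oneForm_apply]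

theorem fderiv_e₀ {f : Plane → ℝ} (hf : ContDiff ℝ ∞ f) (y : Plane) {c : ℝ}
    (h : HasDerivAt (fun s => f !₂[s, y 1]) c (y 0)) : fderiv ℝ f y e₀ = c := by
  have h1 : HasFDerivAt f (fderiv ℝ f y) !₂[y 0, y 1] := by
    rw [mk_coord]; exact (hf.differentiable (by simp) y).hasFDerivAt
  have h2 : HasDerivAt (fun s : ℝ => (!₂[s, y 1] : Plane)) e₀ (y 0) := by
    have : (fun s : ℝ => (!₂[s, y 1] : Plane)) = fun s => s • e₀ + y 1 • e₁ := by
      ext s i; fin_cases i <;> simp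
    rw [this]
    simpa using ((hasDerivAt_id (y 0)).smul_const e₀).add_const (y 1 • e₁)
  exact (h1.comp_hasDerivAt (y 0) h2).unique h

theorem fderiv_e₁ {f : Plane → ℝ} (hf : ContDiff ℝ ∞ f) (y : Plane) {c : ℝ}
    (h : HasDerivAt (fun t => f !₂[y 0, t]) c (y 1)) : fderiv ℝ f y e₁ = c := by
  have h1 : HasFDerivAt f (fderiv ℝ f y) !₂[y 0, y 1] := by
    rw [mk_coord]; exact (hf.differentiable (by simp) y).hasFDerivAt
  have h2 : HasDerivAt (fun t : ℝ => (!₂[y 0, t] : Plane)) e₁ (y 1) := by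
    have : (fun t : ℝ => (!₂[y 0, t] : Plane)) = fun t => y 0 • e₀ + t • e₁ := by
      ext s i; fin_cases i <;> simp
    rw [this]
    simpa using ((hasDerivAt_id (y 1)).smul_const e₁).const_add (y 0 • e₀)
  exact (h1.comp_hasDerivAt (y 1) h2).unique h

/-- Every smooth 2-form on the plane is exact. -/
theorem exists_fderiv_e₀_eq {g : Plane → ℝ} (hg : ContDiff ℝ ∞ g) :
    ∃ b : Plane → ℝ, ContDiff ℝ ∞ b ∧ ∀ y, fderiv ℝ b y e₀ = g y := by
  have h1 : ContDiff ℝ ∞ fun y : Plane => ∫ s in (0 : ℝ)..y 0, g !₂[s, y 1] := by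
    refine contDiff_integral_upper (φ := fun y s => g !₂[s, y 1]) ?_ (contDiff_coord 0) 0
    exact hg.comp (contDiff_mk contDiff_snd ((contDiff_coord 1).comp contDiff_fst))
  refine ⟨_, h1, fun y => fderiv_e₀ h1 y ?_⟩
  have h2 : Continuous fun s => g !₂[s, y 1] :=
    hg.continuous.comp (contDiff_mk contDiff_id contDiff_const).continuous
  have := intervalIntegral.integral_hasDerivAt_right (h2.intervalIntegrable 0 (y 0))
    (h2.stronglyMeasurableAtFilter _ _) h2.continuousAt
  simpa [mk_coord] using this


/-- The integral of a function over the square `[-R, R]²`. -/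
def squareIntegral (R : ℝ) (f : Plane → ℝ) : ℝ :=
  ∫ s in (-R)..R, ∫ t in (-R)..R, f !₂[s, t]

theorem squareIntegral_const_mul (R c : ℝ) (f : Plane → ℝ) :
    squareIntegral R (fun y => c * f y) = c * squareIntegral R f := by
  simp [squareIntegral]

theorem continuous_mk : Continuous fun p : ℝ × ℝ => (!₂[p.1, p.2] : Plane) :=
  (contDiff_mk contDiff_fst contDiff_snd).continuous

theorem squareIntegral_add (R : ℝ) {f g : Plane → ℝ} (hf : Continuous f) (hg : Continuous g) :
    squareIntegral R (fun y => f y + g y) = squareIntegral R f + squareIntegral R g := by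
  have hf' : Continuous fun p : ℝ × ℝ => f !₂[p.1, p.2] := hf.comp continuous_mk
  have hg' : Continuous fun p : ℝ × ℝ => g !₂[p.1, p.2] := hg.comp continuous_mk
  simp only [squareIntegral]
  rw [← intervalIntegral.integral_add]
  · congr 1
    ext s
    exact intervalIntegral.integral_add
      ((hf'.comp (by fun_prop : Continuous fun t : ℝ => (s, t))).intervalIntegrable _ _)
      ((hg'.comp (by fun_prop : Continuous fun t : ℝ => (s, t))).intervalIntegrable _ _)
  · exact (intervalIntegral.continuous_parametric_intervalIntegral_of_continuous'
      (f := fun s t => f !₂[s, t]) hf' _ _).intervalIntegrable _ _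
  · exact (intervalIntegral.continuous_parametric_intervalIntegral_of_continuous'
      (f := fun s t => g !₂[s, t]) hg' _ _).intervalIntegrable _ _

/-- Stokes' theorem for a 1-form vanishing on the boundary of the square. -/
theorem squareIntegral_extDeriv_eq_zero {R : ℝ} (hR : 0 ≤ R) {η : Plane → Plane [⋀^Fin 1]→L[ℝ] ℝ}
    (hη : ContDiff ℝ ∞ η) (h0 : ∀ y : Plane, |y 0| = R ∨ |y 1| = R → η y = 0) :
    squareIntegral R (fun y => extDeriv η y ![e₀, e₁]) = 0 := by
  set b : Plane → ℝ := fun z => η z ![e₁]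
  set a : Plane → ℝ := fun z => η z ![e₀]
  have ha : ContDiff ℝ ∞ a := (ContinuousAlternatingMap.apply ℝ Plane ℝ ![e₀]).contDiff.comp hη
  have hb : ContDiff ℝ ∞ b := (ContinuousAlternatingMap.apply ℝ Plane ℝ ![e₁]).contDiff.comp hη
  have hmk : ContDiff ℝ ∞ fun p : ℝ × ℝ => (!₂[p.1, p.2] : Plane) :=
    contDiff_mk contDiff_fst contDiff_snd
  have hfa := ha.comp hmk
  have hfb := hb.comp hmk
  -- For `η = a dx + b dy`, the coefficient of `dη` is the divergence of the vector field `(b, -a)`.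
  have key := MeasureTheory.integral2_divergence_prod_of_hasFDerivAt_off_countable
    (fun p : ℝ × ℝ => b !₂[p.1, p.2]) (fun p : ℝ × ℝ => - a !₂[p.1, p.2])
    (fderiv ℝ (fun p : ℝ × ℝ => b !₂[p.1, p.2])) (fderiv ℝ (fun p : ℝ × ℝ => - a !₂[p.1, p.2]))
    (-R) (-R) R R ∅ Set.countable_empty hfb.continuous.continuousOn
    hfa.neg.continuous.continuousOn
    (fun p _ => (hfb.differentiable (by simp) p).hasFDerivAt)
    (fun p _ => (hfa.neg.differentiable (by simp) p).hasFDerivAt) ?_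
  · have e1 : ∀ p : ℝ × ℝ, fderiv ℝ (fun p : ℝ × ℝ => (!₂[p.1, p.2] : Plane)) p (1, 0) = e₀ ∧
        fderiv ℝ (fun p : ℝ × ℝ => (!₂[p.1, p.2] : Plane)) p (0, 1) = e₁ := by
      intro p
      let L : ℝ × ℝ →L[ℝ] Plane := (ContinuousLinearMap.fst ℝ ℝ ℝ).smulRight e₀ +
        (ContinuousLinearMap.snd ℝ ℝ ℝ).smulRight e₁
      have hL : (fun p : ℝ × ℝ => (!₂[p.1, p.2] : Plane)) = L := by
        ext q i; fin_cases i <;> simp [L]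
      rw [hL, L.fderiv]
      simp [L]
    have e2 : ∀ x y : ℝ, (fderiv ℝ (fun p : ℝ × ℝ => b !₂[p.1, p.2])) (x, y) (1, 0) +
        (fderiv ℝ (fun p : ℝ × ℝ => - a !₂[p.1, p.2])) (x, y) (0, 1) =
        extDeriv η !₂[x, y] ![e₀, e₁] := by
      intro x y
      have c1 := fderiv_comp (x, y) (hb.differentiable (by simp) (!₂[x, y]))
        (hmk.differentiable (by simp) (x, y))
      have c2 := fderiv_comp (x, y) (ha.differentiable (by simp) (!₂[x, y]))
        (hmk.differentiable (by simp) (x, y))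
      rw [extDeriv_apply_basis (hη.differentiable (by simp) _), fderiv_fun_neg]
      change fderiv ℝ (b ∘ fun p : ℝ × ℝ => (!₂[p.1, p.2] : Plane)) (x, y) (1, 0) +
        (- fderiv ℝ (a ∘ fun p : ℝ × ℝ => (!₂[p.1, p.2] : Plane)) (x, y)) (0, 1) = _
      rw [c1, c2]
      simp only [ContinuousLinearMap.comp_apply, _root_.neg_apply, e1]
      rfl
    simp only [e2] at key
    rw [squareIntegral, key]
    have habs : |R| = R ∧ |-R| = R := by simp [abs_of_nonneg hR]
    have hb0 : ∀ y : Plane, |y 0| = R ∨ |y 1| = R → b y = 0 ∧ a y = 0 := fun y hy => by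
      simp [a, b, h0 y hy]
    have z1 : ∀ x : ℝ, a !₂[x, R] = 0 ∧ a !₂[x, -R] = 0 := fun x =>
      ⟨(hb0 _ (by simp [habs])).2, (hb0 _ (by simp [habs])).2⟩
    have z2 : ∀ x : ℝ, b !₂[R, x] = 0 ∧ b !₂[-R, x] = 0 := fun x =>
      ⟨(hb0 _ (by simp [habs])).1, (hb0 _ (by simp [habs])).1⟩
    simp [z1, z2]
  · refine ContinuousOn.integrableOn_compact (isCompact_uIcc.prod isCompact_uIcc)
      (Continuous.continuousOn ?_)
    exact ((hfb.continuous_fderiv (by simp)).clm_apply continuous_const).add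
      ((hfa.neg.continuous_fderiv (by simp)).clm_apply continuous_const)

/-! ### The Poincaré lemma with compact supports in the plane -/

theorem hasCompactSupport_of_box {f : Plane → ℝ} {R : ℝ}
    (h : ∀ y : Plane, R ≤ |y 0| ∨ R ≤ |y 1| → f y = 0) : HasCompactSupport f := by
  refine HasCompactSupport.of_support_subset_isCompact
    (isCompact_closedBall (0 : Plane) (R + R)) fun y hy => ?_
  have h1 : |y 0| < R ∧ |y 1| < R := by
    by_contra hcon
    rw [not_and_or, not_lt, not_lt] at hcon
    exact hy (h y hcon)
  rw [mem_closedBall_zero_iff]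
  have h2 : y = y 0 • e₀ + y 1 • e₁ := eq_smul_add_smul y
  rw [h2]
  refine (norm_add_le _ _).trans ?_
  rw [norm_smul, norm_smul]
  simp
  linarith [h1.1.le, h1.2.le]

theorem exists_box_of_hasCompactSupport {f : Plane → ℝ} (h : HasCompactSupport f) :
    ∃ R : ℝ, ∀ y : Plane, R ≤ |y 0| ∨ R ≤ |y 1| → f y = 0 := by
  obtain ⟨R, hR⟩ := h.isCompact.isBounded.exists_norm_le
  refine ⟨R + 1, fun y hy => ?_⟩
  by_contra hne
  have h1 := hR y (subset_tsupport f hne)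
  have h2 := PiLp.norm_apply_le y 0
  have h3 := PiLp.norm_apply_le y 1
  rw [Real.norm_eq_abs] at h2 h3
  rcases hy with hy | hy <;> linarith

theorem exists_compact_primitive_real {h : ℝ → ℝ} (hh : ContDiff ℝ ∞ h) {R : ℝ}
    (h0 : ∀ t, R ≤ |t| → h t = 0) (hint : ∫ t in (-R)..R, h t = 0) :
    ∃ Q : ℝ → ℝ, ContDiff ℝ ∞ Q ∧ (∀ t, HasDerivAt Q (h t) t) ∧ ∀ t, R ≤ |t| → Q t = 0 := by
  refine ⟨fun t => ∫ s in (-R)..t, h s, ?_, ?_, ?_⟩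
  · exact contDiff_integral_upper (φ := fun _ s => h s) (hh.comp contDiff_snd) contDiff_id (-R)
  · intro t
    exact intervalIntegral.integral_hasDerivAt_right (hh.continuous.intervalIntegrable _ _)
      (hh.continuous.stronglyMeasurableAtFilter _ _) hh.continuous.continuousAt
  · intro t ht
    rcases le_total 0 t with h1 | h1
    · rw [abs_of_nonneg h1] at ht
      have : ∫ s in R..t, h s = 0 := by
        refine intervalIntegral.integral_zero_ae (Filter.Eventually.of_forall fun s hs => h0 s ?_)
        rw [Set.uIoc_of_le ht] at hs
        exact hs.1.le.trans (le_abs_self s)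
      have h2 := intervalIntegral.integral_add_adjacent_intervals (a := -R) (b := R) (c := t)
        (hh.continuous.intervalIntegrable _ _) (hh.continuous.intervalIntegrable (μ := MeasureTheory.volume) _ _)
      linarith
    · rw [abs_of_nonpos h1] at ht
      refine intervalIntegral.integral_zero_ae (Filter.Eventually.of_forall fun s hs => h0 s ?_)
      rw [Set.uIoc_of_ge (by linarith)] at hs
      have := neg_le_abs s
      linarith [hs.2]

/-- The Poincaré lemma with compact supports in the plane: modulo exterior derivatives of
compactly supported 1-forms, compactly supported 2-forms are multiples of a fixed one. -/
theorem exists_compact_primitive {g : Plane → ℝ} (hg : ContDiff ℝ ∞ g)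
    (hgc : HasCompactSupport g) {ρ : ℝ → ℝ} (hρ : ContDiff ℝ ∞ ρ) (hρ0 : ∀ t, 1 ≤ |t| → ρ t = 0)
    (hρ1 : ∫ t in (-1 : ℝ)..1, ρ t = 1) :
    ∃ (c : ℝ) (a b : Plane → ℝ), ContDiff ℝ ∞ a ∧ ContDiff ℝ ∞ b ∧ HasCompactSupport a ∧
      HasCompactSupport b ∧
      ∀ y, g y = c * (ρ (y 0) * ρ (y 1)) + (fderiv ℝ b y e₀ - fderiv ℝ a y e₁) := by
  obtain ⟨R', hR'⟩ := exists_box_of_hasCompactSupport hgc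
  set R := max R' 1
  have hR1 : 1 ≤ R := le_max_right _ _
  have hg0 : ∀ y : Plane, R ≤ |y 0| ∨ R ≤ |y 1| → g y = 0 := fun y hy =>
    hR' y (hy.imp (le_max_left _ _).trans (le_max_left _ _).trans)
  have hρR : ∀ t, R ≤ |t| → ρ t = 0 := fun t ht => hρ0 t (hR1.trans ht)
  have hρint : ∫ t in (-R)..R, ρ t = 1 := by
    rw [← hρ1]
    have i : ∀ a b, IntervalIntegrable ρ MeasureTheory.volume a b := fun a b =>
      hρ.continuous.intervalIntegrable a b
    rw [← intervalIntegral.integral_add_adjacent_intervals (i (-R) (-1)) (i (-1) R),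
      ← intervalIntegral.integral_add_adjacent_intervals (i (-1) 1) (i 1 R)]
    have z1 : ∫ t in (-R)..(-1), ρ t = 0 := by
      refine intervalIntegral.integral_zero_ae (Filter.Eventually.of_forall fun s hs => hρ0 s ?_)
      rw [Set.uIoc_of_le (by linarith)] at hs
      have := neg_le_abs s
      linarith [hs.2]
    have z2 : ∫ t in (1 : ℝ)..R, ρ t = 0 := by
      refine intervalIntegral.integral_zero_ae (Filter.Eventually.of_forall fun s hs => hρ0 s ?_)
      rw [Set.uIoc_of_le (by linarith)] at hs
      exact hs.1.le.trans (le_abs_self s)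
    rw [z1, z2]; ring
  -- Integration along horizontal lines gives `h`. On each such line `g - ρ h` has integral zero, so
  -- its primitive `P` has compact support; on the vertical axis `h - c ρ` has integral zero, with
  -- compactly supported primitive `Q`. Together `g = ∂₀P + ρ(y₀) (Q'(y₁) + c ρ(y₁))`, whence `b =
  -- P` and `a = -ρ(y₀) Q(y₁)`.
  set h : ℝ → ℝ := fun t => ∫ s in (-R)..R, g !₂[s, t]
  have hh : ContDiff ℝ ∞ h := contDiff_integral_upper (φ := fun t s => g !₂[s, t])
    (hg.comp (contDiff_mk contDiff_snd contDiff_fst)) contDiff_const (-R)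
  have hh0 : ∀ t, R ≤ |t| → h t = 0 := fun t ht => by
    simp only [h]
    rw [intervalIntegral.integral_zero_ae]
    exact Filter.Eventually.of_forall fun s _ => hg0 _ (by simp [ht])
  set c := ∫ t in (-R)..R, h t
  obtain ⟨Q, hQ, hQd, hQ0⟩ := exists_compact_primitive_real (h := fun t => h t - c * ρ t) (R := R)
    (hh.sub (contDiff_const.mul hρ)) (fun t ht => by rw [hh0 t ht, hρR t ht]; ring) (by
      rw [intervalIntegral.integral_sub (hh.continuous.intervalIntegrable _ _)
        ((hρ.continuous.intervalIntegrable _ _).const_mul _),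
        intervalIntegral.integral_const_mul, hρint]
      simp [c])
  have hker : ∀ t, ContDiff ℝ ∞ fun s => g !₂[s, t] - ρ s * h t := fun t =>
    (hg.comp (contDiff_mk contDiff_id contDiff_const)).sub (hρ.mul contDiff_const)
  set P : Plane → ℝ := fun y => ∫ s in (-R)..y 0, (g !₂[s, y 1] - ρ s * h (y 1))
  have hP : ContDiff ℝ ∞ P := by
    refine contDiff_integral_upper (φ := fun y s => g !₂[s, y 1] - ρ s * h (y 1)) ?_
      (contDiff_coord 0) (-R)
    have h1 : ContDiff ℝ ∞ fun p : Plane × ℝ => p.1 1 := (contDiff_coord 1).comp contDiff_fst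
    exact (hg.comp (contDiff_mk contDiff_snd h1)).sub ((hρ.comp contDiff_snd).mul (hh.comp h1))
  have hPd : ∀ y, fderiv ℝ P y e₀ = g y - ρ (y 0) * h (y 1) := fun y => by
    refine fderiv_e₀ hP y ?_
    have h2 := (hker (y 1)).continuous
    have := intervalIntegral.integral_hasDerivAt_right (h2.intervalIntegrable (-R) (y 0))
      (h2.stronglyMeasurableAtFilter _ _) h2.continuousAt
    simpa [mk_coord, P] using this
  have hP0 : ∀ y : Plane, R ≤ |y 0| ∨ R ≤ |y 1| → P y = 0 := by
    intro y hy
    by_cases hy1 : R ≤ |y 1|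
    · simp only [P]
      refine intervalIntegral.integral_zero_ae (Filter.Eventually.of_forall fun s _ => ?_)
      rw [hg0 _ (by simp [hy1]), hh0 _ hy1]; ring
    -- To the right of the box `P` vanishes only because the whole line has integral zero, which is
    -- why `ρ h` was subtracted.
    · have hy0 : R ≤ |y 0| := hy.resolve_right hy1
      obtain ⟨Q', _, hQ'd, hQ'0⟩ := exists_compact_primitive_real (R := R) (hker (y 1))
        (fun s hs => by rw [hg0 _ (by simp [hs]), hρR s hs]; ring) (by
          have i1 : IntervalIntegrable (fun s => g !₂[s, y 1]) MeasureTheory.volume (-R) R :=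
            (hg.comp (contDiff_mk contDiff_id contDiff_const)).continuous.intervalIntegrable _ _
          rw [intervalIntegral.integral_sub i1 ((hρ.continuous.intervalIntegrable _ _).mul_const _),
            intervalIntegral.integral_mul_const, hρint]
          simp [h])
      have : P y = Q' (y 0) - Q' (-R) :=
        intervalIntegral.integral_eq_sub_of_hasDerivAt (fun s _ => hQ'd s)
          ((hker (y 1)).continuous.intervalIntegrable _ _)
      rw [this, hQ'0 _ hy0, hQ'0 _ (by simp [abs_of_nonneg (zero_le_one.trans hR1)])]; ring
  have hA : ContDiff ℝ ∞ fun y : Plane => -(ρ (y 0) * Q (y 1)) :=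
    ((hρ.comp (contDiff_coord 0)).mul (hQ.comp (contDiff_coord 1))).neg
  refine ⟨c, fun y => -(ρ (y 0) * Q (y 1)), P, hA, hP, ?_, hasCompactSupport_of_box hP0, ?_⟩
  · refine hasCompactSupport_of_box (R := R) fun y hy => ?_
    rcases hy with hy | hy
    · rw [hρR _ hy]; ring
    · rw [hQ0 _ hy]; ring
  · intro y
    have h3 : fderiv ℝ (fun y : Plane => -(ρ (y 0) * Q (y 1))) y e₁ =
        -(ρ (y 0) * (h (y 1) - c * ρ (y 1))) := by
      refine fderiv_e₁ hA y ?_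
      simpa using ((hQd (y 1)).const_mul (ρ (y 0))).fun_neg
    rw [hPd, h3]; ring

end Plane

/-! ### The two stereographic parametrizations of the sphere -/

namespace S2
open Plane

theorem finrank_eq_two_add_one : Fact (Module.finrank ℝ (EuclideanSpace ℝ (Fin 3)) = 2 + 1) :=
  ⟨finrank_euclideanSpace_fin⟩

theorem mem_sphere_iff (p : EuclideanSpace ℝ (Fin 3)) :
    p ∈ Metric.sphere (0 : EuclideanSpace ℝ (Fin 3)) 1 ↔ p 0 ^ 2 + p 1 ^ 2 + p 2 ^ 2 = 1 := by
  rw [mem_sphere_zero_iff_norm, EuclideanSpace.norm_eq, Real.sqrt_eq_one, Fin.sum_univ_three]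
  simp

theorem sq_add_sq_add_sq (p : S2) : p.1 0 ^ 2 + p.1 1 ^ 2 + p.1 2 ^ 2 = 1 :=
  (mem_sphere_iff p.1).1 p.2

theorem sign_sq (ε : ℤˣ) : ((ε : ℤ) : ℝ) ^ 2 = 1 := by
  rcases Int.units_eq_one_or ε with h | h <;> simp [h]

/-- The point `(0, 0, ε)` of the sphere. -/
def pole (ε : ℤˣ) : S2 := ⟨!₂[0, 0, (ε : ℤ)], by rw [mem_sphere_iff]; simp [sign_sq]⟩

/-- The inverse of the stereographic projection from `pole ε` to the equatorial plane. -/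
def stereo (ε : ℤˣ) (y : Plane) : S2 :=
  ⟨!₂[2 * y 0 / (1 + y 0 ^ 2 + y 1 ^ 2), 2 * y 1 / (1 + y 0 ^ 2 + y 1 ^ 2),
    (ε : ℤ) * (y 0 ^ 2 + y 1 ^ 2 - 1) / (1 + y 0 ^ 2 + y 1 ^ 2)], by
    have h : 1 + y 0 ^ 2 + y 1 ^ 2 ≠ 0 := by positivity
    have h2 := sign_sq ε
    rw [mem_sphere_iff]
    simp only [Matrix.cons_val]
    field_simp
    rw [h2]; ring⟩

/-- The stereographic projection from `pole ε` to the equatorial plane. -/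
def proj (ε : ℤˣ) (p : S2) : Plane :=
  !₂[p.1 0 / (1 - (ε : ℤ) * p.1 2), p.1 1 / (1 - (ε : ℤ) * p.1 2)]

theorem eq_pole_iff {ε : ℤˣ} {p : S2} : p = pole ε ↔ 1 - (ε : ℤ) * p.1 2 = 0 := by
  constructor
  · rintro rfl
    have := sign_sq ε
    simp [pole]; linarith
  · intro h
    have h1 := sq_add_sq_add_sq p
    have h2 := sign_sq ε
    have h3 : p.1 2 = (ε : ℤ) := by
      have : ((ε : ℤ) : ℝ) * (1 - (ε : ℤ) * p.1 2) = 0 := by rw [h]; ring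
      nlinarith
    rw [h3, h2] at h1
    have h4 : p.1 0 = 0 := by nlinarith [sq_nonneg (p.1 0), sq_nonneg (p.1 1)]
    have h5 : p.1 1 = 0 := by nlinarith [sq_nonneg (p.1 0), sq_nonneg (p.1 1)]
    apply Subtype.ext
    ext i; fin_cases i <;> simp [pole, h3, h4, h5]

theorem stereo_ne_pole (ε : ℤˣ) (y : Plane) : stereo ε y ≠ pole ε := by
  rw [Ne, eq_pole_iff]
  have h : 1 + y 0 ^ 2 + y 1 ^ 2 ≠ 0 := by positivity
  have h2 := sign_sq ε
  simp only [stereo, Matrix.cons_val]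
  field_simp
  rw [h2]
  ring_nf
  norm_num

theorem proj_stereo (ε : ℤˣ) (y : Plane) : proj ε (stereo ε y) = y := by
  have h : 1 + y 0 ^ 2 + y 1 ^ 2 ≠ 0 := by positivity
  have h2 := sign_sq ε
  have h3 : 1 - ((ε : ℤ) : ℝ) * ((ε : ℤ) * (y 0 ^ 2 + y 1 ^ 2 - 1) / (1 + y 0 ^ 2 + y 1 ^ 2)) =
      2 / (1 + y 0 ^ 2 + y 1 ^ 2) := by
    field_simp; rw [h2]; ring
  ext i
  fin_cases i
  · simp only [proj, stereo, Matrix.cons_val, Fin.zero_eta, Fin.isValue]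
    rw [h3]; field_simp
  · simp only [proj, stereo, Matrix.cons_val, Fin.mk_one, Fin.isValue]
    rw [h3]; field_simp

theorem stereo_proj {ε : ℤˣ} {p : S2} (hp : p ≠ pole ε) : stereo ε (proj ε p) = p := by
  have h1 := sq_add_sq_add_sq p
  have h2 := sign_sq ε
  have h3 : 1 - (ε : ℤ) * p.1 2 ≠ 0 := fun h => hp (eq_pole_iff.2 h)
  have h4 : 1 + (p.1 0 / (1 - (ε : ℤ) * p.1 2)) ^ 2 + (p.1 1 / (1 - (ε : ℤ) * p.1 2)) ^ 2 =
      2 / (1 - (ε : ℤ) * p.1 2) := by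
    field_simp
    linear_combination h1 + (p.1 2) ^ 2 * h2
  apply Subtype.ext
  ext i
  fin_cases i
  · simp only [proj, stereo, Matrix.cons_val, Fin.zero_eta, Fin.isValue]
    rw [h4]; field_simp
  · simp only [proj, stereo, Matrix.cons_val, Fin.mk_one, Fin.isValue]
    rw [h4]; field_simp
  · simp only [proj, stereo, Matrix.cons_val, Fin.reduceFinMk, Fin.isValue]
    have h5 : (p.1 0 / (1 - (ε : ℤ) * p.1 2)) ^ 2 + (p.1 1 / (1 - (ε : ℤ) * p.1 2)) ^ 2 - 1 =
      2 / (1 - (ε : ℤ) * p.1 2) - 2 := by linarith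
    rw [h4, h5]; field_simp
    linear_combination p.1 2 * h2

theorem stereo_zero (ε : ℤˣ) : stereo ε 0 = pole (-ε) := by
  apply Subtype.ext
  ext i; fin_cases i <;> simp [stereo, pole]

theorem contDiff_normSq : ContDiff ℝ ∞ fun y : Plane => 1 + y 0 ^ 2 + y 1 ^ 2 :=
  (contDiff_const.add ((contDiff_coord 0).pow 2)).add ((contDiff_coord 1).pow 2)

theorem contMDiff_stereo (ε : ℤˣ) : ContMDiff (𝓡 2) (𝓡 2) ∞ (stereo ε) := by
  have h : ∀ y : Plane, 1 + y 0 ^ 2 + y 1 ^ 2 ≠ 0 := fun y => by positivity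
  have := finrank_eq_two_add_one
  refine ContMDiff.codRestrict_sphere (n := 2) (ContDiff.contMDiff ?_) (fun y => (stereo ε y).2)
  rw [contDiff_euclidean]
  intro i
  fin_cases i
  · exact (contDiff_const.mul (contDiff_coord 0)).div contDiff_normSq h
  · exact (contDiff_const.mul (contDiff_coord 1)).div contDiff_normSq h
  · exact (contDiff_const.mul ((((contDiff_coord 0).pow 2).add ((contDiff_coord 1).pow 2)).sub
      contDiff_const)).div contDiff_normSq h

theorem contMDiff_coe : ContMDiff (𝓡 2) (𝓡 3) ∞ (fun p : S2 => (p : EuclideanSpace ℝ (Fin 3))) :=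
  have := finrank_eq_two_add_one
  contMDiff_coe_sphere

theorem contMDiffOn_proj (ε : ℤˣ) : ContMDiffOn (𝓡 2) (𝓡 2) ∞ (proj ε) {pole ε}ᶜ := by
  have h : ContDiffOn ℝ ∞ (fun p : EuclideanSpace ℝ (Fin 3) =>
      (!₂[p 0 / (1 - (ε : ℤ) * p 2), p 1 / (1 - (ε : ℤ) * p 2)] : Plane))
      {p | 1 - (ε : ℤ) * p 2 ≠ 0} := by
    have hc : ∀ i, ContDiffOn ℝ ∞ (fun p : EuclideanSpace ℝ (Fin 3) => p i)
      {p | 1 - (ε : ℤ) * p 2 ≠ 0} := fun i =>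
        (EuclideanSpace.proj i : EuclideanSpace ℝ (Fin 3) →L[ℝ] ℝ).contDiff.contDiffOn
    rw [contDiffOn_euclidean]
    intro i
    fin_cases i
    · exact (hc 0).div (contDiffOn_const.sub (contDiffOn_const.mul (hc 2))) fun p hp => hp
    · exact (hc 1).div (contDiffOn_const.sub (contDiffOn_const.mul (hc 2))) fun p hp => hp
  refine h.contMDiffOn.comp contMDiff_coe.contMDiffOn ?_
  intro p hp
  exact fun h => hp (eq_pole_iff.2 h)

theorem isOpen_compl_pole (ε : ℤˣ) : IsOpen ({pole ε}ᶜ : Set S2) := isOpen_compl_singleton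

theorem mdifferentiableAt_proj {ε : ℤˣ} {p : S2} (hp : p ≠ pole ε) :
    MDifferentiableAt (𝓡 2) (𝓡 2) (proj ε) p :=
  ((contMDiffOn_proj ε p hp).contMDiffAt ((isOpen_compl_pole ε).mem_nhds hp)).mdifferentiableAt
    (by simp)

theorem mdifferentiable_stereo (ε : ℤˣ) : MDifferentiable (𝓡 2) (𝓡 2) (stereo ε) :=
  (contMDiff_stereo ε).mdifferentiable (by simp)

theorem mfderiv_stereo_comp_mfderiv_proj (ε : ℤˣ) (y : Plane) (v : TangentSpace (𝓡 2) (stereo ε y)) :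
    mfderiv (𝓡 2) (𝓡 2) (stereo ε) y (mfderiv (𝓡 2) (𝓡 2) (proj ε) (stereo ε y) v) = v := by
  have h1 : stereo ε ∘ proj ε =ᶠ[𝓝 (stereo ε y)] id := by
    filter_upwards [(isOpen_compl_pole ε).mem_nhds (stereo_ne_pole ε y)] with p hp
    exact stereo_proj hp
  have h2 := h1.mfderiv_eq (I := 𝓡 2) (I' := 𝓡 2)
  have h3 := mfderiv_comp (stereo ε y) (mdifferentiable_stereo ε (proj ε (stereo ε y)))
    (mdifferentiableAt_proj (stereo_ne_pole ε y))
  rw [h3, mfderiv_id] at h2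
  have h4 := DFunLike.congr_fun h2 v
  -- The type of the derivative depends on its base point, so `proj ε (stereo ε y)` is replaced by
  -- `y` through a variable `z`, with the tangent spaces read as `Plane`.
  have h5 : ∀ z : Plane, proj ε (stereo ε y) = z →
      (mfderiv (𝓡 2) (𝓡 2) (stereo ε) z : Plane →L[ℝ] Plane)
        (mfderiv (𝓡 2) (𝓡 2) (proj ε) (stereo ε y) v) = v := by
    rintro z rfl
    exact h4
  exact h5 y (proj_stereo ε y)

/-- A form on the sphere is determined away from the pole by its pullback to the plane. -/
theorem eq_of_epullback_stereo_eq {k : ℕ} {ε : ℤˣ} {η θ : DForm 2 S2 k} {y : Plane}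
    (h : DForm.epullback (stereo ε) η y = DForm.epullback (stereo ε) θ y) :
    η (stereo ε y) = θ (stereo ε y) := by
  ext v
  have := DFunLike.congr_fun h (fun i => mfderiv (𝓡 2) (𝓡 2) (proj ε) (stereo ε y) (v i))
  have hv : (fun i => mfderiv (𝓡 2) (𝓡 2) (stereo ε) y
      (mfderiv (𝓡 2) (𝓡 2) (proj ε) (stereo ε y) (v i))) = v := by
    ext1 i; exact mfderiv_stereo_comp_mfderiv_proj ε y (v i)
  change η (stereo ε y) (fun i => mfderiv (𝓡 2) (𝓡 2) (stereo ε) y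
      (mfderiv (𝓡 2) (𝓡 2) (proj ε) (stereo ε y) (v i))) =
    θ (stereo ε y) (fun i => mfderiv (𝓡 2) (𝓡 2) (stereo ε) y
      (mfderiv (𝓡 2) (𝓡 2) (proj ε) (stereo ε y) (v i))) at this
  rwa [hv] at this

end S2

/-! ### Linearity of the exterior derivative and of pullbacks -/

namespace DForm
section Linear
variable {m k : ℕ} {M : Type*} [TopologicalSpace M] [ChartedSpace (EuclideanSpace ℝ (Fin m)) M]

theorem inChart_add (η θ : DForm m M k) (x : M) :
    (η + θ).inChart x = η.inChart x + θ.inChart x := rfl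

theorem inChart_smul (c : ℝ) (η : DForm m M k) (x : M) :
    (c • η).inChart x = c • η.inChart x := rfl

theorem IsSmooth.add {η θ : DForm m M k} (hη : η.IsSmooth) (hθ : θ.IsSmooth) :
    (η + θ).IsSmooth := fun x => (hη x).add (hθ x)

theorem IsSmooth.const_smul {η : DForm m M k} (hη : η.IsSmooth) (c : ℝ) :
    (c • η).IsSmooth := fun x => (hη x).const_smul c

theorem IsSmooth.differentiableAt_inChart {η : DForm m M k} (hη : η.IsSmooth) (x : M) :
    DifferentiableAt ℝ (η.inChart x) (extChartAt (𝓡 m) x x) :=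
  ((hη x _ (mem_extChartAt_target x)).contDiffAt
    ((isOpen_extChartAt_target x).mem_nhds (mem_extChartAt_target x))).differentiableAt (by simp)

theorem d_add {η θ : DForm m M k} (hη : η.IsSmooth) (hθ : θ.IsSmooth) :
    (η + θ).d = η.d + θ.d := by
  funext x
  simp only [d, inChart_add, Pi.add_apply]
  rw [extDeriv_add (hη.differentiableAt_inChart x) (hθ.differentiableAt_inChart x)]
  rfl

theorem d_smul (c : ℝ) (η : DForm m M k) : (c • η).d = c • η.d := by
  funext x
  simp only [d, inChart_smul, Pi.smul_apply]
  rw [extDeriv_smul]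
  rfl

theorem isSmooth_of_contDiff {b : EuclideanSpace ℝ (Fin m) → EuclideanSpace ℝ (Fin m) [⋀^Fin k]→L[ℝ] ℝ}
    (hb : ContDiff ℝ ∞ b) : IsSmooth (m := m) (M := EuclideanSpace ℝ (Fin m)) b := by
  intro x₀
  refine hb.contDiffOn.congr fun y _ => ?_
  ext v
  simp only [inChart, extChartAt_model_space_eq_id, PartialEquiv.refl_symm, PartialEquiv.refl_coe]
  change b y (fun i => mfderiv (𝓡 m) (𝓡 m) id y (v i)) = b y v
  rw [mfderiv_id]
  rfl

theorem epullback_add_apply {l : ℕ} (h : EuclideanSpace ℝ (Fin l) → M) (η θ : DForm m M k)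
    (y : EuclideanSpace ℝ (Fin l)) (v : Fin k → EuclideanSpace ℝ (Fin l)) :
    epullback h (η + θ) y v = epullback h η y v + epullback h θ y v := rfl

theorem epullback_smul_apply {l : ℕ} (h : EuclideanSpace ℝ (Fin l) → M) (c : ℝ) (η : DForm m M k)
    (y : EuclideanSpace ℝ (Fin l)) (v : Fin k → EuclideanSpace ℝ (Fin l)) :
    epullback h (c • η) y v = c * epullback h η y v := rfl

end Linear
end DForm

/-! ### Reduction of 2-forms on the sphere to a fixed bump form -/

namespace S2
open Plane DForm

/-- The transport of a compactly supported form on the plane to the sphere, by stereographic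
projection. -/
def push (ε : ℤˣ) {k : ℕ} (b : Plane → Plane [⋀^Fin k]→L[ℝ] ℝ) : DForm 2 S2 k :=
  open Classical in
  fun p => if p = pole ε then 0 else
    pullback (l := 2) (m := 2) (M := Plane) (proj ε) b p

/-- The support of `b` has compact image in the sphere, and this image misses the pole. Thus
extension by zero preserves smoothness. -/
theorem push_eq_zero_near_pole (ε : ℤˣ) {k : ℕ} {b : Plane → Plane [⋀^Fin k]→L[ℝ] ℝ}
    (hb : HasCompactSupport b) : ∀ᶠ p in 𝓝 (pole ε), push ε b p = 0 := by
  have hK : IsCompact (stereo ε '' tsupport b) :=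
    hb.isCompact.image (contMDiff_stereo ε).continuous
  have hN : pole ε ∉ stereo ε '' tsupport b := by
    rintro ⟨y, _, hy⟩; exact stereo_ne_pole ε y hy
  filter_upwards [hK.isClosed.isOpen_compl.mem_nhds hN] with p hp
  simp only [push]
  split_ifs with h
  · rfl
  · have h1 : b (proj ε p) = 0 := by
      by_contra hne
      exact hp ⟨proj ε p, subset_tsupport b hne, stereo_proj h⟩
    simp only [pullback]
    rw [h1]
    rfl

theorem epullback_push {ε : ℤˣ} {k : ℕ} (b : Plane → Plane [⋀^Fin k]→L[ℝ] ℝ) {l : ℕ}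
    {h : EuclideanSpace ℝ (Fin l) → S2} {y : EuclideanSpace ℝ (Fin l)}
    (hh : MDifferentiableAt (𝓡 l) (𝓡 2) h y) (hy : h y ≠ pole ε) :
    epullback h (push ε b) y = epullback (m := 2) (M := Plane) (proj ε ∘ h) b y := by
  refine Eq.trans ?_ (pullback_comp_apply (M := Plane) b (mdifferentiableAt_proj hy) hh).symm
  simp only [pullback, push]
  rw [if_neg hy]

theorem epullback_stereo_push (ε : ℤˣ) {k : ℕ} (b : Plane → Plane [⋀^Fin k]→L[ℝ] ℝ) :
    epullback (stereo ε) (push ε b) = b := by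
  funext y
  rw [epullback_push b (mdifferentiable_stereo ε y) (stereo_ne_pole ε y)]
  have : proj ε ∘ stereo ε = id := funext (proj_stereo ε)
  rw [this]
  ext v
  change b y (fun i => mfderiv (𝓡 2) (𝓡 2) id y (v i)) = b y v
  rw [mfderiv_id]
  rfl

theorem contDiffOn_epullback_push (ε : ℤˣ) {k : ℕ} {b : Plane → Plane [⋀^Fin k]→L[ℝ] ℝ}
    (hb : ContDiff ℝ ∞ b) (hbc : HasCompactSupport b) {l : ℕ}
    {h : EuclideanSpace ℝ (Fin l) → S2} {O : Set (EuclideanSpace ℝ (Fin l))} (hO : IsOpen O)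
    (hh : ContMDiffOn (𝓡 l) (𝓡 2) ∞ h O) : ContDiffOn ℝ ∞ (epullback h (push ε b)) O := by
  intro y hy
  apply ContDiffAt.contDiffWithinAt
  have hmd : ∀ z ∈ O, MDifferentiableAt (𝓡 l) (𝓡 2) h z := fun z hz =>
    ((hh z hz).contMDiffAt (hO.mem_nhds hz)).mdifferentiableAt (by simp)
  by_cases hp : h y = pole ε
  · have h1 : ∀ᶠ z in 𝓝 y, push ε b (h z) = 0 := by
      have := push_eq_zero_near_pole ε hbc
      rw [← hp] at this
      exact (hmd y hy).continuousAt.eventually this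
    refine contDiffAt_const (c := 0) |>.congr_of_eventuallyEq ?_
    filter_upwards [h1] with z hz
    simp only [epullback, pullback]
    rw [hz]
    rfl
  · have hO' : IsOpen (O ∩ h ⁻¹' {pole ε}ᶜ) :=
      hh.continuousOn.isOpen_inter_preimage hO (isOpen_compl_pole ε)
    have hy' : y ∈ O ∩ h ⁻¹' {pole ε}ᶜ := ⟨hy, hp⟩
    have h1 : ContDiffOn ℝ ∞ (epullback (m := 2) (M := Plane) (proj ε ∘ h) b)
        (O ∩ h ⁻¹' {pole ε}ᶜ) :=
      contDiffOn_epullback (isSmooth_of_contDiff hb) hO'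
        ((contMDiffOn_proj ε).comp (hh.mono Set.inter_subset_left) fun z hz => hz.2)
    refine ((h1 y hy').contDiffAt (hO'.mem_nhds hy')).congr_of_eventuallyEq ?_
    filter_upwards [hO'.mem_nhds hy'] with z hz
    exact epullback_push b (hmd z hz.1) hz.2

theorem isSmooth_push (ε : ℤˣ) {k : ℕ} {b : Plane → Plane [⋀^Fin k]→L[ℝ] ℝ}
    (hb : ContDiff ℝ ∞ b) (hbc : HasCompactSupport b) : (push ε b).IsSmooth := fun x₀ =>
  contDiffOn_epullback_push ε hb hbc (isOpen_extChartAt_target x₀) (contMDiffOn_extChartAt_symm x₀)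

theorem d_eq_zero_of_eventually {k : ℕ} {β : DForm 2 S2 k} {p : S2}
    (h : ∀ᶠ q in 𝓝 p, β q = 0) : β.d p = 0 := by
  have h0 : β.inChart p =ᶠ[𝓝 (extChartAt (𝓡 2) p p)] fun _ => 0 := by
    have h1 : Filter.Tendsto (extChartAt (𝓡 2) p).symm (𝓝 (extChartAt (𝓡 2) p p)) (𝓝 p) := by
      have := continuousAt_extChartAt_symm (I := 𝓡 2) p
      rwa [ContinuousAt, extChartAt_to_inv] at this
    filter_upwards [h1.eventually h] with y hy
    simp only [inChart]
    rw [hy]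
    rfl
  simp only [d]
  rw [h0.extDeriv_eq]
  have : extDeriv (fun _ : Plane => (0 : Plane [⋀^Fin k]→L[ℝ] ℝ)) (extChartAt (𝓡 2) p p) = 0 := by
    ext v
    rw [extDeriv_apply (differentiableAt_const _)]
    simp
  erw [this]
  rfl

/-- Two 2-forms agree if their pullbacks by `stereo ε` do, and they agree at the pole. -/
theorem ext_of_epullback {k : ℕ} (ε : ℤˣ) {η θ : DForm 2 S2 k}
    (h : ∀ y, epullback (stereo ε) η y = epullback (stereo ε) θ y)
    (hp : η (pole ε) = θ (pole ε)) : η = θ := by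
  funext p
  by_cases hpp : p = pole ε
  · rw [hpp, hp]
  · rw [← stereo_proj hpp]
    exact eq_of_epullback_stereo_eq (h _)

theorem epullback_d_push (ε : ℤˣ) {b : Plane → Plane [⋀^Fin 1]→L[ℝ] ℝ}
    (hb : ContDiff ℝ ∞ b) (hbc : HasCompactSupport b) (y : Plane) :
    epullback (stereo ε) (push ε b).d y = extDeriv b y := by
  rw [epullback_d (isSmooth_push ε hb hbc) isOpen_univ (contMDiff_stereo ε).contMDiffOn
    (Set.mem_univ y), epullback_stereo_push]

theorem contDiff_extDeriv_basis {β : Plane → Plane [⋀^Fin 1]→L[ℝ] ℝ} (hβ : ContDiff ℝ ∞ β) :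
    ContDiff ℝ ∞ fun y => extDeriv β y ![e₀, e₁] := by
  have h : ∀ v : Fin 1 → Plane, ContDiff ℝ ∞ fun z => β z v := fun v =>
    (ContinuousAlternatingMap.apply ℝ Plane ℝ v).contDiff.comp hβ
  have h2 : ∀ (v : Fin 1 → Plane) (e : Plane), ContDiff ℝ ∞ fun y =>
      fderiv ℝ (fun z => β z v) y e := fun v e =>
    ((h v).fderiv_right (m := ∞) le_rfl).clm_apply contDiff_const
  have h3 : (fun y => extDeriv β y ![e₀, e₁]) = fun y =>
      fderiv ℝ (fun z => β z ![e₁]) y e₀ - fderiv ℝ (fun z => β z ![e₀]) y e₁ :=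
    funext fun y => extDeriv_apply_basis (hβ.differentiable (by simp) y)
  rw [h3]
  exact (h2 _ _).sub (h2 _ _)

/-- The area form of the plane. -/
def planeArea : Plane [⋀^Fin 2]→L[ℝ] ℝ :=
  extDeriv (fun y : Plane => oneForm 0 (y 0)) 0

theorem planeArea_apply : planeArea ![e₀, e₁] = 1 := by
  rw [planeArea, extDeriv_oneForm contDiff_const (contDiff_coord 0)]
  have : fderiv ℝ (fun y : Plane => y 0) 0 = (EuclideanSpace.proj 0 : Plane →L[ℝ] ℝ) :=
    (EuclideanSpace.proj 0 : Plane →L[ℝ] ℝ).fderiv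
  rw [this]
  simp

theorem hasCompactSupport_oneForm {a b : Plane → ℝ} (ha : HasCompactSupport a)
    (hb : HasCompactSupport b) : HasCompactSupport fun y => oneForm (a y) (b y) := by
  have h : (fun y => oneForm (a y) (b y)) =
      (fun y => a y • oneForm 1 0) + fun y => b y • oneForm 0 1 := by
    funext y; ext v; simp [oneForm_apply]
  rw [h]
  exact ha.smul_right.add hb.smul_right

/-- The pulled-back form has a primitive `b₁ dy` on the whole plane. Multiplying it by a bump
function equal to one on the unit disc lets it extend by zero to the sphere without changing its
derivative over the open disc. The disc is centred at `pole (-ε)`, which is the pole meant here. -/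
theorem exists_primitive_near_pole (ε : ℤˣ) {η : DForm 2 S2 2} (hη : η.IsSmooth) :
    ∃ β : DForm 2 S2 1, β.IsSmooth ∧
      ∀ y ∈ Metric.ball (0 : Plane) 1, η (stereo ε y) = β.d (stereo ε y) := by
  have hη1 : ContDiff ℝ ∞ fun y => epullback (stereo ε) η y ![e₀, e₁] :=
    (ContinuousAlternatingMap.apply ℝ Plane ℝ ![e₀, e₁]).contDiff.comp (contDiffOn_univ.1
      (contDiffOn_epullback hη isOpen_univ (contMDiff_stereo ε).contMDiffOn))
  obtain ⟨b₁, hb₁, hb₁d⟩ := exists_fderiv_e₀_eq hη1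
  let χ : ContDiffBump (0 : Plane) := ⟨1, 2, one_pos, one_lt_two⟩
  have hχb : ContDiff ℝ ∞ fun y => χ y * b₁ y := χ.contDiff.mul hb₁
  have hχbc : HasCompactSupport fun y => χ y * b₁ y := χ.hasCompactSupport.mul_right
  have hb' : ContDiff ℝ ∞ fun y => oneForm 0 (χ y * b₁ y) := contDiff_oneForm contDiff_const hχb
  have hb'c : HasCompactSupport fun y => oneForm 0 (χ y * b₁ y) :=
    hasCompactSupport_oneForm HasCompactSupport.zero hχbc
  refine ⟨push ε _, isSmooth_push _ hb' hb'c, ?_⟩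
  intro y hy
  apply eq_of_epullback_stereo_eq
  rw [epullback_d_push _ hb' hb'c]
  apply ext_two
  rw [extDeriv_oneForm contDiff_const hχb]
  have h1 : (fun y => χ y * b₁ y) =ᶠ[𝓝 y] b₁ := by
    filter_upwards [Metric.isOpen_ball.mem_nhds hy] with z hz
    rw [χ.one_of_mem_closedBall (Metric.ball_subset_closedBall hz), one_mul]
  rw [h1.fderiv_eq, hb₁d]
  simp

/-- Every smooth 2-form on the sphere is cohomologous to a multiple of a given 2-form supported in
the domain of a stereographic chart. -/
theorem exists_cohomologous_push {η : DForm 2 S2 2} (hη : η.IsSmooth) {ρ : ℝ → ℝ}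
    (hρ : ContDiff ℝ ∞ ρ) (hρ0 : ∀ t, 1 ≤ |t| → ρ t = 0) (hρ1 : ∫ t in (-1 : ℝ)..1, ρ t = 1) :
    ∃ (c : ℝ) (β : DForm 2 S2 1), β.IsSmooth ∧
      η = c • push 1 (fun y => (ρ (y 0) * ρ (y 1)) • planeArea) + β.d := by
  -- The chart `stereo (-1)` is centred at `pole 1`, the point missed by `stereo 1`: subtracting
  -- `dβ₁` makes the form vanish near it.
  obtain ⟨β₁, hβ₁, hnear⟩ := exists_primitive_near_pole (-1) hη
  have hst : ContMDiffOn (𝓡 2) (𝓡 2) ∞ (stereo 1) Set.univ := (contMDiff_stereo 1).contMDiffOn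
  -- the difference is compactly supported in the other chart
  obtain ⟨g, hgdef⟩ : ∃ g : Plane → ℝ, g = fun y => epullback (stereo 1) η y ![e₀, e₁] -
    epullback (stereo 1) β₁.d y ![e₀, e₁] := ⟨_, rfl⟩
  have hg : ContDiff ℝ ∞ g := by
    rw [hgdef]
    refine ContDiff.sub ?_ ?_
    · exact (ContinuousAlternatingMap.apply ℝ Plane ℝ ![e₀, e₁]).contDiff.comp (contDiffOn_univ.1
        (contDiffOn_epullback hη isOpen_univ hst))
    · have h1 : epullback (stereo 1) β₁.d = extDeriv (epullback (stereo 1) β₁) := funext fun y =>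
        epullback_d hβ₁ isOpen_univ hst (Set.mem_univ y)
      rw [h1]
      exact contDiff_extDeriv_basis (contDiffOn_univ.1
        (contDiffOn_epullback hβ₁ isOpen_univ hst))
  have hpole : stereo (-1) 0 = pole 1 := by rw [stereo_zero, neg_neg]
  have hU : IsOpen ({pole (-1)}ᶜ ∩ proj (-1) ⁻¹' Metric.ball 0 1) :=
    (contMDiffOn_proj (-1)).continuousOn.isOpen_inter_preimage
      (isOpen_compl_pole _) Metric.isOpen_ball
  obtain ⟨U, hUdef⟩ : ∃ U : Set S2, U = {pole (-1)}ᶜ ∩ proj (-1) ⁻¹' Metric.ball 0 1 := ⟨_, rfl⟩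
  rw [← hUdef] at hU
  have hηU : ∀ p ∈ U, η p = β₁.d p := fun p hp => by
    rw [hUdef] at hp
    rw [← stereo_proj hp.1]; exact hnear _ hp.2
  have hpU : pole 1 ∈ U := by
    rw [← hpole, hUdef]
    exact ⟨stereo_ne_pole _ _, by simp [proj_stereo]⟩
  have hgc : HasCompactSupport g := by
    -- The support of `g` comes from points outside `U`. These form a compact set avoiding `pole 1`,
    -- on which `proj 1` is continuous.
    have hK : IsCompact (proj 1 '' Uᶜ) := by
      refine hU.isClosed_compl.isCompact.image_of_continuousOn
        ((contMDiffOn_proj 1).continuousOn.mono ?_)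
      intro p hp hp'
      exact hp (hp' ▸ hpU)
    refine HasCompactSupport.of_support_subset_isCompact hK fun y hy => ?_
    refine ⟨stereo 1 y, fun hyU => hy ?_, proj_stereo 1 y⟩
    simp only [hgdef, epullback, pullback]
    rw [hηU _ hyU, sub_self]
  obtain ⟨c, a, b, ha, hb, hac, hbc, hab⟩ := exists_compact_primitive hg hgc hρ hρ0 hρ1
  have hBc : HasCompactSupport fun y : Plane => (ρ (y 0) * ρ (y 1)) • planeArea := by
    have h1 : HasCompactSupport fun y : Plane => ρ (y 0) * ρ (y 1) := by
      refine hasCompactSupport_of_box (R := 1) fun y hy => ?_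
      rcases hy with h | h <;> simp [hρ0 _ h]
    exact h1.comp_left (g := fun c : ℝ => c • planeArea) (zero_smul _ _)
  obtain ⟨β₂, hβ₂, hβ₂d, hβ₂p⟩ : ∃ β : DForm 2 S2 1, β.IsSmooth ∧
      (∀ y, epullback (stereo 1) β.d y ![e₀, e₁] = fderiv ℝ b y e₀ - fderiv ℝ a y e₁) ∧
      β.d (pole 1) = 0 := by
    have hof := contDiff_oneForm ha hb
    have hofc := hasCompactSupport_oneForm hac hbc
    refine ⟨push 1 _, isSmooth_push 1 hof hofc, fun y => ?_,
      d_eq_zero_of_eventually (push_eq_zero_near_pole 1 hofc)⟩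
    rw [epullback_d_push _ hof hofc, extDeriv_oneForm ha hb]
  obtain ⟨B, hB, hBp, hBdef⟩ : ∃ B : DForm 2 S2 2,
      (∀ y, epullback (stereo 1) B y ![e₀, e₁] = ρ (y 0) * ρ (y 1)) ∧ B (pole 1) = 0 ∧
      B = push 1 (fun y => (ρ (y 0) * ρ (y 1)) • planeArea) := by
    refine ⟨_, fun y => ?_, (push_eq_zero_near_pole 1 hBc).self_of_nhds, rfl⟩
    rw [epullback_stereo_push]
    simp [planeArea_apply]
  rw [← hBdef]
  refine ⟨c, β₁ + β₂, hβ₁.add hβ₂, ?_⟩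
  rw [d_add hβ₁ hβ₂]
  refine ext_of_epullback 1 (fun y => ?_) ?_
  · apply ext_two
    rw [epullback_add_apply, epullback_add_apply, epullback_smul_apply, hB, hβ₂d]
    have h1 := hab y
    simp only [hgdef] at h1
    linarith
  · have h1 : (c • B + (β₁.d + β₂.d)) (pole 1) = c • B (pole 1) +
      (β₁.d (pole 1) + β₂.d (pole 1)) := rfl
    rw [h1, hηU _ hpU, hBp, hβ₂p, smul_zero, zero_add, add_zero]

end S2

/-! ### Integration over the sphere and its second cohomology -/

namespace S2
open Plane DForm

/-- A smooth cutoff on `[0, ∞)`, equal to one on `[0, 1]` and to zero on `[4, ∞)`. -/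
def cutoff (s : ℝ) : ℝ := Real.smoothTransition ((4 - s) / 3)

theorem contDiff_cutoff : ContDiff ℝ ∞ cutoff :=
  Real.smoothTransition.contDiff.comp ((contDiff_const.sub contDiff_id).div_const 3)

theorem cutoff_eq_one {s : ℝ} (h : s ≤ 1) : cutoff s = 1 :=
  Real.smoothTransition.one_of_one_le (by linarith)

theorem cutoff_eq_zero {s : ℝ} (h : 4 ≤ s) : cutoff s = 0 :=
  Real.smoothTransition.zero_of_nonpos (by linarith)

theorem cutoff_nonneg (s : ℝ) : 0 ≤ cutoff s := Real.smoothTransition.nonneg _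

theorem cutoff_le_one (s : ℝ) : cutoff s ≤ 1 := Real.smoothTransition.le_one _

theorem deriv_cutoff_nonpos (s : ℝ) : deriv cutoff s ≤ 0 := by
  have : Antitone cutoff := fun a b h => Real.smoothTransition.monotone (by linarith)
  exact this.deriv_nonpos

theorem cutoff_denom_pos {s : ℝ} (hs : 0 ≤ s) : 0 < cutoff s ^ 2 + s := by
  rcases hs.eq_or_lt with h | h
  · rw [← h, cutoff_eq_one zero_le_one]; norm_num
  · positivity

/-- With `θ = cutoff s` and `s = |y|²`, the functions `capRadius` and `capHeight` come from `stereo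
1 (y / θ)` by clearing denominators. The resulting formulas remain smooth where `θ` vanishes,
because `θ² + s` is positive, and there they give the pole. -/
def capRadius (s : ℝ) : ℝ := 2 * cutoff s / (cutoff s ^ 2 + s)

def capHeight (s : ℝ) : ℝ := (s - cutoff s ^ 2) / (cutoff s ^ 2 + s)

theorem normSq_nonneg (y : Plane) : 0 ≤ y 0 ^ 2 + y 1 ^ 2 := by positivity

/-- A map of degree one (up to sign) from the plane to the sphere, equal to the inverse
stereographic projection on the unit disc and constant outside the disc of radius two. -/
def cap (y : Plane) : S2 :=
  ⟨!₂[capRadius (y 0 ^ 2 + y 1 ^ 2) * y 0, capRadius (y 0 ^ 2 + y 1 ^ 2) * y 1,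
    capHeight (y 0 ^ 2 + y 1 ^ 2)], by
    have h := (cutoff_denom_pos (normSq_nonneg y)).ne'
    rw [mem_sphere_iff]
    simp only [Matrix.cons_val, capRadius, capHeight]
    field_simp
    ring⟩

theorem contDiff_coe_cap : ContDiff ℝ ∞ fun y => (cap y : EuclideanSpace ℝ (Fin 3)) := by
  have hq : ContDiff ℝ ∞ fun y : Plane => y 0 ^ 2 + y 1 ^ 2 :=
    ((contDiff_coord 0).pow 2).add ((contDiff_coord 1).pow 2)
  have hc := contDiff_cutoff.comp hq
  have hd : ∀ y : Plane, cutoff (y 0 ^ 2 + y 1 ^ 2) ^ 2 + (y 0 ^ 2 + y 1 ^ 2) ≠ 0 := fun y =>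
    (cutoff_denom_pos (normSq_nonneg y)).ne'
  have hr : ContDiff ℝ ∞ fun y : Plane => capRadius (y 0 ^ 2 + y 1 ^ 2) :=
    (contDiff_const.mul hc).div ((hc.pow 2).add hq) hd
  rw [contDiff_euclidean]
  intro i
  fin_cases i
  · exact hr.mul (contDiff_coord 0)
  · exact hr.mul (contDiff_coord 1)
  · exact (hq.sub (hc.pow 2)).div ((hc.pow 2).add hq) hd

theorem contMDiff_cap : ContMDiff (𝓡 2) (𝓡 2) ∞ cap := by
  have := finrank_eq_two_add_one
  exact ContMDiff.codRestrict_sphere (n := 2) contDiff_coe_cap.contMDiff (fun y => (cap y).2)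

theorem cap_eq_stereo {y : Plane} (h : y 0 ^ 2 + y 1 ^ 2 ≤ 1) : cap y = stereo 1 y := by
  apply Subtype.ext
  ext i
  fin_cases i <;> simp [cap, stereo, capRadius, capHeight, cutoff_eq_one h] <;> ring

theorem cap_eq_pole {y : Plane} (h : 4 ≤ y 0 ^ 2 + y 1 ^ 2) : cap y = pole 1 := by
  have h0 : y 0 ^ 2 + y 1 ^ 2 ≠ 0 := by linarith
  apply Subtype.ext
  ext i
  fin_cases i <;> simp [cap, pole, capRadius, capHeight, cutoff_eq_zero h, h0]

theorem proj_cap {y : Plane} (h : cap y ≠ pole 1) :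
    0 < cutoff (y 0 ^ 2 + y 1 ^ 2) ∧
      proj 1 (cap y) = !₂[y 0 / cutoff (y 0 ^ 2 + y 1 ^ 2), y 1 / cutoff (y 0 ^ 2 + y 1 ^ 2)] := by
  have hd := (cutoff_denom_pos (normSq_nonneg y)).ne'
  have hc : cutoff (y 0 ^ 2 + y 1 ^ 2) ≠ 0 := by
    intro hc
    apply h
    rw [hc] at hd
    apply Subtype.ext
    have hd' : y 0 ^ 2 + y 1 ^ 2 ≠ 0 := by simpa using hd
    ext i
    fin_cases i <;> simp [cap, pole, capRadius, capHeight, hc, hd']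
  refine ⟨lt_of_le_of_ne (cutoff_nonneg _) hc.symm, ?_⟩
  have h3 : 1 - capHeight (y 0 ^ 2 + y 1 ^ 2) =
      cutoff (y 0 ^ 2 + y 1 ^ 2) * capRadius (y 0 ^ 2 + y 1 ^ 2) := by
    simp only [capHeight, capRadius]; field_simp; ring
  have hr : capRadius (y 0 ^ 2 + y 1 ^ 2) ≠ 0 :=
    div_ne_zero (mul_ne_zero two_ne_zero hc) hd
  ext i
  fin_cases i
  · simp only [proj, cap, Matrix.cons_val, Fin.zero_eta, Fin.isValue, Units.val_one, Int.cast_one,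
      one_mul]
    rw [h3]; field_simp
  · simp only [proj, cap, Matrix.cons_val, Fin.mk_one, Fin.isValue, Units.val_one, Int.cast_one,
      one_mul]
    rw [h3]; field_simp

/-- The integral of a 2-form over the sphere, computed in the parametrization `cap`. -/
def integral (η : DForm 2 S2 2) : ℝ :=
  squareIntegral 2 fun y => epullback cap η y ![e₀, e₁]

theorem contDiff_epullback_cap {k : ℕ} {η : DForm 2 S2 k} (hη : η.IsSmooth) :
    ContDiff ℝ ∞ (epullback cap η) :=
  contDiffOn_univ.1 (contDiffOn_epullback hη isOpen_univ contMDiff_cap.contMDiffOn)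

theorem continuous_epullback_cap {η : DForm 2 S2 2} (hη : η.IsSmooth) :
    Continuous fun y => epullback cap η y ![e₀, e₁] :=
  ((ContinuousAlternatingMap.apply ℝ Plane ℝ ![e₀, e₁]).contDiff.comp
    (contDiff_epullback_cap hη)).continuous

/-- Where `|y|² > 4` the map `cap` is locally constant. The bounding circle is reached by
continuity; it has to be included because the square `[-2, 2]²` touches it. -/
theorem epullback_cap_eq_zero {η : DForm 2 S2 1} (hη : η.IsSmooth) {y : Plane}
    (hy : 4 ≤ y 0 ^ 2 + y 1 ^ 2) : epullback cap η y = 0 := by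
  set O : Set Plane := {y | 4 < y 0 ^ 2 + y 1 ^ 2}
  have hcl : y ∈ closure O := by
    have h1 : ContinuousWithinAt (fun t : ℝ => t • y) (Set.Ioi 1) 1 := by fun_prop
    have h2 := h1.mem_closure_image (x := 1) (by rw [closure_Ioi]; exact Set.self_mem_Ici)
    rw [one_smul] at h2
    refine closure_mono ?_ h2
    rintro _ ⟨t, ht, rfl⟩
    simp only [O, Set.mem_ofPred_eq, PiLp.smul_apply, smul_eq_mul]
    have ht' : 1 < t := ht
    have : 1 < t ^ 2 := by nlinarith
    nlinarith
  have hO : IsOpen O := isOpen_lt continuous_const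
    (((contDiff_coord 0).pow 2).add ((contDiff_coord 1).pow 2)).continuous
  have hz : ∀ z ∈ O, epullback cap η z = 0 := by
    intro z hz
    have h1 : cap =ᶠ[𝓝 z] fun _ => pole 1 := by
      filter_upwards [hO.mem_nhds hz] with w hw
      exact cap_eq_pole (le_of_lt hw)
    ext v
    change η (cap z) (fun i => mfderiv (𝓡 2) (𝓡 2) cap z (v i)) = 0
    have h2 := h1.mfderiv_eq (I := 𝓡 2) (I' := 𝓡 2)
    rw [mfderiv_const] at h2
    refine (η (cap z)).map_coord_zero 0 ?_
    rw [h2]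
    rfl
  have hclosed : IsClosed {z | epullback cap η z = 0} :=
    isClosed_eq (contDiff_epullback_cap hη).continuous continuous_const
  exact (closure_minimal hz hclosed) hcl

theorem integral_d {β : DForm 2 S2 1} (hβ : β.IsSmooth) : integral β.d = 0 := by
  have h1 : epullback cap β.d = extDeriv (epullback cap β) := funext fun y =>
    epullback_d hβ isOpen_univ contMDiff_cap.contMDiffOn (Set.mem_univ y)
  rw [integral, h1]
  refine squareIntegral_extDeriv_eq_zero zero_le_two (contDiff_epullback_cap hβ) fun y hy => ?_
  refine epullback_cap_eq_zero hβ ?_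
  rcases hy with hy | hy
  · have := sq_abs (y 0); rw [hy] at this; nlinarith [sq_nonneg (y 1)]
  · have := sq_abs (y 1); rw [hy] at this; nlinarith [sq_nonneg (y 0)]

theorem integral_add_smul {η θ : DForm 2 S2 2} (hη : η.IsSmooth) (hθ : θ.IsSmooth) (c : ℝ) :
    integral (c • η + θ) = c * integral η + integral θ := by
  have h1 : (fun y => epullback cap (c • η + θ) y ![e₀, e₁]) =
      fun y => c * epullback cap η y ![e₀, e₁] + epullback cap θ y ![e₀, e₁] := by
    funext y
    rw [epullback_add_apply, epullback_smul_apply]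
  have h2 : Continuous fun y => c * epullback cap η y ![e₀, e₁] :=
    continuous_const.mul (continuous_epullback_cap hη)
  rw [integral, h1, squareIntegral_add 2 h2 (continuous_epullback_cap hθ),
    squareIntegral_const_mul]
  rfl

theorem isSmooth_standardFormS2 : standardFormS2.IsSmooth := by
  have h : ContDiff ℝ ∞ tripleProduct := by
    have h1 : IsLinearMap ℝ tripleProduct := by
      constructor
      · intro p q; ext v; exact add_dotProduct p.ofLp q.ofLp ((v 0).ofLp ⨯₃ (v 1).ofLp)
      · intro c p; ext v; exact smul_dotProduct c p.ofLp ((v 0).ofLp ⨯₃ (v 1).ofLp)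
    exact (LinearMap.toContinuousLinearMap (h1.mk' tripleProduct)).contDiff
  exact IsSmooth.pullback (isSmooth_of_contDiff h) contMDiff_coe

theorem epullback_cap_standardFormS2 (y : Plane) :
    epullback cap standardFormS2 y ![e₀, e₁] = tripleProduct (cap y)
      ![fderiv ℝ (fun y => (cap y : EuclideanSpace ℝ (Fin 3))) y e₀,
        fderiv ℝ (fun y => (cap y : EuclideanSpace ℝ (Fin 3))) y e₁] := by
  have h1 : mfderiv (𝓡 2) (𝓡 3) ((fun q : S2 => (q : EuclideanSpace ℝ (Fin 3))) ∘ cap) y = _ :=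
    mfderiv_comp y (contMDiff_coe.mdifferentiable (by simp) (cap y))
      (contMDiff_cap.mdifferentiable (by simp) y)
  rw [mfderiv_eq_fderiv] at h1
  have h2 : epullback cap standardFormS2 y ![e₀, e₁] = tripleProduct (cap y) fun i =>
      mfderiv (𝓡 2) (𝓡 3) (fun q : S2 => (q : EuclideanSpace ℝ (Fin 3))) (cap y)
        (mfderiv (𝓡 2) (𝓡 2) cap y ((![e₀, e₁] : Fin 2 → Plane) i)) := rfl
  rw [h2]
  congr 1
  ext1 i
  fin_cases i
  · exact (DFunLike.congr_fun h1 e₀).symm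
  · exact (DFunLike.congr_fun h1 e₁).symm

theorem fderiv_coe_cap_apply (y e : Plane) (i : Fin 3) :
    (fderiv ℝ (fun y => (cap y : EuclideanSpace ℝ (Fin 3))) y e) i =
      fderiv ℝ (fun y => (cap y : EuclideanSpace ℝ (Fin 3)) i) y e := by
  have h := (EuclideanSpace.proj i : EuclideanSpace ℝ (Fin 3) →L[ℝ] ℝ).hasFDerivAt.comp y
    (contDiff_coe_cap.differentiable (by simp) y).hasFDerivAt
  exact (DFunLike.congr_fun h.fderiv e).symm

theorem contDiff_coe_cap_apply (i : Fin 3) :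
    ContDiff ℝ ∞ fun y => (cap y : EuclideanSpace ℝ (Fin 3)) i :=
  (contDiff_euclidean.1 contDiff_coe_cap) i

/-- The Jacobian of `cap`. -/
theorem epullback_cap_standardFormS2_eq (y : Plane) :
    epullback cap standardFormS2 y ![e₀, e₁] =
      -4 * (cutoff (y 0 ^ 2 + y 1 ^ 2) * (cutoff (y 0 ^ 2 + y 1 ^ 2) -
        2 * (y 0 ^ 2 + y 1 ^ 2) * deriv cutoff (y 0 ^ 2 + y 1 ^ 2))) /
        (cutoff (y 0 ^ 2 + y 1 ^ 2) ^ 2 + (y 0 ^ 2 + y 1 ^ 2)) ^ 2 := by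
  set q := y 0 ^ 2 + y 1 ^ 2 with hq
  set θ := cutoff q with hθ
  set D := deriv cutoff q with hD
  have hN : θ ^ 2 + q ≠ 0 := (cutoff_denom_pos (normSq_nonneg y)).ne'
  have hcut : HasDerivAt cutoff D q :=
    (contDiff_cutoff.differentiable (by simp) q).hasDerivAt
  have hden : HasDerivAt (fun s => cutoff s ^ 2 + s) (2 * θ * D + 1) q := by
    have := (hcut.fun_pow 2).fun_add (hasDerivAt_id q)
    simpa [hθ] using this
  have hA : HasDerivAt capRadius ((2 * D * (θ ^ 2 + q) - 2 * θ * (2 * θ * D + 1)) / (θ ^ 2 + q) ^ 2)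
      q := (hcut.const_mul 2).fun_div hden hN
  have hC : HasDerivAt capHeight (((1 - 2 * θ * D) * (θ ^ 2 + q) - (q - θ ^ 2) * (2 * θ * D + 1)) /
      (θ ^ 2 + q) ^ 2) q := by
    refine HasDerivAt.fun_div ?_ hden hN
    have := (hasDerivAt_id q).fun_sub (hcut.fun_pow 2)
    simpa [hθ] using this
  set A' := (2 * D * (θ ^ 2 + q) - 2 * θ * (2 * θ * D + 1)) / (θ ^ 2 + q) ^ 2 with hA'
  set C' := ((1 - 2 * θ * D) * (θ ^ 2 + q) - (q - θ ^ 2) * (2 * θ * D + 1)) / (θ ^ 2 + q) ^ 2 with hC'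
  have hs0 : HasDerivAt (fun s : ℝ => s ^ 2 + y 1 ^ 2) (2 * y 0) (y 0) := by
    simpa using (hasDerivAt_pow 2 (y 0)).add_const (y 1 ^ 2)
  have hs1 : HasDerivAt (fun s : ℝ => y 0 ^ 2 + s ^ 2) (2 * y 1) (y 1) := by
    simpa using (hasDerivAt_pow 2 (y 1)).const_add (y 0 ^ 2)
  have hA0 : HasDerivAt (fun s : ℝ => capRadius (s ^ 2 + y 1 ^ 2)) (A' * (2 * y 0)) (y 0) :=
    HasDerivAt.comp (h₂ := capRadius) (h := fun s : ℝ => s ^ 2 + y 1 ^ 2) (y 0) hA hs0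
  have hA1 : HasDerivAt (fun s : ℝ => capRadius (y 0 ^ 2 + s ^ 2)) (A' * (2 * y 1)) (y 1) :=
    HasDerivAt.comp (h₂ := capRadius) (h := fun s : ℝ => y 0 ^ 2 + s ^ 2) (y 1) hA hs1
  have hC0 : HasDerivAt (fun s : ℝ => capHeight (s ^ 2 + y 1 ^ 2)) (C' * (2 * y 0)) (y 0) :=
    HasDerivAt.comp (h₂ := capHeight) (h := fun s : ℝ => s ^ 2 + y 1 ^ 2) (y 0) hC hs0
  have hC1 : HasDerivAt (fun s : ℝ => capHeight (y 0 ^ 2 + s ^ 2)) (C' * (2 * y 1)) (y 1) :=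
    HasDerivAt.comp (h₂ := capHeight) (h := fun s : ℝ => y 0 ^ 2 + s ^ 2) (y 1) hC hs1
  have d00 := fderiv_e₀ (contDiff_coe_cap_apply 0) y (c := A' * (2 * y 0) * y 0 + capRadius q * 1)
    (by simpa [cap] using hA0.fun_mul (hasDerivAt_id (y 0)))
  have d01 := fderiv_e₀ (contDiff_coe_cap_apply 1) y (c := A' * (2 * y 0) * y 1)
    (by simpa [cap] using hA0.mul_const (y 1))
  have d02 := fderiv_e₀ (contDiff_coe_cap_apply 2) y (c := C' * (2 * y 0))
    (by simpa [cap] using hC0)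
  have d10 := fderiv_e₁ (contDiff_coe_cap_apply 0) y (c := A' * (2 * y 1) * y 0)
    (by simpa [cap] using hA1.mul_const (y 0))
  have d11 := fderiv_e₁ (contDiff_coe_cap_apply 1) y (c := A' * (2 * y 1) * y 1 + capRadius q * 1)
    (by simpa [cap] using hA1.fun_mul (hasDerivAt_id (y 1)))
  have d12 := fderiv_e₁ (contDiff_coe_cap_apply 2) y (c := C' * (2 * y 1))
    (by simpa [cap] using hC1)
  rw [epullback_cap_standardFormS2]
  have hT : ∀ p v w : EuclideanSpace ℝ (Fin 3), tripleProduct p ![v, w] =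
      p 0 * (v 1 * w 2 - v 2 * w 1) + p 1 * (v 2 * w 0 - v 0 * w 2) +
        p 2 * (v 0 * w 1 - v 1 * w 0) := by
    intro p v w
    change p.ofLp ⬝ᵥ (v.ofLp ⨯₃ w.ofLp) = _
    rw [cross_apply, Matrix.vec3_dotProduct]
    simp
  rw [hT]
  simp only [fderiv_coe_cap_apply, d00, d01, d02, d10, d11, d12]
  have p0 : (cap y : EuclideanSpace ℝ (Fin 3)) 0 = capRadius q * y 0 := by simp [cap, hq]
  have p1 : (cap y : EuclideanSpace ℝ (Fin 3)) 1 = capRadius q * y 1 := by simp [cap, hq]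
  have p2 : (cap y : EuclideanSpace ℝ (Fin 3)) 2 = capHeight q := by simp [cap, hq]
  have r1 : capRadius q = 2 * θ / (θ ^ 2 + q) := rfl
  have r2 : capHeight q = (q - θ ^ 2) / (θ ^ 2 + q) := rfl
  rw [p0, p1, p2, r1, r2, hA', hC']
  -- By rotational symmetry the answer involves only `q`, `θ` and `D`. With these as independent
  -- variables and `y 1 ^ 2` eliminated, the claim is an identity of rational functions.
  have hy1 : y 1 ^ 2 = q - y 0 ^ 2 := by rw [hq]; ring
  clear_value q θ D
  field_simp
  ring_nf
  simp only [hy1]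
  ring

/-- Stereographic projection from the north pole reverses the outward-normal orientation. The
Jacobian of `cap` is nowhere positive because `cutoff` is nonnegative and nonincreasing, and it
equals `-4` at the origin. -/
theorem integral_standardFormS2_neg : integral standardFormS2 < 0 := by
  have hcont := continuous_epullback_cap isSmooth_standardFormS2
  have hc2 : Continuous fun p : ℝ × ℝ =>
      - epullback cap standardFormS2 !₂[p.1, p.2] ![e₀, e₁] := (hcont.comp continuous_mk).neg
  have hle : ∀ y, 0 ≤ - epullback cap standardFormS2 y ![e₀, e₁] := by
    intro y
    rw [epullback_cap_standardFormS2_eq, ← neg_div]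
    have h1 := cutoff_nonneg (y 0 ^ 2 + y 1 ^ 2)
    have h2 := deriv_cutoff_nonpos (y 0 ^ 2 + y 1 ^ 2)
    have h3 := normSq_nonneg y
    refine div_nonneg ?_ (by positivity)
    have h4 : 0 ≤ -(2 * (y 0 ^ 2 + y 1 ^ 2) * deriv cutoff (y 0 ^ 2 + y 1 ^ 2)) := by nlinarith
    have h5 : 0 ≤ cutoff (y 0 ^ 2 + y 1 ^ 2) * (cutoff (y 0 ^ 2 + y 1 ^ 2) -
        2 * (y 0 ^ 2 + y 1 ^ 2) * deriv cutoff (y 0 ^ 2 + y 1 ^ 2)) := mul_nonneg h1 (by linarith)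
    linarith
  have h0 : 0 < - epullback cap standardFormS2 !₂[0, 0] ![e₀, e₁] := by
    rw [epullback_cap_standardFormS2_eq]
    simp [cutoff_eq_one]
  have hlt : 0 < ∫ s in (-2 : ℝ)..2, ∫ t in (-2 : ℝ)..2,
      - epullback cap standardFormS2 !₂[s, t] ![e₀, e₁] := by
    refine intervalIntegral.integral_pos (by norm_num) ?_ ?_ ⟨0, by norm_num, ?_⟩
    · exact (intervalIntegral.continuous_parametric_intervalIntegral_of_continuous'
        (f := fun s t => - epullback cap standardFormS2 !₂[s, t] ![e₀, e₁]) hc2 _ _).continuousOn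
    · exact fun s _ => intervalIntegral.integral_nonneg (by norm_num) fun t _ => hle _
    · refine intervalIntegral.integral_pos (by norm_num) ?_ (fun t _ => hle _) ⟨0, by norm_num, h0⟩
      exact (hc2.comp (by fun_prop : Continuous fun t : ℝ => ((0 : ℝ), t))).continuousOn
  simp only [intervalIntegral.integral_neg] at hlt
  have : 0 < - integral standardFormS2 := hlt
  linarith

theorem exists_bump : ∃ ρ : ℝ → ℝ, ContDiff ℝ ∞ ρ ∧ (∀ t, 1 ≤ |t| → ρ t = 0) ∧
    ∫ t in (-1 : ℝ)..1, ρ t = 1 := by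
  let f : ContDiffBump (0 : ℝ) := ⟨1 / 2, 1, by norm_num, by norm_num⟩
  have hs : Function.support (f.normed MeasureTheory.volume) = Metric.ball 0 1 :=
    f.support_normed_eq
  refine ⟨f.normed MeasureTheory.volume, f.contDiff_normed, fun t ht => ?_, ?_⟩
  · by_contra hne
    have : t ∈ Function.support (f.normed MeasureTheory.volume) := hne
    rw [hs, mem_ball_zero_iff, Real.norm_eq_abs] at this
    linarith
  · rw [intervalIntegral.integral_eq_integral_of_support_subset, f.integral_normed]
    rw [hs, Real.ball_eq_Ioo]
    simpa using Set.Ioo_subset_Ioc_self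

/-- A smooth 2-form on the sphere whose integral has the sign of that of the standard form is
cohomologous to a positive multiple of the standard form. -/
theorem exists_cohomologous_standardFormS2 {η : DForm 2 S2 2} (hη : η.IsSmooth)
    (hpos : integral η < 0) : ∃ k : ℝ, 0 < k ∧ Cohomologous η (k • standardFormS2) := by
  obtain ⟨ρ, hρ, hρ0, hρ1⟩ := exists_bump
  obtain ⟨c, β, hβ, h1⟩ := exists_cohomologous_push hη hρ hρ0 hρ1
  obtain ⟨c₀, β₀, hβ₀, h2⟩ := exists_cohomologous_push isSmooth_standardFormS2 hρ hρ0 hρ1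
  have hBc : HasCompactSupport fun y : Plane => (ρ (y 0) * ρ (y 1)) • planeArea := by
    have h1 : HasCompactSupport fun y : Plane => ρ (y 0) * ρ (y 1) := by
      refine hasCompactSupport_of_box (R := 1) fun y hy => ?_
      rcases hy with h | h <;> simp [hρ0 _ h]
    exact h1.comp_left (g := fun c : ℝ => c • planeArea) (zero_smul _ _)
  have hBs : ContDiff ℝ ∞ fun y : Plane => (ρ (y 0) * ρ (y 1)) • planeArea :=
    ((hρ.comp (contDiff_coord 0)).mul (hρ.comp (contDiff_coord 1))).smul contDiff_const
  have hB := isSmooth_push 1 hBs hBc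
  generalize push 1 (fun y => (ρ (y 0) * ρ (y 1)) • planeArea) = B at h1 h2 hB
  have hdβ : ∀ {γ : DForm 2 S2 1} {θ : DForm 2 S2 2} {a : ℝ}, γ.IsSmooth → θ.IsSmooth →
      θ = a • B + γ.d → integral θ = a * integral B := by
    intro γ θ a hγ hθ h
    -- Smoothness of `dγ` is read off from the relation itself, as a difference of smooth forms.
    have hγd : γ.d.IsSmooth := by
      have : γ.d = (-a) • B + θ := by
        rw [h, ← add_assoc, ← add_smul]; simp
      rw [this]
      exact (hB.const_smul _).add hθ
    rw [h, integral_add_smul hB hγd, integral_d hγ, add_zero]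
  have i1 := hdβ hβ hη h1
  have i2 := hdβ hβ₀ isSmooth_standardFormS2 h2
  have hneg := integral_standardFormS2_neg
  rw [i2] at hneg
  rw [i1] at hpos
  have hc₀ : c₀ ≠ 0 := by rintro rfl; simp at hneg
  -- The value of `integral B` is not needed: its products with `c` and with `c₀` are both negative,
  -- so `c` and `c₀` have the same sign.
  have hk : 0 < c / c₀ := by
    rcases lt_trichotomy (integral B) 0 with h | h | h
    · exact div_pos (by nlinarith) (by nlinarith)
    · rw [h] at hneg; simp at hneg
    · exact div_pos_of_neg_of_neg (by nlinarith) (by nlinarith)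
  refine ⟨c / c₀, hk, β + (-(c / c₀)) • β₀, hβ.add (hβ₀.const_smul _), ?_⟩
  rw [d_add hβ (hβ₀.const_smul _), d_smul, h1, h2, smul_add, smul_smul, div_mul_cancel₀ _ hc₀]
  funext p
  ext v
  change c * B p v + β.d p v - (c * B p v + c / c₀ * β₀.d p v) =
    β.d p v + -(c / c₀) * β₀.d p v
  ring

end S2

/-! ### From a square with constant boundary to a smooth sphere -/

namespace S2
open Plane DForm

section SphereMap
variable {m : ℕ} {M : Type*} [TopologicalSpace M] [ChartedSpace (EuclideanSpace ℝ (Fin m)) M]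

/-- The extension to the sphere, by a constant value at the pole, of a map on the plane. -/
def extendMap {X : Type*} (x : X) (v : Plane → X) (p : S2) : X :=
  open Classical in if p = pole 1 then x else v (proj 1 p)

theorem proj_normSq {p : S2} (hp : p ≠ pole 1) (h : 0 < p.1 2) :
    1 ≤ (proj 1 p 0) ^ 2 + (proj 1 p 1) ^ 2 := by
  have h3 : 1 - ((1 : ℤˣ) : ℤ) * p.1 2 ≠ 0 := fun h => hp (eq_pole_iff.2 h)
  simp only [Units.val_one, Int.cast_one, one_mul] at h3
  have h1 := sq_add_sq_add_sq p
  have h2 : p.1 2 ≤ 1 := by nlinarith [sq_nonneg (p.1 0), sq_nonneg (p.1 1)]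
  have h4 : 0 < 1 - p.1 2 := lt_of_le_of_ne (by linarith) h3.symm
  simp only [proj, Units.val_one, Int.cast_one, one_mul, Matrix.cons_val]
  rw [div_pow, div_pow, ← add_div, le_div_iff₀ (by positivity)]
  nlinarith

/-- The open upper hemisphere, apart from the pole, projects outside the open unit disc, where `v`
is constant; so the extension is constant near the pole. -/
theorem contMDiff_extendMap {x : M} {v : Plane → M} (hv : ContMDiff (𝓡 2) (𝓡 m) ∞ v)
    (hx : ∀ y : Plane, 1 ≤ y 0 ^ 2 + y 1 ^ 2 → v y = x) :
    ContMDiff (𝓡 2) (𝓡 m) ∞ (extendMap x v) := by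
  intro p
  by_cases hp : p = pole 1
  · have h1 : extendMap x v =ᶠ[𝓝 p] fun _ => x := by
      have hopen : IsOpen {q : S2 | 0 < q.1 2} := by
        refine isOpen_lt continuous_const ?_
        exact (EuclideanSpace.proj (2 : Fin 3) : EuclideanSpace ℝ (Fin 3) →L[ℝ] ℝ).continuous.comp
          continuous_subtype_val
      filter_upwards [hopen.mem_nhds (by rw [hp]; simp [pole])] with q hq
      simp only [extendMap]
      split_ifs with h
      · rfl
      · exact hx _ (proj_normSq h hq)
    exact contMDiffAt_const.congr_of_eventuallyEq h1
  · have h1 : extendMap x v =ᶠ[𝓝 p] v ∘ proj 1 := by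
      filter_upwards [(isOpen_compl_pole 1).mem_nhds hp] with q hq
      exact if_neg hq
    refine ContMDiffAt.congr_of_eventuallyEq ?_ h1
    exact (hv _).comp p ((contMDiffOn_proj 1 p hp).contMDiffAt ((isOpen_compl_pole 1).mem_nhds hp))

/-- On the unit disc `cap` is `stereo 1`. Beyond it, `cap y` is either the pole or projects to `y /
θ` with `θ ≤ 1`, which stays in the region where `v` is constant. -/
theorem extendMap_cap {X : Type*} {x : X} {v : Plane → X}
    (hx : ∀ y : Plane, 1 ≤ y 0 ^ 2 + y 1 ^ 2 → v y = x) (y : Plane) :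
    extendMap x v (cap y) = v y := by
  by_cases hy : y 0 ^ 2 + y 1 ^ 2 ≤ 1
  · rw [cap_eq_stereo hy, extendMap, if_neg (stereo_ne_pole 1 y), proj_stereo]
  · push Not at hy
    rw [hx y hy.le, extendMap]
    split_ifs with h
    · rfl
    · obtain ⟨h1, h2⟩ := proj_cap h
      apply hx
      rw [h2]
      simp only [Matrix.cons_val]
      have h3 := cutoff_le_one (y 0 ^ 2 + y 1 ^ 2)
      rw [div_pow, div_pow, ← add_div, le_div_iff₀ (by positivity)]
      nlinarith

theorem integral_pullback [IsManifold (𝓡 m) ∞ M] {σ : DForm m M 2} {g : S2 → M}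
    (hg : ContMDiff (𝓡 2) (𝓡 m) ∞ g) :
    integral (pullback (l := 2) g σ) =
      squareIntegral 2 fun y => epullback (g ∘ cap) σ y ![e₀, e₁] := by
  have : epullback cap (pullback (l := 2) g σ) = epullback (g ∘ cap) σ := funext fun y =>
    (pullback_comp_apply σ (hg.mdifferentiable (by simp) _)
      (contMDiff_cap.mdifferentiable (by simp) _)).symm
  rw [integral, this]

/-- The product of two reparametrizations of the line. -/
def prodMap (ψ₀ ψ₁ : ℝ → ℝ) (y : Plane) : Plane := !₂[ψ₀ (y 0), ψ₁ (y 1)]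

theorem contDiff_prodMap {ψ₀ ψ₁ : ℝ → ℝ} (h₀ : ContDiff ℝ ∞ ψ₀) (h₁ : ContDiff ℝ ∞ ψ₁) :
    ContDiff ℝ ∞ (prodMap ψ₀ ψ₁) :=
  contDiff_mk (h₀.comp (contDiff_coord 0)) (h₁.comp (contDiff_coord 1))

theorem fderiv_prodMap {ψ₀ ψ₁ : ℝ → ℝ} (h₀ : ContDiff ℝ ∞ ψ₀) (h₁ : ContDiff ℝ ∞ ψ₁) (y : Plane) :
    fderiv ℝ (prodMap ψ₀ ψ₁) y e₀ = deriv ψ₀ (y 0) • e₀ ∧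
      fderiv ℝ (prodMap ψ₀ ψ₁) y e₁ = deriv ψ₁ (y 1) • e₁ := by
  have hc : ∀ (e : Plane) (i : Fin 2), (fderiv ℝ (prodMap ψ₀ ψ₁) y e) i =
      fderiv ℝ (fun y => prodMap ψ₀ ψ₁ y i) y e := by
    intro e i
    have h := (EuclideanSpace.proj i : Plane →L[ℝ] ℝ).hasFDerivAt.comp y
      ((contDiff_prodMap h₀ h₁).differentiable (by simp) y).hasFDerivAt
    exact (DFunLike.congr_fun h.fderiv e).symm
  have hs : ∀ i, ContDiff ℝ ∞ fun y => prodMap ψ₀ ψ₁ y i :=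
    fun i => (contDiff_euclidean.1 (contDiff_prodMap h₀ h₁)) i
  have d0 := (h₀.differentiable (by simp) (y 0)).hasDerivAt
  have d1 := (h₁.differentiable (by simp) (y 1)).hasDerivAt
  constructor
  · ext i
    rw [hc]
    fin_cases i
    · simpa using fderiv_e₀ (hs 0) y (by simpa [prodMap] using d0)
    · simpa using fderiv_e₀ (hs 1) y (c := 0) (by simpa [prodMap] using hasDerivAt_const _ _)
  · ext i
    rw [hc]
    fin_cases i
    · simpa using fderiv_e₁ (hs 0) y (c := 0) (by simpa [prodMap] using hasDerivAt_const _ _)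
    · simpa using fderiv_e₁ (hs 1) y (by simpa [prodMap] using d1)

theorem epullback_comp_prodMap [IsManifold (𝓡 m) ∞ M] (σ : DForm m M 2) {u : Plane → M}
    (hu : ContMDiff (𝓡 2) (𝓡 m) ∞ u) {ψ₀ ψ₁ : ℝ → ℝ} (h₀ : ContDiff ℝ ∞ ψ₀)
    (h₁ : ContDiff ℝ ∞ ψ₁) (y : Plane) :
    epullback (u ∘ prodMap ψ₀ ψ₁) σ y ![e₀, e₁] =
      deriv ψ₀ (y 0) * (deriv ψ₁ (y 1) * epullback u σ (prodMap ψ₀ ψ₁ y) ![e₀, e₁]) := by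
  have hψ := contDiff_prodMap h₀ h₁
  have h2 : epullback (u ∘ prodMap ψ₀ ψ₁) σ y = _ :=
    pullback_comp_apply σ (hu.mdifferentiable (by simp) (prodMap ψ₀ ψ₁ y))
      (hψ.contMDiff.mdifferentiable (by simp) y)
  obtain ⟨hd0, hd1⟩ := fderiv_prodMap h₀ h₁ y
  rw [← mfderiv_eq_fderiv] at hd0 hd1
  have h3 : epullback (m := 2) (M := Plane) (prodMap ψ₀ ψ₁) (pullback (l := 2) u σ) y ![e₀, e₁] =
      epullback u σ (prodMap ψ₀ ψ₁ y) ![deriv ψ₀ (y 0) • e₀, deriv ψ₁ (y 1) • e₁] := by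
    rw [← hd0, ← hd1]
    change epullback u σ (prodMap ψ₀ ψ₁ y) _ = _
    congr 1
    ext1 i
    fin_cases i <;> rfl
  rw [h2, h3]
  generalize epullback u σ (prodMap ψ₀ ψ₁ y) = T
  have hT0 : ∀ (a : ℝ) (v w : Plane), T ![a • v, w] = a * T ![v, w] := fun a v w => by
    have h := T.map_update_smul ![v, w] 0 a v
    have h1 : ∀ z : Plane, Function.update ![v, w] 0 z = ![z, w] := fun z => by
      funext i; fin_cases i <;> rfl
    rwa [h1, h1] at h
  have hT1 : ∀ (a : ℝ) (v w : Plane), T ![v, a • w] = a * T ![v, w] := fun a v w => by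
    have h := T.map_update_smul ![v, w] 1 a w
    have h1 : ∀ z : Plane, Function.update ![v, w] 1 z = ![v, z] := fun z => by
      funext i; fin_cases i <;> rfl
    rwa [h1, h1] at h
  rw [hT0, hT1]

theorem squareIntegral_comp_prodMap [IsManifold (𝓡 m) ∞ M] {σ : DForm m M 2} (hσ : σ.IsSmooth)
    {u : Plane → M} (hu : ContMDiff (𝓡 2) (𝓡 m) ∞ u) {ψ₀ ψ₁ : ℝ → ℝ} (h₀ : ContDiff ℝ ∞ ψ₀)
    (h₁ : ContDiff ℝ ∞ ψ₁) :
    squareIntegral 2 (fun y => epullback (u ∘ prodMap ψ₀ ψ₁) σ y ![e₀, e₁]) =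
      ∫ s in (ψ₀ (-2))..(ψ₀ 2), ∫ t in (ψ₁ (-2))..(ψ₁ 2), epullback u σ !₂[s, t] ![e₀, e₁] := by
  have hF : Continuous fun p : ℝ × ℝ => epullback u σ !₂[p.1, p.2] ![e₀, e₁] :=
    ((ContinuousAlternatingMap.apply ℝ Plane ℝ ![e₀, e₁]).continuous.comp (contDiffOn_univ.1
      (contDiffOn_epullback hσ isOpen_univ hu.contMDiffOn)).continuous).comp continuous_mk
  have hG : Continuous fun s => ∫ t in (ψ₁ (-2))..(ψ₁ 2), epullback u σ !₂[s, t] ![e₀, e₁] :=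
    intervalIntegral.continuous_parametric_intervalIntegral_of_continuous'
      (f := fun s t => epullback u σ !₂[s, t] ![e₀, e₁]) hF _ _
  rw [squareIntegral]
  rw [← intervalIntegral.integral_comp_mul_deriv (f' := deriv ψ₀)
    (fun x _ => (h₀.differentiable (by simp) x).hasDerivAt)
    (h₀.continuous_deriv (by simp)).continuousOn hG]
  congr 1
  funext s
  have hs : Continuous fun t : ℝ => epullback u σ !₂[ψ₀ s, t] ![e₀, e₁] :=
    hF.comp (by fun_prop : Continuous fun t : ℝ => (ψ₀ s, t))
  rw [Function.comp_apply, ← intervalIntegral.integral_comp_mul_deriv (f' := deriv ψ₁)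
    (fun x _ => (h₁.differentiable (by simp) x).hasDerivAt)
    (h₁.continuous_deriv (by simp)).continuousOn hs, ← intervalIntegral.integral_mul_const]
  congr 1
  funext t
  rw [epullback_comp_prodMap σ hu h₀ h₁]
  simp [prodMap]
  ring

/-- A 2-form which evaluates nontrivially on the second homotopy group has a negative integral
over some smooth sphere. -/
theorem exists_integral_neg [IsManifold (𝓡 m) ∞ M] {σ : DForm m M 2} (hσ : σ.IsSmooth)
    (hπ : σ.EvaluatesNontriviallyOnPi2) :
    ∃ g : S2 → M, ContMDiff (𝓡 2) (𝓡 m) ∞ g ∧ integral (pullback (l := 2) g σ) < 0 := by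
  obtain ⟨x, _, c, ⟨u, γ, hu, hγ, -, hc⟩, hc0⟩ := hπ
  have hc' : ∫ s in (0 : ℝ)..1, ∫ t in (0 : ℝ)..1, epullback u σ !₂[s, t] ![e₀, e₁] = c := hc
  have hux : ∀ y : Plane, (∀ i, y i ∈ unitInterval) → (∃ i, y i = 0 ∨ y i = 1) → u y = x := by
    intro y hy hb
    have h1 := hγ fun i => ⟨y i, hy i⟩
    have h2 : γ (fun i => ⟨y i, hy i⟩) = x := by
      apply γ.2
      obtain ⟨i, hi⟩ := hb
      exact ⟨i, hi.imp (fun h => Subtype.ext h) (fun h => Subtype.ext h)⟩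
    rw [h2] at h1
    exact h1.symm
  -- reparametrizations of the interval, constant outside `(-1/2, 1/2)`
  let P : (ℝ → ℝ) → Prop := fun ψ => ContDiff ℝ ∞ ψ ∧ (∀ t, ψ t ∈ unitInterval) ∧
    ∀ t, 1 / 2 ≤ |t| → ψ t = 0 ∨ ψ t = 1
  have hmain : ∀ ψ₀ ψ₁, P ψ₀ → P ψ₁ → ∃ g : S2 → M, ContMDiff (𝓡 2) (𝓡 m) ∞ g ∧
      integral (pullback (l := 2) g σ) =
        ∫ s in (ψ₀ (-2))..(ψ₀ 2), ∫ t in (ψ₁ (-2))..(ψ₁ 2), epullback u σ !₂[s, t] ![e₀, e₁] := by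
    intro ψ₀ ψ₁ h₀ h₁
    have hv : ContMDiff (𝓡 2) (𝓡 m) ∞ (u ∘ prodMap ψ₀ ψ₁) :=
      hu.comp (contDiff_prodMap h₀.1 h₁.1).contMDiff
    have hvx : ∀ y : Plane, 1 ≤ y 0 ^ 2 + y 1 ^ 2 → (u ∘ prodMap ψ₀ ψ₁) y = x := by
      intro y hy
      refine hux _ (fun i => ?_) ?_
      · fin_cases i
        · exact h₀.2.1 _
        · exact h₁.2.1 _
      -- Two coordinates smaller than `1/2` in absolute value would give `|y|² < 1/2`, so outside
      -- the open unit disc one of them is sent to an end of the interval.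
      · by_cases h : 1 / 2 ≤ |y 0|
        · exact ⟨0, h₀.2.2 _ h⟩
        · refine ⟨1, h₁.2.2 _ ?_⟩
          by_contra h'
          push Not at h h'
          have a0 := sq_lt_sq' (by linarith [abs_nonneg (y 0)]) h
          have a1 := sq_lt_sq' (by linarith [abs_nonneg (y 1)]) h'
          rw [sq_abs] at a0 a1
          linarith
    refine ⟨extendMap x (u ∘ prodMap ψ₀ ψ₁), contMDiff_extendMap hv hvx, ?_⟩
    rw [integral_pullback (contMDiff_extendMap hv hvx)]
    have : extendMap x (u ∘ prodMap ψ₀ ψ₁) ∘ cap = u ∘ prodMap ψ₀ ψ₁ :=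
      funext fun y => extendMap_cap hvx y
    rw [this, squareIntegral_comp_prodMap hσ hu h₀.1 h₁.1]
  let φ : ℝ → ℝ := fun t => Real.smoothTransition (t + 1 / 2)
  have hφ : P φ := by
    refine ⟨Real.smoothTransition.contDiff.comp (contDiff_id.add contDiff_const), fun t =>
      ⟨Real.smoothTransition.nonneg _, Real.smoothTransition.le_one _⟩, fun t ht => ?_⟩
    rcases le_abs.1 ht with h | h
    · exact Or.inr (Real.smoothTransition.one_of_one_le (by linarith))
    · exact Or.inl (Real.smoothTransition.zero_of_nonpos (by linarith))
  -- Reversing the first coordinate changes the orientation of the square, hence the sign of the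
  -- integral.
  have hφ' : P fun t => φ (-t) :=
    ⟨hφ.1.comp contDiff_neg, fun t => hφ.2.1 _, fun t ht => hφ.2.2 _ (by rwa [abs_neg])⟩
  have v1 : φ 2 = 1 := Real.smoothTransition.one_of_one_le (by norm_num)
  have v0 : φ (-2) = 0 := Real.smoothTransition.zero_of_nonpos (by norm_num)
  rcases lt_or_gt_of_ne hc0 with h | h
  · obtain ⟨g, hg, hgi⟩ := hmain φ φ hφ hφ
    refine ⟨g, hg, ?_⟩
    rw [hgi, v0, v1, hc']
    exact h
  · obtain ⟨g, hg, hgi⟩ := hmain _ φ hφ' hφ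
    refine ⟨g, hg, ?_⟩
    rw [hgi]
    simp only [neg_neg]
    rw [v0, v1, intervalIntegral.integral_symm, hc']
    linarith

end SphereMap
end S2

/-! ### Perturbations in a chart and the directions to avoid -/

/-- A `C¹` map is locally Lipschitz, and locally Lipschitz maps do not raise Hausdorff dimension. -/
theorem dimH_image_le_of_contDiffOn {E F : Type*} [NormedAddCommGroup E] [NormedSpace ℝ E]
    [FiniteDimensional ℝ E] [NormedAddCommGroup F] [NormedSpace ℝ F] {h : E → F} {O : Set E}
    (hO : IsOpen O) (hh : ContDiffOn ℝ 1 h O) : dimH (h '' O) ≤ Module.finrank ℝ E := by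
  have h1 : dimH (h '' O) ≤ dimH O := by
    refine dimH_image_le_of_locally_lipschitzOn fun x hx => ?_
    obtain ⟨K, t, ht, hK⟩ := ((hh x hx).contDiffAt (hO.mem_nhds hx)).exists_lipschitzOnWith
    exact ⟨K, t, mem_nhdsWithin_of_mem_nhds ht, hK⟩
  exact h1.trans ((dimH_mono (Set.subset_univ O)).trans (Real.dimH_univ_eq_finrank E).le)

namespace S2
open Plane DForm

section Perturbation
variable {m : ℕ} {M : Type*} [TopologicalSpace M] [ChartedSpace (EuclideanSpace ℝ (Fin m)) M]

/-- Move the points of a map `f` in the direction `a` in the chart at `x`, by the amount `μ`. -/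
def perturb (x : M) (f : S2 → M) (μ : S2 → ℝ) (a : EuclideanSpace ℝ (Fin m)) (p : S2) : M :=
  open Classical in
  if f p ∈ (extChartAt (𝓡 m) x).source then
    (extChartAt (𝓡 m) x).symm (extChartAt (𝓡 m) x (f p) + μ p • a) else f p

variable {x : M} {f : S2 → M} {μ : S2 → ℝ}

theorem perturb_zero : perturb (m := m) x f μ 0 = f := by
  funext p
  simp only [perturb, smul_zero, add_zero]
  split_ifs with h
  · exact (extChartAt (𝓡 m) x).left_inv h
  · rfl

/-- The chart sends the image of `tsupport μ` to a compact subset of the open target, so a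
thickening of it still lies in the target; `μ` is bounded, and where it vanishes nothing moves. -/
theorem exists_radius (hf : ContMDiff (𝓡 2) (𝓡 m) ∞ f) (hμ : ContMDiff (𝓡 2) 𝓘(ℝ, ℝ) ∞ μ)
    (hsupp : tsupport μ ⊆ f ⁻¹' (extChartAt (𝓡 m) x).source) :
    ∃ δ > 0, ∀ a : EuclideanSpace ℝ (Fin m), ‖a‖ < δ → ∀ p,
      f p ∈ (extChartAt (𝓡 m) x).source →
        extChartAt (𝓡 m) x (f p) + μ p • a ∈ (extChartAt (𝓡 m) x).target := by
  have hK : IsCompact (tsupport μ) := (isClosed_tsupport μ).isCompact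
  have hψ : ContinuousOn (fun p => extChartAt (𝓡 m) x (f p)) (tsupport μ) :=
    (continuousOn_extChartAt x).comp hf.continuous.continuousOn hsupp
  obtain ⟨r, hr, hrt⟩ := (hK.image_of_continuousOn hψ).exists_thickening_subset_open
    (isOpen_extChartAt_target (I := 𝓡 m) x) (by
      rintro _ ⟨p, hp, rfl⟩
      exact (extChartAt (𝓡 m) x).map_source (hsupp hp))
  obtain ⟨C, hC⟩ := isCompact_univ.exists_bound_of_continuousOn hμ.continuous.continuousOn
  have hC' : ∀ p, |μ p| ≤ |C| + 1 := fun p => by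
    have := hC p (Set.mem_univ p)
    rw [Real.norm_eq_abs] at this
    linarith [le_abs_self C]
  refine ⟨r / (|C| + 1), by positivity, fun a ha p hp => ?_⟩
  by_cases h0 : μ p = 0
  · rw [h0, zero_smul, add_zero]
    exact (extChartAt (𝓡 m) x).map_source hp
  · apply hrt
    rw [Metric.mem_thickening_iff]
    refine ⟨_, ⟨p, subset_tsupport μ h0, rfl⟩, ?_⟩
    rw [dist_eq_norm, add_sub_cancel_left, norm_smul, Real.norm_eq_abs]
    rw [lt_div_iff₀ (by positivity)] at ha
    calc |μ p| * ‖a‖ ≤ (|C| + 1) * ‖a‖ := by gcongr; exact hC' p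
      _ < r := by linarith

theorem isOpen_preimage_stereo (hf : ContMDiff (𝓡 2) (𝓡 m) ∞ f) (ε : ℤˣ) :
    IsOpen {y | f (stereo ε y) ∈ (extChartAt (𝓡 m) x).source} :=
  (isOpen_extChartAt_source (I := 𝓡 m) x).preimage
    (hf.continuous.comp (contMDiff_stereo ε).continuous)

theorem perturb_mem_source_iff {δ : ℝ}
    (hδ : ∀ a : EuclideanSpace ℝ (Fin m), ‖a‖ < δ → ∀ p, f p ∈ (extChartAt (𝓡 m) x).source →
        extChartAt (𝓡 m) x (f p) + μ p • a ∈ (extChartAt (𝓡 m) x).target)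
    {a : EuclideanSpace ℝ (Fin m)} (ha : ‖a‖ < δ) (p : S2) :
    perturb x f μ a p ∈ (extChartAt (𝓡 m) x).source ↔ f p ∈ (extChartAt (𝓡 m) x).source := by
  by_cases h : f p ∈ (extChartAt (𝓡 m) x).source
  · simp only [perturb, h, iff_true]
    exact (extChartAt (𝓡 m) x).map_target (hδ a ha p h)
  · simp only [perturb, if_neg h]

theorem chart_perturb {δ : ℝ}
    (hδ : ∀ a : EuclideanSpace ℝ (Fin m), ‖a‖ < δ → ∀ p, f p ∈ (extChartAt (𝓡 m) x).source →
        extChartAt (𝓡 m) x (f p) + μ p • a ∈ (extChartAt (𝓡 m) x).target)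
    {a : EuclideanSpace ℝ (Fin m)} (ha : ‖a‖ < δ) {p : S2}
    (h : f p ∈ (extChartAt (𝓡 m) x).source) :
    extChartAt (𝓡 m) x (perturb x f μ a p) = extChartAt (𝓡 m) x (f p) + μ p • a := by
  simp only [perturb, if_pos h]
  exact (extChartAt (𝓡 m) x).right_inv (hδ a ha p h)

theorem exists_stereo (p : S2) : ∃ ε y, stereo ε y = p := by
  by_cases h : p = pole 1
  · exact ⟨-1, 0, by rw [stereo_zero, neg_neg, h]⟩
  · exact ⟨1, proj 1 p, stereo_proj h⟩

/-- The directions in which `perturb` creates double points or critical points. -/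
def badSet (x : M) (f : S2 → M) (μ : S2 → ℝ) : Set (EuclideanSpace ℝ (Fin m)) :=
  (⋃ ε : ℤˣ × ℤˣ, (fun z : Plane × Plane =>
    (μ (stereo ε.1 z.1) - μ (stereo ε.2 z.2))⁻¹ •
      (extChartAt (𝓡 m) x (f (stereo ε.2 z.2)) - extChartAt (𝓡 m) x (f (stereo ε.1 z.1)))) ''
    {z | f (stereo ε.1 z.1) ∈ (extChartAt (𝓡 m) x).source ∧
      f (stereo ε.2 z.2) ∈ (extChartAt (𝓡 m) x).source ∧
      μ (stereo ε.1 z.1) - μ (stereo ε.2 z.2) ≠ 0}) ∪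
  ⋃ ε : ℤˣ, (fun z : Plane × Plane =>
    (fderiv ℝ (fun y => μ (stereo ε y)) z.1 z.2)⁻¹ •
      - fderiv ℝ (fun y => extChartAt (𝓡 m) x (f (stereo ε y))) z.1 z.2) ''
    {z | f (stereo ε z.1) ∈ (extChartAt (𝓡 m) x).source ∧
      fderiv ℝ (fun y => μ (stereo ε y)) z.1 z.2 ≠ 0}

/-- If `p` and `q` are identified although `μ p ≠ μ q`, solving the equation in the chart for `a`
exhibits it as a point of the first part of `badSet`. If `μ p = μ q`, both points are moved by the
same vector, so they were already identified by `f`. -/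
theorem eq_of_perturb_eq (hsupp : tsupport μ ⊆ f ⁻¹' (extChartAt (𝓡 m) x).source) {δ : ℝ}
    (hδ : ∀ a : EuclideanSpace ℝ (Fin m), ‖a‖ < δ → ∀ p, f p ∈ (extChartAt (𝓡 m) x).source →
        extChartAt (𝓡 m) x (f p) + μ p • a ∈ (extChartAt (𝓡 m) x).target)
    {a : EuclideanSpace ℝ (Fin m)} (ha : ‖a‖ < δ) (hbad : a ∉ badSet x f μ) {p q : S2}
    (h : perturb x f μ a p = perturb x f μ a q) : μ p = μ q ∧ f p = f q := by
  have hμ0 : ∀ p, f p ∉ (extChartAt (𝓡 m) x).source → μ p = 0 := fun p hp => by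
    by_contra h
    exact hp (hsupp (subset_tsupport μ h))
  have hiff : f p ∈ (extChartAt (𝓡 m) x).source ↔ f q ∈ (extChartAt (𝓡 m) x).source := by
    rw [← perturb_mem_source_iff hδ ha p, ← perturb_mem_source_iff hδ ha q, h]
  by_cases hp : f p ∈ (extChartAt (𝓡 m) x).source
  · have hq := hiff.1 hp
    have h1 := congrArg (extChartAt (𝓡 m) x) h
    rw [chart_perturb hδ ha hp, chart_perturb hδ ha hq] at h1
    by_cases hpq : μ p = μ q
    · refine ⟨hpq, ?_⟩
      rw [hpq] at h1
      exact (extChartAt (𝓡 m) x).injOn hp hq (add_right_cancel h1)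
    · exfalso
      apply hbad
      obtain ⟨ε, y, rfl⟩ := exists_stereo p
      obtain ⟨ε', y', rfl⟩ := exists_stereo q
      refine Or.inl (Set.mem_iUnion.2 ⟨(ε, ε'), (y, y'), ⟨hp, hq, sub_ne_zero.2 hpq⟩, ?_⟩)
      rw [inv_smul_eq_iff₀ (sub_ne_zero.2 hpq), sub_smul, sub_eq_sub_iff_add_eq_add]
      rw [← h1, add_comm]
  · have hq := fun hq => hp (hiff.2 hq)
    refine ⟨by rw [hμ0 p hp, hμ0 q hq], ?_⟩
    simpa only [perturb, if_neg hp, if_neg hq] using h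

variable [IsManifold (𝓡 m) ∞ M]

theorem contMDiffOn_chart_comp (hf : ContMDiff (𝓡 2) (𝓡 m) ∞ f) :
    ContMDiffOn (𝓡 2) (𝓡 m) ∞ (fun p => extChartAt (𝓡 m) x (f p))
      (f ⁻¹' (extChartAt (𝓡 m) x).source) := by
  refine (contMDiffOn_extChartAt (x := x)).comp hf.contMDiffOn ?_
  intro p hp
  rwa [← extChartAt_source (𝓡 m)]

/-- At a point outside the preimage of the chart domain, `μ` vanishes nearby and the family is
locally `f`. Smoothness is joint in `a` and `p`, so that integrals and support conditions can be
followed as `a` tends to zero. -/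
theorem contMDiffOn_perturb (hf : ContMDiff (𝓡 2) (𝓡 m) ∞ f) (hμ : ContMDiff (𝓡 2) 𝓘(ℝ, ℝ) ∞ μ)
    (hsupp : tsupport μ ⊆ f ⁻¹' (extChartAt (𝓡 m) x).source) {δ : ℝ}
    (hδ : ∀ a : EuclideanSpace ℝ (Fin m), ‖a‖ < δ → ∀ p, f p ∈ (extChartAt (𝓡 m) x).source →
        extChartAt (𝓡 m) x (f p) + μ p • a ∈ (extChartAt (𝓡 m) x).target) :
    ContMDiffOn ((𝓡 m).prod (𝓡 2)) (𝓡 m) ∞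
      (fun z : EuclideanSpace ℝ (Fin m) × S2 => perturb x f μ z.1 z.2)
      (Metric.ball 0 δ ×ˢ Set.univ) := by
  have hU : IsOpen (f ⁻¹' (extChartAt (𝓡 m) x).source) :=
    (isOpen_extChartAt_source x).preimage hf.continuous
  rintro ⟨a, p⟩ ⟨ha, -⟩
  have ha' : ‖a‖ < δ := mem_ball_zero_iff.1 ha
  apply ContMDiffAt.contMDiffWithinAt
  by_cases hp : f p ∈ (extChartAt (𝓡 m) x).source
  · have h1 : (fun z : EuclideanSpace ℝ (Fin m) × S2 => perturb x f μ z.1 z.2) =ᶠ[𝓝 (a, p)]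
        fun z => (extChartAt (𝓡 m) x).symm (extChartAt (𝓡 m) x (f z.2) + μ z.2 • z.1) := by
      have : ∀ᶠ z : EuclideanSpace ℝ (Fin m) × S2 in 𝓝 (a, p),
          f z.2 ∈ (extChartAt (𝓡 m) x).source :=
        (hU.preimage continuous_snd).mem_nhds hp
      filter_upwards [this] with z hz
      exact if_pos hz
    refine ContMDiffAt.congr_of_eventuallyEq ?_ h1
    have h2 : ContMDiffAt ((𝓡 m).prod (𝓡 2)) (𝓡 m) ∞
        (fun z : EuclideanSpace ℝ (Fin m) × S2 => extChartAt (𝓡 m) x (f z.2) + μ z.2 • z.1)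
        (a, p) := by
      have h3 : ContMDiffAt ((𝓡 m).prod (𝓡 2)) 𝓘(ℝ, ℝ) ∞
          (fun z : EuclideanSpace ℝ (Fin m) × S2 => μ z.2) (a, p) :=
        (hμ p).comp (a, p) contMDiffAt_snd
      have h4 : ContMDiffAt ((𝓡 m).prod (𝓡 2)) (𝓡 m) ∞
          (fun z : EuclideanSpace ℝ (Fin m) × S2 => z.1) (a, p) := contMDiffAt_fst
      exact ((((contMDiffOn_chart_comp hf p hp).contMDiffAt (hU.mem_nhds hp)).comp (a, p)
        contMDiffAt_snd).add (h3.smul h4))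
    exact ((contMDiffOn_extChartAt_symm x _ (hδ a ha' p hp)).contMDiffAt
      ((isOpen_extChartAt_target x).mem_nhds (hδ a ha' p hp))).comp (a, p) h2
  · have hp' : p ∉ tsupport μ := fun h => hp (hsupp h)
    have h1 : (fun z : EuclideanSpace ℝ (Fin m) × S2 => perturb x f μ z.1 z.2) =ᶠ[𝓝 (a, p)]
        fun z => f z.2 := by
      have : ∀ᶠ z : EuclideanSpace ℝ (Fin m) × S2 in 𝓝 (a, p), μ z.2 = 0 :=
        continuous_snd.continuousAt.eventually (notMem_tsupport_iff_eventuallyEq.1 hp')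
      filter_upwards [this] with z hz
      simp only [perturb]
      rw [hz, zero_smul, add_zero]
      split_ifs with h
      · exact (extChartAt (𝓡 m) x).left_inv h
      · rfl
    exact ((hf p).comp (a, p) contMDiffAt_snd).congr_of_eventuallyEq h1

theorem contDiff_comp_stereo (hμ : ContMDiff (𝓡 2) 𝓘(ℝ, ℝ) ∞ μ) (ε : ℤˣ) :
    ContDiff ℝ ∞ fun y => μ (stereo ε y) :=
  contMDiff_iff_contDiff.1 (hμ.comp (contMDiff_stereo ε))

theorem contDiffOn_chart_comp_stereo (hf : ContMDiff (𝓡 2) (𝓡 m) ∞ f) (ε : ℤˣ) :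
    ContDiffOn ℝ ∞ (fun y => extChartAt (𝓡 m) x (f (stereo ε y)))
      {y | f (stereo ε y) ∈ (extChartAt (𝓡 m) x).source} := by
  rw [← contMDiffOn_iff_contDiffOn]
  exact (contMDiffOn_chart_comp hf).comp (contMDiff_stereo ε).contMDiffOn fun y hy => hy

/-- Pairs of points, as well as points with a tangent vector, are parametrized by open subsets of
`Plane × Plane`. So `badSet` is a finite union of smooth images of four-dimensional sets, of
Hausdorff dimension at most `4 < m`. -/
theorem dense_compl_badSet (hm : 4 < m) (hf : ContMDiff (𝓡 2) (𝓡 m) ∞ f)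
    (hμ : ContMDiff (𝓡 2) 𝓘(ℝ, ℝ) ∞ μ) : Dense (badSet (m := m) x f μ)ᶜ := by
  have hfin : Module.finrank ℝ (Plane × Plane) = 4 := by simp
  apply dense_compl_of_dimH_lt_finrank
  refine lt_of_le_of_lt (b := (4 : ENNReal)) ?_ (by simpa using by exact_mod_cast hm)
  have hle : ∀ {h : Plane × Plane → EuclideanSpace ℝ (Fin m)} {O : Set (Plane × Plane)},
      IsOpen O → ContDiffOn ℝ ∞ h O → dimH (h '' O) ≤ 4 := fun hO hh => by
    have := dimH_image_le_of_contDiffOn hO (hh.of_le (by exact_mod_cast le_top))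
    rw [hfin] at this
    exact_mod_cast this
  have hsmul : ∀ {h : Plane × Plane → EuclideanSpace ℝ (Fin m)} {c : Plane × Plane → ℝ}
      {O : Set (Plane × Plane)}, (∀ z ∈ O, c z ≠ 0) → ContDiffOn ℝ ∞ c O → ContDiffOn ℝ ∞ h O →
        ContDiffOn ℝ ∞ (fun z => (c z)⁻¹ • h z) O := fun h0 hc hh => (hc.inv h0).smul hh
  rw [badSet, dimH_union, dimH_iUnion, dimH_iUnion]
  refine max_le (iSup_le fun ε => hle ?_ ?_) (iSup_le fun ε => hle ?_ ?_)
  · refine ((isOpen_preimage_stereo hf ε.1).preimage continuous_fst).inter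
      (((isOpen_preimage_stereo hf ε.2).preimage continuous_snd).inter ?_)
    refine isOpen_ne_fun ?_ continuous_const
    exact ((contDiff_comp_stereo hμ ε.1).continuous.comp continuous_fst).sub
      ((contDiff_comp_stereo hμ ε.2).continuous.comp continuous_snd)
  · refine hsmul (fun z hz => hz.2.2) ?_ (ContDiffOn.sub ?_ ?_)
    · exact (((contDiff_comp_stereo hμ ε.1).comp contDiff_fst).sub
        ((contDiff_comp_stereo hμ ε.2).comp contDiff_snd)).contDiffOn
    · exact (contDiffOn_chart_comp_stereo hf ε.2).comp contDiffOn_snd fun z hz => hz.2.1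
    · exact (contDiffOn_chart_comp_stereo hf ε.1).comp contDiffOn_fst fun z hz => hz.1
  · refine ((isOpen_preimage_stereo hf ε).preimage continuous_fst).inter ?_
    refine isOpen_ne_fun ?_ continuous_const
    exact (((contDiff_comp_stereo hμ ε).continuous_fderiv (by simp)).comp continuous_fst).clm_apply
      continuous_snd
  · refine hsmul (fun z hz => hz.2) ?_ (ContDiffOn.neg ?_)
    · exact ((((contDiff_comp_stereo hμ ε).fderiv_right (m := ∞) le_rfl).comp
        contDiff_fst).clm_apply contDiff_snd).contDiffOn
    · refine ContDiffOn.clm_apply ?_ contDiffOn_snd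
      exact ((contDiffOn_chart_comp_stereo hf ε).fderiv_of_isOpen (m := ∞)
        (isOpen_preimage_stereo hf ε) le_rfl).comp contDiffOn_fst fun z hz => hz.1

end Perturbation
end S2

/-! ### Stability under small perturbations and the induction over functions -/

namespace S2
open Plane DForm

/-- Compactness of `K` makes the condition open in the parameter. It keeps the functions still to be
treated supported over their charts after a perturbation. -/
theorem eventually_subset_preimage {m : ℕ} {M : Type*} [TopologicalSpace M]
    {Φ : EuclideanSpace ℝ (Fin m) × S2 → M} {δ : ℝ} (hδ : 0 < δ)
    (hΦ : ContinuousOn Φ (Metric.ball 0 δ ×ˢ Set.univ)) {K : Set S2} (hK : IsClosed K)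
    {V : Set M} (hV : IsOpen V) (h0 : K ⊆ (fun p => Φ (0, p)) ⁻¹' V) :
    ∀ᶠ a in 𝓝 0, K ⊆ (fun p => Φ (a, p)) ⁻¹' V := by
  refine hK.isCompact.eventually_forall_of_forall_eventually (P := fun a p => Φ (a, p) ∈ V) ?_
  intro p hp
  have : ContinuousAt Φ (0, p) := hΦ.continuousAt
    (prod_mem_nhds (Metric.ball_mem_nhds 0 hδ) Filter.univ_mem)
  exact this.eventually (hV.mem_nhds (h0 hp))

section Perturbation
variable {m : ℕ} {M : Type*} [TopologicalSpace M] [ChartedSpace (EuclideanSpace ℝ (Fin m)) M]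
  [IsManifold (𝓡 m) ∞ M] {x : M} {f : S2 → M} {μ : S2 → ℝ}

theorem mfderiv_eq_zero_iff_fderiv_chart {l : ℕ} {h : EuclideanSpace ℝ (Fin l) → M}
    {y w : EuclideanSpace ℝ (Fin l)}
    (hh : MDifferentiableAt (𝓡 l) (𝓡 m) h y) (hy : h y ∈ (extChartAt (𝓡 m) x).source) :
    mfderiv (𝓡 l) (𝓡 m) h y w = 0 ↔ fderiv ℝ (fun z => extChartAt (𝓡 m) x (h z)) y w = 0 := by
  have h1 : MDifferentiableAt (𝓡 m) (𝓡 m) (extChartAt (𝓡 m) x) (h y) :=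
    mdifferentiableAt_extChartAt (by rwa [← extChartAt_source (𝓡 m)])
  have e1 : mfderiv (𝓡 l) (𝓡 m) (fun z => extChartAt (𝓡 m) x (h z)) y =
      (mfderiv (𝓡 m) (𝓡 m) (extChartAt (𝓡 m) x) (h y)).comp (mfderiv (𝓡 l) (𝓡 m) h y) :=
    mfderiv_comp y h1 hh
  rw [← mfderiv_eq_fderiv, e1]
  constructor
  · intro h0
    change mfderiv (𝓡 m) (𝓡 m) (extChartAt (𝓡 m) x) (h y) (mfderiv (𝓡 l) (𝓡 m) h y w) = 0
    rw [h0, map_zero]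
  · intro h0
    have h2 : mfderiv (𝓡 m) (𝓡 m) (extChartAt (𝓡 m) x) (h y) (mfderiv (𝓡 l) (𝓡 m) h y w) = 0 := h0
    obtain ⟨e, he⟩ := isInvertible_mfderiv_extChartAt (I := 𝓡 m) hy
    rw [← he] at h2
    exact e.map_eq_zero_iff.1 h2

/-- The infinitesimal counterpart of `eq_of_perturb_eq`: in the chart the derivative along `w` is
`df w + dμ w • a`. If this vanishes with `dμ w ≠ 0`, then `a` lies in the second part of `badSet`.
-/
theorem mfderiv_eq_zero_of_perturb (hf : ContMDiff (𝓡 2) (𝓡 m) ∞ f)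
    (hμ : ContMDiff (𝓡 2) 𝓘(ℝ, ℝ) ∞ μ)
    (hsupp : tsupport μ ⊆ f ⁻¹' (extChartAt (𝓡 m) x).source) {δ : ℝ}
    (hδ : ∀ a : EuclideanSpace ℝ (Fin m), ‖a‖ < δ → ∀ p, f p ∈ (extChartAt (𝓡 m) x).source →
        extChartAt (𝓡 m) x (f p) + μ p • a ∈ (extChartAt (𝓡 m) x).target)
    {a : EuclideanSpace ℝ (Fin m)} (ha : ‖a‖ < δ) (hbad : a ∉ badSet x f μ)
    (hF : ContMDiff (𝓡 2) (𝓡 m) ∞ (perturb x f μ a)) {ε : ℤˣ} {y w : Plane}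
    (h : mfderiv (𝓡 2) (𝓡 m) (fun y => perturb x f μ a (stereo ε y)) y w = 0) :
    fderiv ℝ (fun y => μ (stereo ε y)) y w = 0 ∧
      mfderiv (𝓡 2) (𝓡 m) (fun y => f (stereo ε y)) y w = 0 := by
  have hmf : MDifferentiableAt (𝓡 2) (𝓡 m) (fun y => f (stereo ε y)) y :=
    (hf.comp (contMDiff_stereo ε)).mdifferentiable (by simp) y
  by_cases hp : f (stereo ε y) ∈ (extChartAt (𝓡 m) x).source
  · have hmF : MDifferentiableAt (𝓡 2) (𝓡 m) (fun y => perturb x f μ a (stereo ε y)) y :=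
      (hF.comp (contMDiff_stereo ε)).mdifferentiable (by simp) y
    replace h := (mfderiv_eq_zero_iff_fderiv_chart (x := x) hmF
      ((perturb_mem_source_iff hδ ha _).2 hp)).1 h
    rw [and_congr_right_iff.2 fun _ => mfderiv_eq_zero_iff_fderiv_chart (x := x) hmf hp]
    have hO := (isOpen_preimage_stereo (x := x) hf ε).mem_nhds hp
    have hev : (fun z => extChartAt (𝓡 m) x (perturb x f μ a (stereo ε z))) =ᶠ[𝓝 y]
        fun z => extChartAt (𝓡 m) x (f (stereo ε z)) + μ (stereo ε z) • a := by
      filter_upwards [hO] with z hz using chart_perturb hδ ha hz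
    have hdμ : DifferentiableAt ℝ (fun y => μ (stereo ε y)) y :=
      (contDiff_comp_stereo hμ ε).differentiable (by simp) y
    have hdf : DifferentiableAt ℝ (fun y => extChartAt (𝓡 m) x (f (stereo ε y))) y :=
      ((contDiffOn_chart_comp_stereo hf ε).contDiffAt hO).differentiableAt (by simp)
    have hd := hdf.hasFDerivAt.fun_add (hdμ.hasFDerivAt.smul_const a)
    rw [hev.fderiv_eq, hd.fderiv] at h
    have h' : fderiv ℝ (fun y => extChartAt (𝓡 m) x (f (stereo ε y))) y w +
      fderiv ℝ (fun y => μ (stereo ε y)) y w • a = 0 := h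
    by_cases h0 : fderiv ℝ (fun y => μ (stereo ε y)) y w = 0
    · rw [h0, zero_smul, add_zero] at h'
      exact ⟨h0, h'⟩
    · exfalso
      apply hbad
      refine Or.inr (Set.mem_iUnion.2 ⟨ε, (y, w), ⟨hp, h0⟩, ?_⟩)
      rw [inv_smul_eq_iff₀ h0]
      exact (eq_neg_of_add_eq_zero_right h').symm
  · have hev : (fun y => μ (stereo ε y)) =ᶠ[𝓝 y] fun _ => 0 :=
      (contMDiff_stereo ε).continuous.continuousAt.eventually
        (notMem_tsupport_iff_eventuallyEq.1 fun h => hp (hsupp h))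
    have hev' : (fun y => perturb x f μ a (stereo ε y)) =ᶠ[𝓝 y] fun y => f (stereo ε y) := by
      filter_upwards [hev] with z hz
      simp only [perturb, hz, zero_smul, add_zero]
      split_ifs with h
      · exact (extChartAt (𝓡 m) x).left_inv h
      · rfl
    refine ⟨by rw [hev.fderiv_eq]; simp, ?_⟩
    rw [← hev'.mfderiv_eq]
    exact h

/-- The whole family composed with `cap` is a single map `H` on an open subset of `ℝ^(m+2)`.
Smoothness of the pullback of `σ` by `H` makes the integrand jointly continuous in the parameter and
the point, so the integral is continuous in `a`. -/
theorem eventually_integral_neg {σ : DForm m M 2} (hσ : σ.IsSmooth)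
    {Φ : EuclideanSpace ℝ (Fin m) × S2 → M} {δ : ℝ} (hδ : 0 < δ)
    (hΦ : ContMDiffOn ((𝓡 m).prod (𝓡 2)) (𝓡 m) ∞ Φ (Metric.ball 0 δ ×ˢ Set.univ))
    (h0 : integral (pullback (l := 2) (fun p => Φ (0, p)) σ) < 0) :
    ∀ᶠ a in 𝓝 0, integral (pullback (l := 2) (fun p => Φ (a, p)) σ) < 0 := by
  have hT2 : T2Space (EuclideanSpace ℝ (Fin (m + 2))) := TopologicalSpace.t2Space_of_metrizableSpace
  obtain ⟨L⟩ : Nonempty (EuclideanSpace ℝ (Fin (m + 2)) ≃L[ℝ] EuclideanSpace ℝ (Fin m) × Plane) :=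
    ⟨ContinuousLinearEquiv.ofFinrankEq (by simp)⟩
  set O : Set (EuclideanSpace ℝ (Fin (m + 2))) := {z | (L z).1 ∈ Metric.ball 0 δ} with hOdef
  have hO : IsOpen O := Metric.isOpen_ball.preimage (continuous_fst.comp L.continuous)
  set H : EuclideanSpace ℝ (Fin (m + 2)) → M := fun z => Φ ((L z).1, cap (L z).2) with hHdef
  have hH : ContMDiffOn (𝓡 (m + 2)) (𝓡 m) ∞ H O := by
    have h1 : ContMDiff (𝓡 (m + 2)) ((𝓡 m).prod (𝓡 2)) ∞
        (fun z : EuclideanSpace ℝ (Fin (m + 2)) => ((L z).1, cap (L z).2)) := by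
      refine ContMDiff.prodMk ?_ (contMDiff_cap.comp ?_)
      · exact (contDiff_fst.comp L.contDiff).contMDiff
      · exact (contDiff_snd.comp L.contDiff).contMDiff
    exact hΦ.comp h1.contMDiffOn fun z hz => ⟨hz, trivial⟩
  have hcont := (contDiffOn_epullback hσ hO hH).continuousOn
  have hsm : ∀ a ∈ Metric.ball (0 : EuclideanSpace ℝ (Fin m)) δ,
      ContMDiff (𝓡 2) (𝓡 m) ∞ fun p => Φ (a, p) := by
    intro a ha
    rw [← contMDiffOn_univ]
    exact hΦ.comp (contMDiff_const.prodMk contMDiff_id).contMDiffOn fun p _ => ⟨ha, trivial⟩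
  have hkey : ∀ a ∈ Metric.ball (0 : EuclideanSpace ℝ (Fin m)) δ, ∀ y : Plane,
      epullback ((fun p => Φ (a, p)) ∘ cap) σ y ![e₀, e₁] =
        epullback H σ (L.symm (a, y)) ![L.symm (0, e₀), L.symm (0, e₁)] := by
    intro a ha y
    have hg : HasFDerivAt (fun y : Plane => L.symm (a, y))
        (L.symm.toContinuousLinearMap.comp (ContinuousLinearMap.inr ℝ _ _)) y :=
      L.symm.toContinuousLinearMap.hasFDerivAt.comp y (hasFDerivAt_prodMk_right a y)
    have hcomp : (fun p => Φ (a, p)) ∘ cap = H ∘ fun y : Plane => L.symm (a, y) := by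
      funext z
      simp [hHdef]
    have hmem : L.symm (a, y) ∈ O := by simpa [hOdef] using ha
    rw [hcomp, epullback, pullback_comp_apply (f := H)
      (g := fun y : Plane => L.symm (a, y)) σ (((hH _ hmem).contMDiffAt (hO.mem_nhds hmem)).mdifferentiableAt (by simp))
      hg.differentiableAt.mdifferentiableAt]
    rw [pullback, mfderiv_eq_fderiv, hg.fderiv]
    change epullback H σ (L.symm (a, y)) _ = _
    congr 1
    funext i
    fin_cases i <;> rfl
  have hint : Continuous fun a : Metric.ball (0 : EuclideanSpace ℝ (Fin m)) δ =>
      integral (pullback (l := 2) (fun p => Φ (a, p)) σ) := by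
    have : (fun a : Metric.ball (0 : EuclideanSpace ℝ (Fin m)) δ =>
        integral (pullback (l := 2) (fun p => Φ (a, p)) σ)) = fun a : Metric.ball (0 : EuclideanSpace ℝ (Fin m)) δ =>
        squareIntegral 2 fun y =>
          epullback H σ (L.symm (a, y)) ![L.symm (0, e₀), L.symm (0, e₁)] := by
      funext a
      rw [integral_pullback (hsm a a.2)]
      exact congrArg _ (funext fun y => hkey a a.2 y)
    rw [this]
    have hc : Continuous fun z : Metric.ball (0 : EuclideanSpace ℝ (Fin m)) δ × ℝ × ℝ =>
        epullback H σ (L.symm (z.1, !₂[z.2.1, z.2.2])) ![L.symm (0, e₀), L.symm (0, e₁)] := by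
      have h1 : Continuous fun z : Metric.ball (0 : EuclideanSpace ℝ (Fin m)) δ × ℝ × ℝ =>
          L.symm ((z.1 : EuclideanSpace ℝ (Fin m)), (!₂[z.2.1, z.2.2] : Plane)) :=
        L.symm.continuous.comp ((continuous_subtype_val.comp continuous_fst).prodMk
          (continuous_mk.comp continuous_snd))
      have h2 := hcont.comp_continuous h1 fun z => by
        simpa [hOdef, -Subtype.coe_prop] using z.1.2
      exact (ContinuousAlternatingMap.apply ℝ _ ℝ _).continuous.comp h2
    simp only [squareIntegral]
    refine intervalIntegral.continuous_parametric_intervalIntegral_of_continuous' ?_ _ _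
    refine intervalIntegral.continuous_parametric_intervalIntegral_of_continuous'
      (f := fun (z : Metric.ball (0 : EuclideanSpace ℝ (Fin m)) δ × ℝ) t =>
        epullback H σ (L.symm (z.1, !₂[z.2, t])) ![L.symm (0, e₀), L.symm (0, e₁)]) ?_ _ _
    exact hc.comp ((continuous_fst.comp continuous_fst).prodMk
      ((continuous_snd.comp continuous_fst).prodMk continuous_snd))
  have hc0 : ContinuousAt (fun a => integral (pullback (l := 2) (fun p => Φ (a, p)) σ)) 0 :=
    (continuousOn_iff_continuous_domRestrict.2 hint).continuousAt (Metric.ball_mem_nhds 0 hδ)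
  exact hc0.eventually (gt_mem_nhds h0)

/-- Each move avoids its `badSet`, so it creates no new coincidences or critical vectors, and those
that remain are not seen by the function used. Being small, it also preserves the negative integral
and the support conditions for the rest of the list. -/
theorem exists_separated_by (hm : 4 < m) {σ : DForm m M 2} (hσ : σ.IsSmooth)
    (l : List (M × (S2 → ℝ))) : ∀ {f : S2 → M}, ContMDiff (𝓡 2) (𝓡 m) ∞ f →
      integral (pullback (l := 2) f σ) < 0 →
      (∀ c ∈ l, ContMDiff (𝓡 2) 𝓘(ℝ, ℝ) ∞ c.2 ∧
        tsupport c.2 ⊆ f ⁻¹' (extChartAt (𝓡 m) c.1).source) →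
      ∃ f' : S2 → M, ContMDiff (𝓡 2) (𝓡 m) ∞ f' ∧ integral (pullback (l := 2) f' σ) < 0 ∧
        (∀ p q, f' p = f' q → f p = f q ∧ ∀ c ∈ l, c.2 p = c.2 q) ∧
        ∀ (ε : ℤˣ) (y w : Plane), mfderiv (𝓡 2) (𝓡 m) (fun y => f' (stereo ε y)) y w = 0 →
          mfderiv (𝓡 2) (𝓡 m) (fun y => f (stereo ε y)) y w = 0 ∧
          ∀ c ∈ l, fderiv ℝ (fun y => c.2 (stereo ε y)) y w = 0 := by
  induction l with
  | nil =>
    intro f hf hneg _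
    exact ⟨f, hf, hneg, fun p q h => ⟨h, by simp⟩, fun ε y w h => ⟨h, by simp⟩⟩
  | cons c l ih =>
    intro f hf hneg hl
    obtain ⟨hμ, hsupp⟩ := hl c List.mem_cons_self
    obtain ⟨δ, hδ0, hδ⟩ := exists_radius hf hμ hsupp
    have hΦ := contMDiffOn_perturb hf hμ hsupp hδ
    have hzero : (fun p => perturb c.1 f c.2 (0 : EuclideanSpace ℝ (Fin m)) p) = f := perturb_zero
    have h1 := eventually_integral_neg hσ hδ0 hΦ (by simpa only [hzero] using hneg)
    have h2 : ∀ᶠ a : EuclideanSpace ℝ (Fin m) in 𝓝 0, ∀ c' ∈ l,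
        tsupport c'.2 ⊆ perturb c.1 f c.2 a ⁻¹' (extChartAt (𝓡 m) c'.1).source := by
      have := (List.finite_toSet l).eventually_all (l := 𝓝 (0 : EuclideanSpace ℝ (Fin m)))
        (p := fun c' a => tsupport c'.2 ⊆ perturb c.1 f c.2 a ⁻¹' (extChartAt (𝓡 m) c'.1).source)
      refine this.2 fun c' hc' => ?_
      refine eventually_subset_preimage hδ0 hΦ.continuousOn (isClosed_tsupport _)
        (isOpen_extChartAt_source c'.1) ?_
      simp only [hzero]
      exact (hl c' (List.mem_cons_of_mem _ hc')).2
    have h3 := Metric.ball_mem_nhds (0 : EuclideanSpace ℝ (Fin m)) hδ0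
    obtain ⟨a, hbad, ⟨ha1, ha2⟩, ha3⟩ := ((dense_compl_badSet hm hf hμ (x := c.1)).inter_nhds_nonempty
      (Filter.inter_mem (Filter.inter_mem h1 h2) h3))
    rw [mem_ball_zero_iff] at ha3
    have hF : ContMDiff (𝓡 2) (𝓡 m) ∞ (perturb c.1 f c.2 a) := by
      rw [← contMDiffOn_univ]
      exact hΦ.comp (contMDiff_const.prodMk contMDiff_id).contMDiffOn fun p _ =>
        ⟨mem_ball_zero_iff.2 ha3, trivial⟩
    obtain ⟨f', hf', hneg', hsep, hker⟩ := ih hF ha1 fun c' hc' =>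
      ⟨(hl c' (List.mem_cons_of_mem _ hc')).1, ha2 c' hc'⟩
    refine ⟨f', hf', hneg', fun p q h => ?_, fun ε y w h => ?_⟩
    · obtain ⟨h4, h5⟩ := hsep p q h
      obtain ⟨h6, h7⟩ := eq_of_perturb_eq hsupp hδ ha3 hbad h4
      exact ⟨h7, List.forall_mem_cons.2 ⟨h6, h5⟩⟩
    · obtain ⟨h4, h5⟩ := hker ε y w h
      obtain ⟨h6, h7⟩ := mfderiv_eq_zero_of_perturb hf hμ hsupp hδ ha3 hbad hF h4
      exact ⟨h7, List.forall_mem_cons.2 ⟨h6, h5⟩⟩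

end Perturbation
end S2

/-! ### Separating functions and injective immersions of the sphere -/

namespace S2
open Plane DForm

theorem contDiff_coe_stereo_apply (ε : ℤˣ) (i : Fin 3) :
    ContDiff ℝ ∞ fun y => (stereo ε y).1 i :=
  (EuclideanSpace.proj i : EuclideanSpace ℝ (Fin 3) →L[ℝ] ℝ).contDiff.comp
    (contMDiff_iff_contDiff.1 (contMDiff_coe.comp (contMDiff_stereo ε)))

/-- Differentiating `y i * (1 - ε x₂) = x j`, where `x` is the point of the sphere, leaves `w i * (1
- ε x₂) = 0` when the derivatives of all the coordinates of `x` vanish, and the factor is nonzero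
away from the pole. -/
theorem eq_zero_of_fderiv_stereo_eq_zero {ε : ℤˣ} {y w : Plane}
    (h : ∀ i, fderiv ℝ (fun y => (stereo ε y).1 i) y w = 0) : w = 0 := by
  have hd : ∀ i, HasFDerivAt (fun y => (stereo ε y).1 i)
      (fderiv ℝ (fun y => (stereo ε y).1 i) y) y := fun i =>
    ((contDiff_coe_stereo_apply ε i).differentiable (by simp) y).hasFDerivAt
  have hne : ∀ y, 1 - ((ε : ℤ) : ℝ) * (stereo ε y).1 2 ≠ 0 := fun y =>
    fun h => stereo_ne_pole ε y (eq_pole_iff.2 h)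
  have key : ∀ (i : Fin 2) (j : Fin 3),
      (∀ y, y i * (1 - (ε : ℤ) * (stereo ε y).1 2) = (stereo ε y).1 j) → w i = 0 := by
    intro i j hij
    have h1 := ((EuclideanSpace.proj i : Plane →L[ℝ] ℝ).hasFDerivAt (x := y)).fun_mul
      (((hd 2).const_mul ((ε : ℤ) : ℝ)).const_sub 1)
    have h2 := DFunLike.congr_fun (h1.unique ((hd j).congr_of_eventuallyEq
      (Filter.Eventually.of_forall hij))) w
    simp [h] at h2
    exact h2.resolve_left (hne y)
  have h0 : ∀ y : Plane, y 0 * (1 - (ε : ℤ) * (stereo ε y).1 2) = (stereo ε y).1 0 := fun y => by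
    conv_lhs => rw [← proj_stereo ε y, stereo_proj (stereo_ne_pole ε y)]
    exact div_mul_cancel₀ _ (hne y)
  have h1 : ∀ y : Plane, y 1 * (1 - (ε : ℤ) * (stereo ε y).1 2) = (stereo ε y).1 1 := fun y => by
    conv_lhs => rw [← proj_stereo ε y, stereo_proj (stereo_ne_pole ε y)]
    exact div_mul_cancel₀ _ (hne y)
  ext i
  fin_cases i
  · exact key 0 0 h0
  · exact key 1 1 h1

/-- Finitely many smooth functions, each supported over the domain of a chart, that separate the
points and the tangent vectors of the sphere. -/
theorem exists_separating_functions {m : ℕ} {M : Type*} [TopologicalSpace M]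
    [ChartedSpace (EuclideanSpace ℝ (Fin m)) M] {g : S2 → M} (hg : Continuous g) :
    ∃ l : List (M × (S2 → ℝ)),
      (∀ c ∈ l, ContMDiff (𝓡 2) 𝓘(ℝ, ℝ) ∞ c.2 ∧
        tsupport c.2 ⊆ g ⁻¹' (extChartAt (𝓡 m) c.1).source) ∧
      (∀ p q : S2, (∀ c ∈ l, c.2 p = c.2 q) → p = q) ∧
      ∀ (ε : ℤˣ) (y w : Plane), (∀ c ∈ l, fderiv ℝ (fun y => c.2 (stereo ε y)) y w = 0) →
        w = 0 := by
  have := finrank_eq_two_add_one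
  have hχ : ∀ p : S2, ∃ χ : S2 → ℝ, ContMDiff (𝓡 2) 𝓘(ℝ, ℝ) ∞ χ ∧
      tsupport χ ⊆ g ⁻¹' (extChartAt (𝓡 m) (g p)).source ∧ χ =ᶠ[𝓝 p] 1 := fun p => by
    obtain ⟨χ, -, h⟩ := (SmoothBumpFunction.nhds_basis_tsupport (I := 𝓡 2) p).mem_iff.1
      (((isOpen_extChartAt_source (I := 𝓡 m) (g p)).preimage hg).mem_nhds
        (mem_extChartAt_source (I := 𝓡 m) (g p)))
    exact ⟨χ, χ.contMDiff, h, χ.eventuallyEq_one⟩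
  choose χ hχs hχt hχ1 using hχ
  obtain ⟨t, -, ht⟩ := isCompact_univ.elim_nhds_subcover (fun p => {q | χ p =ᶠ[𝓝 q] 1})
    fun p _ => (hχ1 p).eventuallyEq_nhds
  have ht' : ∀ q, ∃ p ∈ t, χ p =ᶠ[𝓝 q] 1 := fun q => by
    simpa using ht (Set.mem_univ q)
  have hx : ∀ i : Fin 3, ContMDiff (𝓡 2) 𝓘(ℝ, ℝ) ∞ fun q : S2 => q.1 i := fun i =>
    (EuclideanSpace.proj i : EuclideanSpace ℝ (Fin 3) →L[ℝ] ℝ).contDiff.contMDiff.comp contMDiff_coe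
  -- Each bump function is listed together with its products with the three coordinates: agreement
  -- of `χ` at two points forces the value one at both, and the products then compare the
  -- coordinates. Near a point where `χ` is locally one, the products have the derivatives of the
  -- coordinates.
  refine ⟨t.toList.flatMap fun p => (g p, χ p) :: List.ofFn fun i : Fin 3 =>
    (g p, fun q => χ p q * q.1 i), fun c hc => ?_, fun p q h => ?_, fun ε y w h => ?_⟩
  · simp only [List.mem_flatMap, Finset.mem_toList, List.mem_cons, List.mem_ofFn] at hc
    obtain ⟨p, -, rfl | ⟨i, rfl⟩⟩ := hc
    · exact ⟨hχs p, hχt p⟩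
    · exact ⟨(hχs p).mul (hx i), (tsupport_mul_subset_left).trans (hχt p)⟩
  · simp only [List.mem_flatMap, Finset.mem_toList, List.mem_cons, List.mem_ofFn] at h
    obtain ⟨r, hr, hrp⟩ := ht' p
    have h1 := h (g r, χ r) ⟨r, hr, Or.inl rfl⟩
    have hp1 : χ r p = 1 := hrp.eq_of_nhds
    have hq1 : χ r q = 1 := h1.symm.trans hp1
    ext i
    have h2 := h (g r, fun q => χ r q * q.1 i) ⟨r, hr, Or.inr ⟨i, rfl⟩⟩
    simpa only [hp1, hq1, one_mul] using h2
  · simp only [List.mem_flatMap, Finset.mem_toList, List.mem_cons, List.mem_ofFn] at h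
    obtain ⟨r, hr, hrp⟩ := ht' (stereo ε y)
    refine eq_zero_of_fderiv_stereo_eq_zero (ε := ε) (y := y) fun i => ?_
    have h2 := h (g r, fun q => χ r q * q.1 i) ⟨r, hr, Or.inr ⟨i, rfl⟩⟩
    rw [← h2]
    congr 1
    refine Filter.EventuallyEq.fderiv_eq ?_
    filter_upwards [(contMDiff_stereo ε).continuous.continuousAt.eventually hrp] with z hz
    simp [hz]

/-- In dimension greater than four, a smooth map of the sphere can be perturbed into an injective
immersion, keeping the integral of a form negative. -/
theorem exists_injective_immersion {m : ℕ} (hm : 4 < m) {M : Type*} [TopologicalSpace M]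
    [ChartedSpace (EuclideanSpace ℝ (Fin m)) M] [IsManifold (𝓡 m) ∞ M] {σ : DForm m M 2}
    (hσ : σ.IsSmooth) {g : S2 → M} (hg : ContMDiff (𝓡 2) (𝓡 m) ∞ g)
    (hneg : integral (pullback (l := 2) g σ) < 0) :
    ∃ f : S2 → M, ContMDiff (𝓡 2) (𝓡 m) ∞ f ∧ integral (pullback (l := 2) f σ) < 0 ∧
      Function.Injective f ∧ ∀ p, Function.Injective (mfderiv (𝓡 2) (𝓡 m) f p) := by
  obtain ⟨l, hl, hsep, hker⟩ := exists_separating_functions (m := m) hg.continuous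
  obtain ⟨f, hf, hfneg, hfsep, hfker⟩ := exists_separated_by hm hσ l hg hneg hl
  refine ⟨f, hf, hfneg, fun p q h => hsep p q (hfsep p q h).2, fun p => ?_⟩
  refine (injective_iff_map_eq_zero (mfderiv (𝓡 2) (𝓡 m) f p)).2 fun v hv => ?_
  obtain ⟨ε, y, rfl⟩ := exists_stereo p
  have h1 := mfderiv_stereo_comp_mfderiv_proj ε y v
  set w : Plane := mfderiv (𝓡 2) (𝓡 2) (proj ε) (stereo ε y) v with hw
  have h2 : mfderiv (𝓡 2) (𝓡 m) (f ∘ stereo ε) y w = 0 := by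
    rw [mfderiv_comp y (hf.mdifferentiable (by simp) _) (mdifferentiable_stereo ε y)]
    change mfderiv (𝓡 2) (𝓡 m) f (stereo ε y) (mfderiv (𝓡 2) (𝓡 2) (stereo ε) y w) = 0
    rw [h1]
    exact hv
  have h3 : w = 0 := hker ε y w (hfker ε y w h2).2
  rw [← h1, h3]
  exact map_zero (mfderiv (𝓡 2) (𝓡 2) (stereo ε) y)

end S2

/-! ### Injective immersions of compact manifolds are embeddings -/

/-- The inverse function theorem for smooth maps, with an inverse that is smooth on its whole
domain. -/
theorem ContDiffOn.exists_openPartialHomeomorph {E : Type*} [NormedAddCommGroup E]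
    [NormedSpace ℝ E] [CompleteSpace E] {Ψ : E → E} {O : Set E} (hO : IsOpen O)
    (hΨ : ContDiffOn ℝ ∞ Ψ O) {a : E} (ha : a ∈ O)
    (h : HasFDerivAt Ψ (ContinuousLinearEquiv.refl ℝ E : E →L[ℝ] E) a) :
    ∃ Θ : OpenPartialHomeomorph E E, a ∈ Θ.source ∧ Θ.source ⊆ O ∧ (Θ : E → E) = Ψ ∧
      ContDiffOn ℝ ∞ Θ.symm Θ.target := by
  -- Invertibility of the derivative is an open condition; restricting to `W` makes the inverse
  -- smooth at every point of its domain, not only at `Ψ a`.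
  set W : Set E := O ∩ fderiv ℝ Ψ ⁻¹' Set.range ((↑) : (E ≃L[ℝ] E) → E →L[ℝ] E) with hW
  have hWo : IsOpen W := (hΨ.continuousOn_fderiv_of_isOpen hO (by simp)).isOpen_inter_preimage hO
    ContinuousLinearEquiv.isOpen
  have haW : a ∈ W := ⟨ha, by rw [Set.mem_preimage, h.fderiv]; exact ⟨_, rfl⟩⟩
  have hat := hΨ.contDiffAt (hO.mem_nhds ha)
  set Θ := (hat.toOpenPartialHomeomorph Ψ h (by simp)).restrOpen W hWo with hΘ
  have hcoe : (Θ : E → E) = Ψ := rfl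
  refine ⟨Θ, ⟨hat.mem_toOpenPartialHomeomorph_source h (by simp), haW⟩,
    fun z hz => hz.2.1, hcoe, fun z hz => ContDiffAt.contDiffWithinAt ?_⟩
  have hz' : Θ.symm z ∈ W := (Θ.map_target hz).2
  obtain ⟨e, he⟩ := hz'.2
  have h1 := hΨ.contDiffAt (hO.mem_nhds hz'.1)
  refine Θ.contDiffAt_symm (f₀' := e) hz ?_ h1
  rw [he]
  exact (h1.differentiableAt (by simp)).hasFDerivAt

theorem exists_continuousLinearEquiv_extend {d m : ℕ}
    {A : EuclideanSpace ℝ (Fin d) →L[ℝ] EuclideanSpace ℝ (Fin m)} (hA : Function.Injective A) :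
    ∃ e : (EuclideanSpace ℝ (Fin d) × EuclideanSpace ℝ (Fin (m - d))) ≃L[ℝ]
      EuclideanSpace ℝ (Fin m), ∀ v, e (v, 0) = A v := by
  obtain ⟨C, hC⟩ := (LinearMap.range A.toLinearMap).exists_isCompl
  have h1 : Module.finrank ℝ (LinearMap.range A.toLinearMap) = d := by
    rw [LinearMap.finrank_range_of_inj hA]; simp
  have h2 := Submodule.finrank_add_eq_of_isCompl hC
  rw [h1, finrank_euclideanSpace_fin] at h2
  let B : EuclideanSpace ℝ (Fin (m - d)) ≃ₗ[ℝ] C :=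
    LinearEquiv.ofFinrankEq _ _ (by rw [finrank_euclideanSpace_fin]; omega)
  let B' : EuclideanSpace ℝ (Fin (m - d)) →ₗ[ℝ] EuclideanSpace ℝ (Fin m) :=
    C.subtype ∘ₗ B.toLinearMap
  have hB' : LinearMap.range B' = C := by
    rw [LinearMap.range_comp, LinearEquiv.range, Submodule.map_top, Submodule.range_subtype]
  have hinj : Function.Injective (A.toLinearMap.coprod B') := by
    rw [← LinearMap.ker_eq_bot, LinearMap.ker_coprod_of_disjoint_range _ _ (by
      rw [hB']; exact hC.disjoint), LinearMap.ker_eq_bot.2 hA, LinearMap.ker_eq_bot.2 (by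
      exact C.subtype_injective.comp B.injective), Submodule.prod_bot]
  let e := LinearMap.linearEquivOfInjective (A.toLinearMap.coprod B') hinj (by simp; omega)
  refine ⟨e.toContinuousLinearEquiv, fun v => ?_⟩
  change A v + B' 0 = A v
  rw [map_zero, add_zero]

section Immersion
variable {d m : ℕ} {N : Type*} [TopologicalSpace N] [ChartedSpace (EuclideanSpace ℝ (Fin d)) N]
  [IsManifold (𝓡 d) ∞ N] {M : Type*} [TopologicalSpace M]
  [ChartedSpace (EuclideanSpace ℝ (Fin m)) M] [IsManifold (𝓡 m) ∞ M]

theorem injective_fderiv_chart_comp {f : N → M} (hf : ContMDiff (𝓡 d) (𝓡 m) ∞ f) (x : N)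
    (hinj : Function.Injective (mfderiv (𝓡 d) (𝓡 m) f x)) :
    Function.Injective (fderiv ℝ (fun y => extChartAt (𝓡 m) (f x) (f ((extChartAt (𝓡 d) x).symm y)))
      (extChartAt (𝓡 d) x x)) := by
  set y := extChartAt (𝓡 d) x x with hy
  have hyx : (extChartAt (𝓡 d) x).symm y = x := extChartAt_to_inv x
  refine (injective_iff_map_eq_zero _).2 fun w hw => ?_
  have h1 : MDifferentiableAt (𝓡 d) (𝓡 d) (extChartAt (𝓡 d) x).symm y := by
    have := mdifferentiableWithinAt_extChartAt_symm (I := 𝓡 d) (mem_extChartAt_target x)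
    rw [modelWithCornersSelf_coe, Set.range_id] at this
    exact this.mdifferentiableAt Filter.univ_mem
  have h2 : MDifferentiableAt (𝓡 d) (𝓡 m) f ((extChartAt (𝓡 d) x).symm y) :=
    hf.mdifferentiable (by simp) _
  have h3 := (S2.mfderiv_eq_zero_iff_fderiv_chart (x := f x)
    (h := fun z => f ((extChartAt (𝓡 d) x).symm z)) (h2.comp y h1)
    (by rw [hyx]; exact mem_extChartAt_source (f x))).2 hw
  have h4 : mfderiv (𝓡 d) (𝓡 m) (fun z => f ((extChartAt (𝓡 d) x).symm z)) y =
    (mfderiv (𝓡 d) (𝓡 m) f ((extChartAt (𝓡 d) x).symm y)).comp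
      (mfderiv (𝓡 d) (𝓡 d) (extChartAt (𝓡 d) x).symm y) := mfderiv_comp y h2 h1
  rw [h4] at h3
  have h5 : Function.Injective (mfderiv (𝓡 d) (𝓡 m) f ((extChartAt (𝓡 d) x).symm y)) := by
    rw [hyx]; exact hinj
  have h6 : mfderiv (𝓡 d) (𝓡 d) (extChartAt (𝓡 d) x).symm y w = 0 :=
    (injective_iff_map_eq_zero _).1 h5 _ h3
  obtain ⟨e, he⟩ := isInvertible_mfderivWithin_extChartAt_symm (I := 𝓡 d)
    (mem_extChartAt_target x)
  rw [modelWithCornersSelf_coe, Set.range_id, mfderivWithin_univ] at he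
  rw [← he] at h6
  exact e.map_eq_zero_iff.1 h6

/-- The coordinate expression `h` of `f` is straightened by the inverse function theorem: adding a
complement of the image of its derivative extends `h` to a local diffeomorphism `Ψ` of `ℝᵐ`. In the
target chart followed by the inverse of `Ψ`, the map becomes the linear inclusion `u ↦ e (u, 0)`. -/
theorem isImmersion_of_injective_mfderiv {f : N → M} (hf : ContMDiff (𝓡 d) (𝓡 m) ∞ f)
    (hinj : ∀ x, Function.Injective (mfderiv (𝓡 d) (𝓡 m) f x)) :
    Manifold.IsImmersion (𝓡 d) (𝓡 m) ∞ f := by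
  refine ⟨EuclideanSpace ℝ (Fin (m - d)), inferInstance, inferInstance, fun x => ?_⟩
  set φ := chartAt (EuclideanSpace ℝ (Fin d)) x with hφ
  set ψ := chartAt (EuclideanSpace ℝ (Fin m)) (f x) with hψ
  set h : EuclideanSpace ℝ (Fin d) → EuclideanSpace ℝ (Fin m) := fun y => ψ (f (φ.symm y)) with hh
  have hA : Function.Injective (fderiv ℝ h (φ x)) := injective_fderiv_chart_comp hf x (hinj x)
  obtain ⟨e, he⟩ := exists_continuousLinearEquiv_extend hA
  set U : Set (EuclideanSpace ℝ (Fin d)) := φ.target ∩ φ.symm ⁻¹' (f ⁻¹' ψ.source) with hU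
  have hUo : IsOpen U := φ.symm.continuousOn.isOpen_inter_preimage φ.open_target
    (ψ.open_source.preimage hf.continuous)
  have hxU : φ x ∈ U := by
    refine ⟨mem_chart_target _ x, ?_⟩
    rw [Set.mem_preimage, φ.left_inv (mem_chart_source _ x)]
    exact mem_chart_source _ (f x)
  have hhU : ContDiffOn ℝ ∞ h U := by
    rw [← contMDiffOn_iff_contDiffOn]
    exact contMDiffOn_chart.comp (hf.comp_contMDiffOn
      (contMDiffOn_chart_symm.mono Set.inter_subset_left)) fun y hy => hy.2
  -- In the coordinates given by `e` this is `(u, w) ↦ h u + e (0, w)`. As `e` extends the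
  -- derivative of `h` at `φ x`, the derivative of `Ψ` at `e (φ x, 0)` is the identity.
  set Ψ : EuclideanSpace ℝ (Fin m) → EuclideanSpace ℝ (Fin m) := fun z =>
    h (e.symm z).1 + e (0, (e.symm z).2) with hΨ
  set O : Set (EuclideanSpace ℝ (Fin m)) := {z | (e.symm z).1 ∈ U} with hO
  have hOo : IsOpen O := hUo.preimage (continuous_fst.comp e.symm.continuous)
  have hΨO : ContDiffOn ℝ ∞ Ψ O := by
    refine ContDiffOn.add (hhU.comp (contDiff_fst.comp e.symm.contDiff).contDiffOn fun z hz => hz) ?_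
    exact (e.contDiff.comp (contDiff_const.prodMk (contDiff_snd.comp e.symm.contDiff))).contDiffOn
  have hmem : e (φ x, 0) ∈ O := by simpa [hO] using hxU
  have hder : HasFDerivAt Ψ (ContinuousLinearEquiv.refl ℝ (EuclideanSpace ℝ (Fin m)) :
      EuclideanSpace ℝ (Fin m) →L[ℝ] EuclideanSpace ℝ (Fin m)) (e (φ x, 0)) := by
    have h1 : HasFDerivAt h (fderiv ℝ h (φ x)) (e.symm (e (φ x, 0))).1 := by
      rw [e.symm_apply_apply]
      exact ((hhU.contDiffAt (hUo.mem_nhds hxU)).differentiableAt (by simp)).hasFDerivAt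
    have h2 := (h1.comp (e (φ x, 0)) ((ContinuousLinearMap.fst ℝ _ _).comp
      e.symm.toContinuousLinearMap).hasFDerivAt).add ((e.toContinuousLinearMap.comp
      ((ContinuousLinearMap.inr ℝ _ _).comp ((ContinuousLinearMap.snd ℝ _ _).comp
        e.symm.toContinuousLinearMap))).hasFDerivAt (x := e (φ x, 0)))
    refine h2.congr_fderiv ?_
    ext1 z
    obtain ⟨⟨v, w⟩, rfl⟩ := e.surjective z
    simp only [_root_.add_apply, ContinuousLinearMap.comp_apply,
      ContinuousLinearEquiv.coe_coe, e.symm_apply_apply, ContinuousLinearMap.coe_fst',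
      ContinuousLinearMap.coe_snd', ContinuousLinearMap.inr_apply, ContinuousLinearEquiv.coe_refl',
      id]
    rw [← he, ← map_add]
    simp
  obtain ⟨Θ, hΘx, hΘO, hΘΨ, hΘs⟩ := hΨO.exists_openPartialHomeomorph hOo hmem hder
  have hΘ0 : ∀ u, Θ (e (u, 0)) = h u := fun u => by
    rw [hΘΨ]
    simp only [hΨ, e.symm_apply_apply]
    rw [show ((0 : EuclideanSpace ℝ (Fin d)), (0 : EuclideanSpace ℝ (Fin (m - d)))) = 0 from rfl,
      map_zero, add_zero]
  -- The source chart is shrunk so that `e (u, 0)` stays where `Θ` can be inverted.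
  set V : Set (EuclideanSpace ℝ (Fin d)) := {u | e (u, 0) ∈ Θ.source} with hV
  have hVo : IsOpen V := Θ.open_source.preimage
    (e.continuous.comp (continuous_id.prodMk continuous_const))
  refine Manifold.IsImmersionAtOfComplement.mk_of_continuousAt hf.continuous.continuousAt e
    (φ ≫ₕ OpenPartialHomeomorph.ofSet V hVo) (ψ ≫ₕ Θ.symm) ?_ ?_ ?_ ?_ ?_
  · simp only [mfld_simps]
    exact ⟨mem_chart_source _ x, hΘx⟩
  · simp only [mfld_simps]
    refine ⟨mem_chart_source _ (f x), ?_⟩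
    have := Θ.map_source hΘx
    rw [hΘ0] at this
    simpa [hh, φ.left_inv (mem_chart_source _ x)] using this
  · refine OpenPartialHomeomorph.mem_maximalAtlas_of_contMDiffOn _ ?_ ?_
    · exact contMDiffOn_chart.mono fun y hy => hy.1
    · exact contMDiffOn_chart_symm.mono fun y hy => hy.2
  · refine OpenPartialHomeomorph.mem_maximalAtlas_of_contMDiffOn _ ?_ ?_
    · exact hΘs.contMDiffOn.comp (contMDiffOn_chart.mono fun y hy => hy.1) fun y hy => hy.2
    · have hΘc : ContMDiffOn (𝓡 m) (𝓡 m) ∞ Θ Θ.source := by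
        rw [hΘΨ]
        exact (hΨO.mono hΘO).contMDiffOn
      exact contMDiffOn_chart_symm.comp (t := ψ.target) (hΘc.mono fun y hy => hy.1)
        fun y hy => hy.2
  · intro u hu
    have hu' : u ∈ V ∧ u ∈ φ.target := by
      simpa only [mfld_simps, OpenPartialHomeomorph.extend_target] using hu
    change Θ.symm (ψ (f (φ.symm u))) = e (u, 0)
    rw [← Θ.left_inv hu'.1, hΘ0]

theorem isSmoothEmbedding_of_injective [CompactSpace N] [T2Space M] {f : N → M}
    (hf : ContMDiff (𝓡 d) (𝓡 m) ∞ f) (hinj : Function.Injective f)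
    (hinj' : ∀ x, Function.Injective (mfderiv (𝓡 d) (𝓡 m) f x)) :
    Manifold.IsSmoothEmbedding (𝓡 d) (𝓡 m) ∞ f :=
  ⟨isImmersion_of_injective_mfderiv hf hinj',
    (hf.continuous.isClosedEmbedding hinj).isEmbedding⟩

end Immersion

end

theorem lemma3p1 (n : ℕ) (hn : 3 ≤ n)
    {M : Type*} [TopologicalSpace M] [ChartedSpace (EuclideanSpace ℝ (Fin (2 * n))) M]
    [IsManifold (𝓡 (2 * n)) ∞ M] [T2Space M] [CompactSpace M]
    (σ : DForm (2 * n) M 2) (hσ : σ.IsSymplectic)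
    (hπ : σ.EvaluatesNontriviallyOnPi2) :
    ∃ f : S2 → M, Manifold.IsSmoothEmbedding (𝓡 2) (𝓡 (2 * n)) ∞ f ∧
      ∃ k : ℝ, 0 < k ∧
        DForm.Cohomologous (DForm.pullback f σ) (k • standardFormS2) := by
  obtain ⟨g, hg, hgneg⟩ := S2.exists_integral_neg hσ.smooth hπ
  -- The assumption `3 ≤ n` enters here, as `4 < 2 * n`.
  obtain ⟨f, hf, hfneg, hinj, hinj'⟩ :=
    S2.exists_injective_immersion (by omega) hσ.smooth hg hgneg
  exact ⟨f, isSmoothEmbedding_of_injective hf hinj hinj',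
    S2.exists_cohomologous_standardFormS2 (hσ.smooth.pullback hf) hfneg⟩
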